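/- For a real $n\times n$ matrix $A$ and a real $n\times m$ matrix $B$, the system $\dot x=Ax+Bu$ is called controllable if every state can be steered to every other state in finite time by a suitable input $u$. Let $\mathcal B(A)$ be the set of vectors $b\in\mathbb R^n$ for which $\dot x=Ax+bu$ (scalar input $u$) is controllable, let $\mathcal B'(A)$ be the set of diagonal matrices $B\in\mathbb R^{n\times n}$ for which $\dot x=Ax+Bu$ is controllable, and let $|b|$, $|B|$ denote the number of nonzero entries. There are an absolute constant $c'>0$ and a deterministic algorithm (a program for a random access machine with logarithmic, i.e. bit-length, cost) which, given any $n$ and any matrix $A\in\mathbb Q^{n\times n}$, terminates in time bounded by a polynomial in $n$ and the number of bits in the entries of $A$ (numerators and denominators in binary), and which, whenever $\mathcal B(A)$ is nonempty, returns an integer vector $b\in\mathcal B(A)$ such that, if $n\ge 2$, $$|b|\;\le\; c'\,\log n\cdot\min_{b'\in\mathcal B(A)}|b'| .$$ The same statement holds, with a possibly different constant, algorithm and polynomial, with $\mathcal B(A)$ replaced by $\mathcal B'(A)$: the algorithm returns an integer diagonal matrix $B\in\mathcal B'(A)$ such that, if $n\ge2$, $|B|\le c'\log n\cdot\min_{B'\in\mathcal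 B'(A)}|B'|$. -/

import Mathlib

/-! ### Controllability of linear time-invariant systems -/

/-- The system `x' = A x + B u` is controllable: every state can be steered to every other state in
some finite time by a (continuous) input.  (For these systems, admitting piecewise continuous or
integrable inputs, or prescribing the time `T`, gives the same notion.) -/
def Controllable {n m : ℕ} (A : Matrix (Fin n) (Fin n) ℝ) (B : Matrix (Fin n) (Fin m) ℝ) : Prop :=
  ∀ x₀ x₁ : Fin n → ℝ, ∃ T : ℝ, 0 < T ∧
    ∃ (u : ℝ → Fin m → ℝ) (x : ℝ → Fin n → ℝ),
      ContinuousOn u (Set.Icc 0 T) ∧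
      (∀ t ∈ Set.Icc 0 T,
        HasDerivWithinAt x (A.mulVec (x t) + B.mulVec (u t)) (Set.Icc 0 T) t) ∧
      x 0 = x₀ ∧ x T = x₁

/-- The vectors `b` that make `x' = A x + b u` (with a scalar input `u`) controllable. -/
def controllingVectors {n : ℕ} (A : Matrix (Fin n) (Fin n) ℝ) : Set (Fin n → ℝ) :=
  {b | Controllable A (Matrix.replicateCol (Fin 1) b)}

/-- The diagonal matrices `B` that make `x' = A x + B u` controllable. -/
def controllingDiagonals {n : ℕ} (A : Matrix (Fin n) (Fin n) ℝ) :
    Set (Matrix (Fin n) (Fin n) ℝ) :=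
  {B | B.IsDiag ∧ Controllable A B}

/-- The number of nonzero entries of a vector. -/
noncomputable def vecNonzeros {n : ℕ} (b : Fin n → ℝ) : ℕ := hammingNorm b

/-- The number of nonzero entries of a matrix. -/
noncomputable def matNonzeros {n : ℕ} (B : Matrix (Fin n) (Fin n) ℝ) : ℕ :=
  hammingNorm fun p : Fin n × Fin n => B p.1 p.2

/-! ### Random access machines with logarithmic cost

Deterministic structured programs over integer registers and integer arrays with computed
(indirect) addresses.  Every operation is charged according to the bit lengths of the integers
that it touches. -/

namespace RAM

/-- The number of bits of an integer, one of them for the sign. -/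
def len (z : ℤ) : ℕ := Nat.size z.natAbs + 1

/-- A memory: integer registers `reg 0, reg 1, …` and integer arrays `arr 0, arr 1, …`, the cells of
an array being addressed by a pair of integers. -/
structure State where
  reg : ℕ → ℤ
  arr : ℕ → ℤ → ℤ → ℤ

/-- The memory `s` with the value `v` written into register `i`. -/
def State.setReg (s : State) (i : ℕ) (v : ℤ) : State :=
  { s with reg := fun i' => if i' = i then v else s.reg i' }

/-- The memory `s` with the value `v` written into cell `(x, y)` of array `a`. -/
def State.setArr (s : State) (a : ℕ) (x y v : ℤ) : State :=
  { s with arr := fun a' x' y' => if a' = a ∧ x' = x ∧ y' = y then v else s.arr a' x' y' }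

/-- The elementary operations on integers. -/
inductive Op where
  | add
  | sub
  | mul
  | div
  | lt
  | eq

/-- The value of an elementary operation.  Division rounds down for positive divisors (division by
`0` gives `0`), and comparisons give `1` for true and `0` for false. -/
def Op.eval : Op → ℤ → ℤ → ℤ
  | .add, x, y => x + y
  | .sub, x, y => x - y
  | .mul, x, y => x * y
  | .div, x, y => x / y
  | .lt, x, y => if x < y then 1 else 0
  | .eq, x, y => if x = y then 1 else 0

/-- The cost of an elementary operation: linear in the bit lengths for additions, subtractions and
comparisons, and the product of the bit lengths for multiplications and divisions. -/
def Op.cost : Op → ℤ → ℤ → ℕ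
  | .add, x, y => len x + len y
  | .sub, x, y => len x + len y
  | .mul, x, y => len x * len y
  | .div, x, y => len x * len y
  | .lt, x, y => len x + len y
  | .eq, x, y => len x + len y

/-- Arithmetic expressions: literals, registers, array cells with computed address, operations. -/
inductive Expr where
  | lit (z : ℤ)
  | reg (i : ℕ)
  | arr (a : ℕ) (e f : Expr)
  | op (o : Op) (e f : Expr)

/-- The value of an expression. -/
def Expr.eval (s : State) : Expr → ℤ
  | .lit z => z
  | .reg i => s.reg i
  | .arr a e f => s.arr a (e.eval s) (f.eval s)
  | .op o e f => o.eval (e.eval s) (f.eval s)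

/-- The cost of evaluating an expression. -/
def Expr.cost (s : State) : Expr → ℕ
  | .lit z => len z
  | .reg i => len (s.reg i)
  | .arr a e f => e.cost s + f.cost s +
      (len (e.eval s) + len (f.eval s) + len (s.arr a (e.eval s) (f.eval s)))
  | .op o e f => e.cost s + f.cost s + o.cost (e.eval s) (f.eval s)

/-- Programs. -/
inductive Program where
  | skip
  /-- `reg i := e` -/
  | assign (i : ℕ) (e : Expr)
  /-- `arr a [e, f] := g` -/
  | store (a : ℕ) (e f g : Expr)
  | seq (P Q : Program)
  /-- if `e ≠ 0` then `P` else `Q` -/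
  | ite (e : Expr) (P Q : Program)
  /-- while `e ≠ 0` do `P` -/
  | loop (e : Expr) (P : Program)

/-- `Exec P s t s'`: the program `P`, started in the memory `s`, terminates after time `t` in the
memory `s'`. -/
inductive Exec : Program → State → ℕ → State → Prop
  | skip (s : State) : Exec .skip s 1 s
  | assign (i : ℕ) (e : Expr) (s : State) :
      Exec (.assign i e) s (e.cost s + len (e.eval s)) (s.setReg i (e.eval s))
  | store (a : ℕ) (e f g : Expr) (s : State) :
      Exec (.store a e f g) s
        (e.cost s + f.cost s + g.cost s + (len (e.eval s) + len (f.eval s) + len (g.eval s)))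
        (s.setArr a (e.eval s) (f.eval s) (g.eval s))
  | seq {P Q : Program} {s s' s'' : State} {t t' : ℕ} :
      Exec P s t s' → Exec Q s' t' s'' → Exec (.seq P Q) s (t + t') s''
  | ite_true {e : Expr} {P Q : Program} {s s' : State} {t : ℕ} :
      e.eval s ≠ 0 → Exec P s t s' → Exec (.ite e P Q) s (e.cost s + t) s'
  | ite_false {e : Expr} {P Q : Program} {s s' : State} {t : ℕ} :
      e.eval s = 0 → Exec Q s t s' → Exec (.ite e P Q) s (e.cost s + t) s'
  | loop_true {e : Expr} {P : Program} {s s' s'' : State} {t t' : ℕ} :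
      e.eval s ≠ 0 → Exec P s t s' → Exec (.loop e P) s' t' s'' →
        Exec (.loop e P) s (e.cost s + t + t') s''
  | loop_false {e : Expr} {P : Program} {s : State} :
      e.eval s = 0 → Exec (.loop e P) s (e.cost s) s

/-- The contents of an array that holds the `n × n` integer matrix `M`, and zeros elsewhere. -/
def matrixCells {n : ℕ} (M : Matrix (Fin n) (Fin n) ℤ) (x y : ℤ) : ℤ :=
  if h : (0 ≤ x ∧ x.toNat < n) ∧ (0 ≤ y ∧ y.toNat < n) then
    M ⟨x.toNat, h.1.2⟩ ⟨y.toNat, h.2.2⟩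
  else 0

/-- The initial memory for the rational matrix `A`: register `0` holds the dimension, array `0` the
numerators and array `1` the denominators of the entries (in lowest terms); all else is zero. -/
def input {n : ℕ} (A : Matrix (Fin n) (Fin n) ℚ) : State where
  reg := fun i => if i = 0 then (n : ℤ) else 0
  arr := fun a =>
    if a = 0 then matrixCells (A.map fun q => q.num)
    else if a = 1 then matrixCells (A.map fun q => (q.den : ℤ))
    else fun _ _ => 0

/-- The number of bits in the entries of a rational matrix (numerators and denominators). -/
def bits {n : ℕ} (A : Matrix (Fin n) (Fin n) ℚ) : ℕ :=
  ∑ i, ∑ j, (len (A i j).num + len ((A i j).den : ℤ))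

/-- The vector that is read off from array `2` (column `0`) as the output. -/
def outputVec (n : ℕ) (s : State) : Fin n → ℝ :=
  fun i => (s.arr 2 (i : ℤ) 0 : ℝ)

/-- The matrix that is read off from array `2` as the output. -/
def outputMat (n : ℕ) (s : State) : Matrix (Fin n) (Fin n) ℝ :=
  Matrix.of fun i j => (s.arr 2 (i : ℤ) (j : ℤ) : ℝ)

end RAM

/-! By Kalman's criterion (`controllable_iff`) the system is controllable exactly if the columns of
`B` generate the whole space under `A`, that is, `Kry A B = ⊤`; what remains is linear algebra and a
program. Vectors and diagonal matrices are treated together through `inject`, a vector being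
represented by `n` equal columns.

The approximation is greedy. Let `c` be a solution with `m` nonzero entries. The cyclic subspaces of
the basis vectors in its support add up to the whole space, so for every `b` one of them closes at
least the fraction `1/m` of the codimension of `Kry A (inject vec b)` (`exists_finrank_gain`). This
gain is realised by changing one coordinate of `b`. In the diagonal case any change that leaves a
nonzero entry will do. In the vector case the space is a cyclic module over the polynomials, and a
gcd argument finds a suitable increment among any `n + 1` scalars (`exists_cyc_add_smul`). After `k`
improvements the codimension is at most `n (1 - 1/m)^k`, hence zero as soon as `k > m log n`
(`Progress`, `exists_greedy_length`).

To keep numbers short and the set of increments finite, the search runs modulo primes `p`. The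
transfer goes both ways. Full rank modulo any prime gives full rank over the reals
(`Kry_real_eq_top_of_zmod`), so every vector that passes the test is a solution. Conversely, a real
solution can be moved, without enlarging its support, to integers between `0` and `n` while one
fixed minor of the controllability matrix stays nonzero. That minor has polynomially many bits, so
some prime of polynomial size, larger than `n`, does not divide it (`exists_good_prime`). The
program tries all primes below a bound computed from the input and keeps the best result.

Programs are written in the language `Cmd` of bounded loops, where `run` is a total function, and
are compiled to the machine (`Cmd.exec`). Polynomial time is mostly automatic: in a `Safe` program
every stored value respects the bound on the memory, which also bounds the loop counts
(`Cmd.Safe.exists_poly`). Only the measurement of the input size needs a cost analysis by hand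
(`inputSize_run`). `controlProgram_spec` assembles everything. -/

/-! ### Cyclic subspaces and the controllable subspace over a field. -/

section Krylov

open Matrix Polynomial

variable {F : Type*} [Field F] {n : ℕ} {ι : Type*}

/-- The cyclic subspace generated by `v` under `A`. -/
def cyc (A : Matrix (Fin n) (Fin n) F) (v : Fin n → F) : Submodule F (Fin n → F) :=
  Submodule.span F (Set.range fun k : ℕ => (A ^ k) *ᵥ v)

/-- The controllable subspace of the pair `(A, B)`. -/
def Kry (A : Matrix (Fin n) (Fin n) F) (B : Matrix (Fin n) ι F) : Submodule F (Fin n → F) :=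
  ⨆ j, cyc A (B.col j)

theorem self_mem_cyc (A : Matrix (Fin n) (Fin n) F) (v : Fin n → F) : v ∈ cyc A v :=
  Submodule.subset_span ⟨0, by simp⟩

theorem mulVec_mem_cyc {A : Matrix (Fin n) (Fin n) F} {v x : Fin n → F} (hx : x ∈ cyc A v) :
    A *ᵥ x ∈ cyc A v := by
  have : cyc A v ≤ (cyc A v).comap A.mulVecLin := by
    refine Submodule.span_le.2 ?_
    rintro _ ⟨k, rfl⟩
    exact Submodule.subset_span ⟨k + 1, by simp [pow_succ', mulVec_mulVec]⟩
  exact this hx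

theorem pow_mulVec_mem_of_invariant {A : Matrix (Fin n) (Fin n) F}
    {W : Submodule F (Fin n → F)} (hA : ∀ x ∈ W, A *ᵥ x ∈ W) {v : Fin n → F} (hv : v ∈ W) (k : ℕ) :
    (A ^ k) *ᵥ v ∈ W := by
  induction k with
  | zero => simpa
  | succ k ih => rw [pow_succ', ← mulVec_mulVec]; exact hA _ ih

theorem cyc_le {A : Matrix (Fin n) (Fin n) F} {W : Submodule F (Fin n → F)}
    (hA : ∀ x ∈ W, A *ᵥ x ∈ W) {v : Fin n → F} (hv : v ∈ W) : cyc A v ≤ W := by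
  refine Submodule.span_le.2 ?_
  rintro _ ⟨k, rfl⟩
  exact pow_mulVec_mem_of_invariant hA hv k

theorem cyc_zero (A : Matrix (Fin n) (Fin n) F) : cyc A 0 = ⊥ :=
  le_bot_iff.1 (cyc_le (by simp) (by simp))

theorem aeval_mulVec_mem_cyc (A : Matrix (Fin n) (Fin n) F) (v : Fin n → F) (q : F[X]) :
    (aeval A q) *ᵥ v ∈ cyc A v := by
  rw [aeval_eq_sum_range, sum_mulVec]
  refine Submodule.sum_mem _ fun k _ => ?_
  rw [smul_mulVec]
  exact Submodule.smul_mem _ _ (Submodule.subset_span ⟨k, rfl⟩)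

theorem exists_aeval_of_mem_cyc {A : Matrix (Fin n) (Fin n) F} {v x : Fin n → F}
    (hx : x ∈ cyc A v) : ∃ q : F[X], x = (aeval A q) *ᵥ v := by
  induction hx using Submodule.span_induction with
  | mem x h => obtain ⟨k, rfl⟩ := h; exact ⟨X ^ k, by simp⟩
  | zero => exact ⟨0, by simp⟩
  | add x y _ _ hx hy =>
    obtain ⟨p, rfl⟩ := hx; obtain ⟨q, rfl⟩ := hy
    exact ⟨p + q, by simp [add_mulVec]⟩
  | smul a x _ hx =>
    obtain ⟨p, rfl⟩ := hx
    exact ⟨a • p, by simp [smul_mulVec]⟩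

/-- By the Cayley-Hamilton theorem the first `n` powers suffice. -/
theorem cyc_eq_span_lt (A : Matrix (Fin n) (Fin n) F) (v : Fin n → F) :
    cyc A v = Submodule.span F (Set.range fun k : Fin n => (A ^ (k : ℕ)) *ᵥ v) := by
  refine le_antisymm (fun x hx => ?_) (Submodule.span_mono ?_)
  · obtain ⟨q, rfl⟩ := exists_aeval_of_mem_cyc hx
    -- For `n = 0` the characteristic polynomial is `1`, and reduction modulo it cannot bring
    -- `natDegree` below `n`.
    by_cases hn : n = 0
    · subst hn
      rw [Subsingleton.elim ((aeval A q) *ᵥ v) 0]; exact Submodule.zero_mem _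
    have h1 : aeval A q = aeval A (q %ₘ A.charpoly) := by
      conv_lhs => rw [← modByMonic_add_div q A.charpoly]
      simp [aeval_self_charpoly]
    have hdeg : (q %ₘ A.charpoly).natDegree < n := by
      have := natDegree_modByMonic_lt q A.charpoly_monic (by
        intro h
        have := A.charpoly_natDegree_eq_dim
        rw [h] at this; simp at this; omega)
      rwa [A.charpoly_natDegree_eq_dim, Fintype.card_fin] at this
    rw [h1, aeval_eq_sum_range' hdeg, sum_mulVec]
    refine Submodule.sum_mem _ fun k hk => ?_
    rw [smul_mulVec]
    exact Submodule.smul_mem _ _ (Submodule.subset_span ⟨⟨k, Finset.mem_range.1 hk⟩, rfl⟩)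
  · rintro _ ⟨k, rfl⟩; exact ⟨k, rfl⟩

theorem Kry_eq_span_lt (A : Matrix (Fin n) (Fin n) F) (B : Matrix (Fin n) ι F) :
    Kry A B = Submodule.span F
      (Set.range fun q : ι × Fin n => (A ^ (q.2 : ℕ)) *ᵥ B.col q.1) := by
  simp only [Kry, cyc_eq_span_lt, ← Submodule.span_iUnion]
  congr 1; ext x; simp

theorem mulVec_mem_Kry {A : Matrix (Fin n) (Fin n) F} {B : Matrix (Fin n) ι F} {x : Fin n → F}
    (hx : x ∈ Kry A B) : A *ᵥ x ∈ Kry A B := by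
  have : Kry A B ≤ (Kry A B).comap A.mulVecLin :=
    iSup_le fun j x hx => le_iSup (fun j => cyc A (B.col j)) j (mulVec_mem_cyc hx)
  exact this hx

theorem col_mem_Kry (A : Matrix (Fin n) (Fin n) F) (B : Matrix (Fin n) ι F) (j : ι) :
    B.col j ∈ Kry A B :=
  le_iSup (fun j => cyc A (B.col j)) j (self_mem_cyc _ _)

theorem Kry_le {A : Matrix (Fin n) (Fin n) F} {B : Matrix (Fin n) ι F}
    {W : Submodule F (Fin n → F)} (hA : ∀ x ∈ W, A *ᵥ x ∈ W) (hB : ∀ j, B.col j ∈ W) :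
    Kry A B ≤ W :=
  iSup_le fun j => cyc_le hA (hB j)

/-- Nonzero scaling of `A` does not change its invariant subspaces; this permits clearing
denominators. -/
theorem Kry_smul (A : Matrix (Fin n) (Fin n) F) (B : Matrix (Fin n) ι F) {a : F} (ha : a ≠ 0) :
    Kry (a • A) B = Kry A B := by
  refine le_antisymm (Kry_le (fun x hx => ?_) (col_mem_Kry A B))
    (Kry_le (fun x hx => ?_) (col_mem_Kry _ B))
  · rw [smul_mulVec]; exact Submodule.smul_mem _ _ (mulVec_mem_Kry hx)
  · have := Submodule.smul_mem _ a⁻¹ (mulVec_mem_Kry hx)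
    rwa [smul_mulVec, smul_smul, inv_mul_cancel₀ ha, one_smul] at this

/-- The input matrix given by a vector `b`: `diagonal b`, or, with `vec`, all columns are `b`. -/
def inject {R : Type*} [Zero R] (vec : Bool) (b : Fin n → R) : Matrix (Fin n) (Fin n) R :=
  Matrix.of fun i j => if vec = true ∨ i = j then b i else 0

theorem inject_vec_col {R : Type*} [Zero R] (b : Fin n → R) (j : Fin n) :
    (inject true b).col j = b := by
  ext i; simp [inject, Matrix.col]

theorem inject_diag_col {R : Type*} [Zero R] (b : Fin n → R) (j : Fin n) :
    (inject false b).col j = Pi.single j (b j) := by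
  ext i
  rcases eq_or_ne i j with rfl | h
  · simp [inject, Matrix.col]
  · simp [inject, Matrix.col, h]

theorem inject_map {R S : Type*} [Zero R] [Zero S] (vec : Bool) (b : Fin n → R) (f : R → S)
    (hf : f 0 = 0) : (inject vec b).map f = inject vec (f ∘ b) := by
  ext i j; simp only [inject, Matrix.map_apply, Matrix.of_apply]; split_ifs <;> simp [hf]

theorem Kry_inject_vec (A : Matrix (Fin n) (Fin n) F) (b : Fin n → F) :
    Kry A (inject true b) = cyc A b := by
  -- Without columns the supremum is empty, but for `n = 0` all subspaces coincide.
  rcases isEmpty_or_nonempty (Fin n) with h | h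
  · exact Subsingleton.elim _ _
  · simp only [Kry, inject_vec_col, ciSup_const]

/-- The left generator is `a / b` times the right one. Thus in the diagonal case only the support
counts, and replacing an entry by a nonzero one loses nothing. -/
theorem cyc_single_le {A : Matrix (Fin n) (Fin n) F} {j : Fin n} {a b : F} (h : b ≠ 0) :
    cyc A (Pi.single j a) ≤ cyc A (Pi.single j b) := by
  refine cyc_le (fun x hx => mulVec_mem_cyc hx) ?_
  have := Submodule.smul_mem _ (a * b⁻¹) (self_mem_cyc A (Pi.single j b))
  rwa [← Pi.single_smul, smul_eq_mul, mul_assoc, inv_mul_cancel₀ h, mul_one] at this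

end Krylov

/-! ### The greedy step over a field. -/

section Greedy

open Matrix Polynomial

variable {F : Type*} [Field F] {n : ℕ}

open Module in
/-- Some member of a covering family of subspaces closes at least the average part of the gap. -/
theorem exists_finrank_gain {V : Type*} [AddCommGroup V] [Module F V] [FiniteDimensional F V]
    {ι : Type*} (S : Finset ι) (W : ι → Submodule F V) (U : Submodule F V)
    (hS : ⊤ ≤ ⨆ i ∈ S, W i) (hU : U ≠ ⊤) :
    ∃ i ∈ S, finrank F V - finrank F U ≤ S.card * (finrank F (U ⊔ W i : Submodule F V) - finrank F U) := by
  classical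
  -- Submodularity of the dimension: the two spaces joined in `h4` both contain `U`, so the gain of
  -- a union is at most the sum of the gains.
  have key : ∀ T : Finset ι, finrank F (U ⊔ ⨆ i ∈ T, W i : Submodule F V) ≤
      finrank F U + ∑ i ∈ T, (finrank F (U ⊔ W i : Submodule F V) - finrank F U) := by
    intro T
    induction T using Finset.induction_on with
    | empty =>
      have h : U ⊔ ⨆ i ∈ (∅ : Finset ι), W i = U := by simp
      rw [h]; simp
    | insert a T ha ih =>
      rw [Finset.sum_insert ha, Finset.iSup_insert]
      have h1 := Submodule.finrank_sup_add_finrank_inf_eq (U ⊔ ⨆ i ∈ T, W i) (U ⊔ W a)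
      have h2 : finrank F U ≤ finrank F ((U ⊔ ⨆ i ∈ T, W i) ⊓ (U ⊔ W a) : Submodule F V) :=
        Submodule.finrank_mono (le_inf le_sup_left le_sup_left)
      have h3 : finrank F U ≤ finrank F (U ⊔ W a : Submodule F V) :=
        Submodule.finrank_mono le_sup_left
      have h4 : U ⊔ (W a ⊔ ⨆ i ∈ T, W i) = (U ⊔ ⨆ i ∈ T, W i) ⊔ (U ⊔ W a) := by
        rw [sup_sup_sup_comm, sup_idem, sup_comm (W a)]
      rw [h4]; omega
  by_contra! hcon
  have h1 := key S
  have h2 : U ⊔ ⨆ i ∈ S, W i = ⊤ := by rw [top_le_iff.1 hS, sup_top_eq]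
  rw [h2, finrank_top] at h1
  have h3 : finrank F U < finrank F V := Submodule.finrank_lt hU
  rcases S.eq_empty_or_nonempty with rfl | hne
  · simp at h1; omega
  have h4 : ∑ i ∈ S, S.card * (finrank F (U ⊔ W i : Submodule F V) - finrank F U)
      < ∑ i ∈ S, (finrank F V - finrank F U) := Finset.sum_lt_sum_of_nonempty hne hcon
  rw [← Finset.mul_sum, Finset.sum_const, smul_eq_mul] at h4
  have h5 := lt_of_mul_lt_mul_left h4 (Nat.zero_le _)
  omega

/-- Over a large enough field, some combination `b + t e` of elements of a cyclic module generates
the same submodule as `b` and `e`. -/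
theorem exists_cyc_add_smul (A : Matrix (Fin n) (Fin n) F) (T : Finset F) (hT : n < T.card)
    {c : Fin n → F} (hc : cyc A c = ⊤) (b e : Fin n → F) :
    ∃ t ∈ T, cyc A b ⊔ cyc A e ≤ cyc A (b + t • e) := by
  classical
  obtain ⟨β, hβ⟩ := exists_aeval_of_mem_cyc (hc ▸ Submodule.mem_top : b ∈ cyc A c)
  obtain ⟨ε, hε⟩ := exists_aeval_of_mem_cyc (hc ▸ Submodule.mem_top : e ∈ cyc A c)
  -- With the gcd `γ` split off, both `b` and `e` lie in the module generated by `γ(A) c`, so it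
  -- suffices to recover that single vector from `b + t e`.
  obtain ⟨γ, β', ε', hcop, h1, h2⟩ : ∃ γ β' ε' : F[X], IsCoprime β' ε' ∧ β = γ * β' ∧ ε = γ * ε' := by
    by_cases h0 : β = 0 ∧ ε = 0
    · exact ⟨0, 1, 1, isCoprime_one_left, by simp [h0.1], by simp [h0.2]⟩
    · obtain ⟨β', hb⟩ := EuclideanDomain.gcd_dvd_left β ε
      obtain ⟨ε', he⟩ := EuclideanDomain.gcd_dvd_right β ε
      refine ⟨EuclideanDomain.gcd β ε, β', ε', ?_, hb, he⟩
      have hg : EuclideanDomain.gcd β ε ≠ 0 := by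
        rw [Ne, EuclideanDomain.gcd_eq_zero_iff]; exact h0
      have := EuclideanDomain.gcd_eq_gcd_ab β ε
      refine ⟨EuclideanDomain.gcdA β ε, EuclideanDomain.gcdB β ε, mul_left_cancel₀ hg ?_⟩
      calc _ = EuclideanDomain.gcd β ε * β' * EuclideanDomain.gcdA β ε +
              EuclideanDomain.gcd β ε * ε' * EuclideanDomain.gcdB β ε := by ring
        _ = _ := by rw [← hb, ← he, ← this, mul_one]
  -- Every bad `t` yields a nonconstant factor `q t` of the characteristic polynomial. These factors
  -- are pairwise coprime, so their product divides a polynomial of degree `n`, and there are at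
  -- most `n` bad values.
  obtain ⟨t, ht, hct⟩ : ∃ t ∈ T, IsCoprime (β' + C t * ε') A.charpoly := by
    by_contra! hcon
    set q : F → F[X] := fun t => EuclideanDomain.gcd (β' + C t * ε') A.charpoly with hq
    have hm : A.charpoly ≠ 0 := A.charpoly_monic.ne_zero
    have hq0 : ∀ t, q t ≠ 0 := fun t h => hm (EuclideanDomain.gcd_eq_zero_iff.1 h).2
    have hqd : ∀ t ∈ T, 1 ≤ (q t).natDegree := by
      intro t ht
      by_contra h
      have hu : IsUnit (q t) := by
        rw [Polynomial.isUnit_iff_degree_eq_zero, Polynomial.degree_eq_natDegree (hq0 t)]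
        simp; omega
      exact hcon t ht (EuclideanDomain.gcd_isUnit_iff.1 hu)
    have hpair : Pairwise fun s t => IsCoprime (q s) (q t) := by
      intro s t hst
      refine IsCoprime.of_isCoprime_of_dvd_left (IsCoprime.of_isCoprime_of_dvd_right ?_
        (EuclideanDomain.gcd_dvd_left _ _)) (EuclideanDomain.gcd_dvd_left _ _)
      obtain ⟨u, v, huv⟩ := hcop
      have hne : s - t ≠ 0 := sub_ne_zero.2 hst
      have hC : C (s - t)⁻¹ * (C s - C t) = 1 := by
        rw [← C_sub, ← C_mul, inv_mul_cancel₀ hne, C_1]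
      -- Obtained by expressing `β'` and `ε'` through the combinations with parameters `s` and `t`,
      -- which divides by `s - t`, and substituting into `u β' + v ε' = 1`.
      refine ⟨C (s - t)⁻¹ * (v - u * C t), C (s - t)⁻¹ * (u * C s - v), ?_⟩
      linear_combination huv + (u * β' + v * ε') * hC
    have hdvd : ∏ t ∈ T, q t ∣ A.charpoly :=
      Finset.prod_dvd_of_coprime (hpair.set_pairwise _)
        fun t _ => EuclideanDomain.gcd_dvd_right _ _
    have hdeg := natDegree_le_of_dvd hdvd hm
    rw [natDegree_prod _ _ fun t _ => hq0 t, A.charpoly_natDegree_eq_dim, Fintype.card_fin] at hdeg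
    have := Finset.sum_le_sum hqd
    simp at this; omega
  refine ⟨t, ht, ?_⟩
  obtain ⟨u, w, huw⟩ := hct
  have hcomb : b + t • e = (aeval A (γ * (β' + C t * ε'))) *ᵥ c := by
    rw [hβ, hε, h1, h2, ← smul_mulVec, ← add_mulVec, ← map_smul, ← map_add, smul_eq_C_mul]
    congr 2; ring
  -- Multiply the Bézout identity by `γ`: by Cayley-Hamilton the multiple of the characteristic
  -- polynomial acts as zero.
  have hγ : (aeval A γ) *ᵥ c ∈ cyc A (b + t • e) := by
    have := aeval_mulVec_mem_cyc A (b + t • e) u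
    rw [hcomb, mulVec_mulVec, ← map_mul] at this
    have h3 : aeval A (u * (γ * (β' + C t * ε'))) = aeval A γ := by
      have : u * (γ * (β' + C t * ε')) = γ - γ * w * A.charpoly := by
        linear_combination γ * huw
      rw [this, map_sub, map_mul, aeval_self_charpoly, mul_zero, sub_zero]
    rw [h3] at this
    rwa [hcomb]
  have hmem : ∀ δ : F[X], (aeval A (γ * δ)) *ᵥ c ∈ cyc A (b + t • e) := by
    intro δ
    rw [mul_comm, map_mul, ← mulVec_mulVec]
    exact (cyc_le (fun x hx => mulVec_mem_cyc hx) hγ) (aeval_mulVec_mem_cyc A _ δ)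
  refine sup_le (cyc_le (fun x hx => mulVec_mem_cyc hx) ?_)
    (cyc_le (fun x hx => mulVec_mem_cyc hx) ?_)
  · have := hmem β'
    rwa [← h1, ← hβ] at this
  · have := hmem ε'
    rwa [← h2, ← hε] at this

open Module in
/-- The greedy step: if some `c` with at most `s` nonzero entries gives the whole space, then one
change of a coordinate of `b` reduces the codimension by a factor `1 - 1/s`. -/
theorem exists_greedy_step [DecidableEq F] (vec : Bool) (A : Matrix (Fin n) (Fin n) F) (T : Finset F)
    (hT : n < T.card) {s : ℕ} {c : Fin n → F} (hcs : hammingNorm c ≤ s)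
    (hc : Kry A (inject vec c) = ⊤) (b : Fin n → F) (hb : Kry A (inject vec b) ≠ ⊤) :
    ∃ i, ∃ t ∈ T, n - finrank F (Kry A (inject vec b)) ≤
      s * (finrank F (Kry A (inject vec (b + Pi.single i t))) -
        finrank F (Kry A (inject vec b))) := by
  classical
  set S : Finset (Fin n) := Finset.univ.filter fun i => c i ≠ 0 with hS
  have hScard : S.card ≤ s := hcs
  set W : Fin n → Submodule F (Fin n → F) := fun i => cyc A (Pi.single i 1) with hW
  -- The sum of the cyclic spaces of the basis vectors in the support of `c` is invariant and
  -- contains all columns of the input matrix, in both cases.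
  have hcover : ⊤ ≤ ⨆ i ∈ S, W i := by
    rw [← hc]
    have hinv : ∀ x ∈ ⨆ i ∈ S, W i, A *ᵥ x ∈ ⨆ i ∈ S, W i := by
      have : (⨆ i ∈ S, W i) ≤ (⨆ i ∈ S, W i).comap A.mulVecLin :=
        iSup₂_le fun i hi x hx =>
          (le_iSup₂ (f := fun i (_ : i ∈ S) => W i) i hi) (mulVec_mem_cyc hx)
      exact fun x hx => this hx
    have hcoord : ∀ i, Pi.single i (c i) ∈ ⨆ i ∈ S, W i := by
      intro i
      by_cases h : c i = 0
      · rw [h, Pi.single_zero]; exact Submodule.zero_mem _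
      · refine (le_iSup₂ (f := fun i (_ : i ∈ S) => W i) i (by simp [hS, h])) ?_
        exact cyc_single_le one_ne_zero (self_mem_cyc A _)
    refine Kry_le hinv fun j => ?_
    cases vec
    · rw [inject_diag_col]; exact hcoord j
    · rw [inject_vec_col]
      rw [← Finset.univ_sum_single c]
      exact Submodule.sum_mem _ fun i _ => hcoord i
  obtain ⟨i, -, hi⟩ := exists_finrank_gain S W (Kry A (inject vec b)) hcover hb
  have hle : ∃ t ∈ T, Kry A (inject vec b) ⊔ W i ≤ Kry A (inject vec (b + Pi.single i t)) := by
    cases vec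
    -- Only `t = -b i` is excluded, and `T` has more than `n ≥ 1` elements.
    · obtain ⟨t, htT, ht⟩ : ∃ t ∈ T, b i + t ≠ 0 := by
        by_contra! h
        have hsub : T ⊆ {-b i} := fun t ht => by
          simpa using eq_neg_of_add_eq_zero_right (h t ht)
        have h1 := Finset.card_le_card hsub
        have h2 : 0 < n := i.pos
        simp at h1; omega
      have hcol : ∀ j, cyc A (Pi.single j ((b + Pi.single i t : Fin n → F) j)) ≤
          Kry A (inject false (b + Pi.single i t)) := fun j => by
        have h := le_iSup (fun j => cyc A ((inject false (b + Pi.single i t)).col j)) j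
        beta_reduce at h
        rwa [inject_diag_col] at h
      have hne : (b + Pi.single i t : Fin n → F) i ≠ 0 := by
        rw [Pi.add_apply, Pi.single_eq_same]; exact ht
      refine ⟨t, htT, sup_le (iSup_le fun j => ?_) ?_⟩
      · refine le_trans ?_ (hcol j)
        rw [inject_diag_col]
        rcases eq_or_ne j i with rfl | hji
        · exact cyc_single_le hne
        · rw [Pi.add_apply, Pi.single_eq_of_ne hji, add_zero]
      · exact le_trans (cyc_single_le hne) (hcol i)
    -- Here `c` itself is a cyclic vector, which is what `exists_cyc_add_smul` requires.
    · rw [Kry_inject_vec] at hc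
      obtain ⟨t, htT, ht⟩ := exists_cyc_add_smul A T hT hc b (Pi.single i 1)
      refine ⟨t, htT, ?_⟩
      rw [Kry_inject_vec, Kry_inject_vec]
      convert ht using 3
      rw [← Pi.single_smul, smul_eq_mul, mul_one]
  obtain ⟨t, htT, ht⟩ := hle
  refine ⟨i, t, htT, ?_⟩
  rw [finrank_fin_fun] at hi
  refine hi.trans (Nat.mul_le_mul hScard (Nat.sub_le_sub_right (Submodule.finrank_mono ht) _))

end Greedy

/-! ### Kalman's rank criterion. -/

section ControllabilityCriterion

open Matrix Set

variable {n m : ℕ}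

/-- Trajectories that start at the origin stay in every invariant subspace containing the columns
of the input matrix. -/
theorem trajectory_mem_of_invariant {A : Matrix (Fin n) (Fin n) ℝ} {B : Matrix (Fin n) (Fin m) ℝ}
    {W : Submodule ℝ (Fin n → ℝ)} (hA : ∀ x ∈ W, A *ᵥ x ∈ W) (hB : ∀ v, B *ᵥ v ∈ W)
    {T : ℝ} (hT : 0 < T) {u : ℝ → Fin m → ℝ} {x : ℝ → Fin n → ℝ}
    (hx : ∀ t ∈ Icc 0 T, HasDerivWithinAt x (A *ᵥ x t + B *ᵥ u t) (Icc 0 T) t) (h0 : x 0 ∈ W) :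
    x T ∈ W := by
  obtain ⟨R, hR⟩ := W.mkQ.exists_rightInverse_of_surjective W.range_mkQ
  -- A projection with kernel `W`. Invariance gives `Q A = Q A Q` and `Q B = 0`, so `Q x` satisfies
  -- a homogeneous linear equation whatever the input is, and it vanishes by a Grönwall estimate.
  set Q : (Fin n → ℝ) →L[ℝ] (Fin n → ℝ) := LinearMap.toContinuousLinearMap (R ∘ₗ W.mkQ) with hQ
  have hQW : ∀ y, Q y = 0 ↔ y ∈ W := by
    intro y
    refine ⟨fun h => ?_, fun h => ?_⟩
    · have h1 : W.mkQ (R (W.mkQ y)) = 0 := by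
        have : R (W.mkQ y) = 0 := h
        rw [this, map_zero]
      have h2 : W.mkQ (R (W.mkQ y)) = W.mkQ y := LinearMap.congr_fun hR _
      rw [h2] at h1
      simpa using h1
    · have : W.mkQ y = 0 := by simpa using h
      change R (W.mkQ y) = 0
      rw [this, map_zero]
  have hQQ : ∀ y, y - Q y ∈ W := by
    intro y
    have h2 : W.mkQ (R (W.mkQ y)) = W.mkQ y := LinearMap.congr_fun hR _
    have : W.mkQ (y - R (W.mkQ y)) = 0 := by rw [map_sub, h2, sub_self]
    exact (Submodule.Quotient.mk_eq_zero W).1 this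
  set G : (Fin n → ℝ) →L[ℝ] (Fin n → ℝ) :=
    Q.comp (LinearMap.toContinuousLinearMap A.mulVecLin) with hG
  have hder : ∀ t ∈ Icc 0 T, HasDerivWithinAt (fun t => Q (x t)) (G (Q (x t))) (Icc 0 T) t := by
    intro t ht
    have h1 := Q.hasFDerivAt.comp_hasDerivWithinAt t (hx t ht)
    refine h1.congr_deriv ?_
    have h2 : Q (B *ᵥ u t) = 0 := (hQW _).2 (hB _)
    have h3 : Q (A *ᵥ (x t - Q (x t))) = 0 := (hQW _).2 (hA _ (hQQ _))
    rw [mulVec_sub, map_sub, sub_eq_zero] at h3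
    rw [map_add, h2, add_zero, h3]
    rfl
  have hz := eq_zero_of_abs_deriv_le_mul_abs_self_of_eq_zero_right (K := ‖G‖)
    (fun t ht => (hder t ht).continuousWithinAt)
    (fun t ht => (hder t ⟨ht.1, ht.2.le⟩).mono_of_mem_nhdsWithin (Icc_mem_nhdsGE_of_mem ht))
    ((hQW _).2 h0) (fun t _ => G.le_opNorm _) T ⟨hT.le, le_rfl⟩
  exact (hQW _).1 hz

theorem mulVec_mem_of_col_mem {B : Matrix (Fin n) (Fin m) ℝ} {W : Submodule ℝ (Fin n → ℝ)}
    (hB : ∀ j, B.col j ∈ W) (v : Fin m → ℝ) : B *ᵥ v ∈ W := by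
  rw [mulVec_eq_sum]
  exact Submodule.sum_mem _ fun j _ => by
    rw [op_smul_eq_smul]
    exact Submodule.smul_mem _ (v j) (hB j)

theorem Kry_eq_top_of_controllable {A : Matrix (Fin n) (Fin n) ℝ} {B : Matrix (Fin n) (Fin m) ℝ}
    (h : Controllable A B) : Kry A B = ⊤ := by
  refine eq_top_iff.2 fun y _ => ?_
  obtain ⟨T, hT, u, x, -, hx, h0, h1⟩ := h 0 y
  rw [← h1]
  exact trajectory_mem_of_invariant (fun x hx => mulVec_mem_Kry hx)
    (mulVec_mem_of_col_mem (col_mem_Kry A B)) hT hx (by rw [h0]; exact Submodule.zero_mem _)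

open NormedSpace in
theorem hasDerivAt_exp_neg_smul {E : Type*} [NormedAddCommGroup E] [NormedSpace ℝ E]
    [CompleteSpace E] (A : E →L[ℝ] E) (s : ℝ) :
    HasDerivAt (fun s : ℝ => exp ((-s) • A)) (-(exp ((-s) • A) * A)) s := by
  have h := (hasDerivAt_exp_smul_const A (-s)).scomp s (hasDerivAt_neg s)
  simpa [Function.comp_def] using h

open NormedSpace in
theorem exp_smul_mul_exp_neg_smul {E : Type*} [NormedAddCommGroup E] [NormedSpace ℝ E]
    [CompleteSpace E] (A : E →L[ℝ] E) (t : ℝ) : exp (t • A) * exp ((-t) • A) = 1 := by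
  let _ : NormedAlgebra ℚ (E →L[ℝ] E) := NormedAlgebra.restrictScalars ℚ ℝ _
  rw [neg_smul, ← NormedSpace.exp_add_of_commute (Commute.refl _).neg_right]; simp

open NormedSpace in
-- By variation of constants it is enough that `u ↦ ∫₀¹ exp(-sA) B u(s) ds` is onto. A functional
-- `f` that vanishes on the range satisfies `f (exp(-sA) B e_j) = 0` for all `s`; derivatives in `s`
-- show that `f ∘ exp(-sA)` kills the controllable subspace, hence everything, and `f = 0`.
theorem controllable_of_Kry_eq_top {A : Matrix (Fin n) (Fin n) ℝ} {B : Matrix (Fin n) (Fin m) ℝ}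
    (h : Kry A B = ⊤) : Controllable A B := by
  set A' : (Fin n → ℝ) →L[ℝ] (Fin n → ℝ) := LinearMap.toContinuousLinearMap A.mulVecLin with hA'
  set B' : (Fin m → ℝ) →L[ℝ] (Fin n → ℝ) := LinearMap.toContinuousLinearMap B.mulVecLin with hB'
  have hinv : ∀ t : ℝ, exp (t • A') * exp ((-t) • A') = 1 := by
    exact exp_smul_mul_exp_neg_smul A'
  have hinv' : ∀ t : ℝ, exp ((-t) • A') * exp (t • A') = 1 := by
    intro t; simpa using hinv (-t)
  have hcont : Continuous fun s : ℝ => exp ((-s) • A') :=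
    continuous_iff_continuousAt.2 fun s => (hasDerivAt_exp_neg_smul A' s).continuousAt
  have hcu : ∀ u : ℝ → Fin m → ℝ, Continuous u →
      Continuous fun s => exp ((-s) • A') (B' (u s)) :=
    fun u hu => hcont.clm_apply (B'.continuous.comp hu)
  let R : C(ℝ, Fin m → ℝ) →ₗ[ℝ] (Fin n → ℝ) :=
    { toFun := fun u => ∫ s in (0 : ℝ)..1, exp ((-s) • A') (B' (u s))
      map_add' := fun u v => by
        rw [← intervalIntegral.integral_add ((hcu _ u.continuous).intervalIntegrable _ _)
          ((hcu _ v.continuous).intervalIntegrable _ _)]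
        simp
      map_smul' := fun a u => by
        rw [RingHom.id_apply, ← intervalIntegral.integral_smul]
        simp }
  have hR : LinearMap.range R = ⊤ := by
    by_contra hne
    obtain ⟨f, hf0, hf⟩ := Submodule.exists_le_ker_of_lt_top _ (lt_top_iff_ne_top.2 hne)
    set f' : (Fin n → ℝ) →L[ℝ] ℝ := LinearMap.toContinuousLinearMap f with hf'
    have hg : ∀ k : ℕ, ∀ v, Continuous fun s : ℝ => f' ((exp ((-s) • A') * A' ^ k) (B' v)) :=
      fun k v => f'.continuous.comp ((hcont.mul continuous_const).clm_apply continuous_const)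
    have hzero : ∀ j, ∀ s ∈ Icc (0 : ℝ) 1, f' (exp ((-s) • A') (B' (Pi.single j 1))) = 0 := by
      intro j
      have hgj : Continuous fun s : ℝ => f' (exp ((-s) • A') (B' (Pi.single j 1))) := by
        simpa using hg 0 (Pi.single j 1)
      -- This test input turns the integral into that of the square of the function in question.
      let u : C(ℝ, Fin m → ℝ) :=
        ⟨fun s => f' (exp ((-s) • A') (B' (Pi.single j 1))) • Pi.single j (1 : ℝ),
          hgj.smul continuous_const⟩
      have h1 : f' (R u) = 0 := hf ⟨u, rfl⟩
      have h2 : f' (R u) = ∫ s in (0 : ℝ)..1, f' (exp ((-s) • A') (B' (u s))) :=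
        (f'.intervalIntegral_comp_comm ((hcu _ u.continuous).intervalIntegrable _ _)).symm
      have h3 : ∀ s, f' (exp ((-s) • A') (B' (u s))) =
          f' (exp ((-s) • A') (B' (Pi.single j 1))) ^ 2 := by
        intro s
        change f' (exp ((-s) • A') (B' (f' (exp ((-s) • A') (B' (Pi.single j 1))) •
          Pi.single j (1 : ℝ)))) = _
        rw [map_smul, map_smul, map_smul, smul_eq_mul, sq]
      rw [h1] at h2
      simp only [h3] at h2
      intro s hs
      by_contra hne
      have := intervalIntegral.integral_pos one_pos (hgj.pow 2).continuousOn
        (fun _ _ => sq_nonneg _) ⟨s, hs, sq_pos_iff.2 hne⟩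
      simp only [Pi.pow_apply] at this
      linarith
    have hk : ∀ j, ∀ k : ℕ, ∀ s ∈ Ioo (0 : ℝ) 1,
        f' ((exp ((-s) • A') * A' ^ k) (B' (Pi.single j 1))) = 0 := by
      intro j k
      induction k with
      | zero => intro s hs; simpa using hzero j s ⟨hs.1.le, hs.2.le⟩
      | succ k ih =>
        intro s hs
        have h1 : HasDerivAt (fun s : ℝ => f' ((exp ((-s) • A') * A' ^ k) (B' (Pi.single j 1))))
            (f' ((-(exp ((-s) • A') * A') * A' ^ k) (B' (Pi.single j 1)))) s := by
          have := ((hasDerivAt_exp_neg_smul A' s).mul_const (A' ^ k)).clm_apply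
            (hasDerivAt_const s (B' (Pi.single j 1)))
          simp only [map_zero, add_zero] at this
          exact f'.hasFDerivAt.comp_hasDerivAt s this
        have h2 : HasDerivAt (fun s : ℝ => f' ((exp ((-s) • A') * A' ^ k) (B' (Pi.single j 1))))
            0 s := by
          refine (hasDerivAt_const s (0 : ℝ)).congr_of_eventuallyEq ?_
          filter_upwards [Ioo_mem_nhds hs.1 hs.2] with r hr using ih r hr
        have h3 := h1.unique h2
        have h4 : -(exp ((-s) • A') * A') * A' ^ k = -(exp ((-s) • A') * A' ^ (k + 1)) := by
          rw [pow_succ']; rfl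
        rw [h4] at h3
        exact neg_eq_zero.1 ((map_neg f' _).symm.trans h3)
    -- Any interior time would do: the identities in `hk` come from differentiation and are
    -- available on the open interval only.
    set q : (Fin n → ℝ) →L[ℝ] ℝ := f'.comp (exp ((-(1 / 2 : ℝ)) • A')) with hq
    have hpow : ∀ (k : ℕ) v, (A' ^ k) v = (A ^ k) *ᵥ v := by
      intro k
      induction k with
      | zero => intro v; simp
      | succ k ih =>
        intro v
        rw [pow_succ', pow_succ', ← mulVec_mulVec, ← ih]; rfl
    have hker : Kry A B ≤ LinearMap.ker (q : (Fin n → ℝ) →ₗ[ℝ] ℝ) := by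
      refine iSup_le fun j => Submodule.span_le.2 ?_
      rintro _ ⟨k, rfl⟩
      have := hk j k (1 / 2) (by constructor <;> norm_num)
      have hc : B' (Pi.single j 1) = B.col j := by
        change B *ᵥ _ = _
        simp
      rw [mul_apply_eq_comp, hpow, hc] at this
      exact this
    rw [h] at hker
    refine hf0 (LinearMap.ext fun y => ?_)
    have h1 : exp ((-(1 / 2 : ℝ)) • A') (exp ((1 / 2 : ℝ) • A') y) = y := by
      have := hinv' (1 / 2)
      exact congrArg (fun L : (Fin n → ℝ) →L[ℝ] (Fin n → ℝ) => L y) this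
    have h2 : q (exp ((1 / 2 : ℝ) • A') y) = 0 := hker Submodule.mem_top
    rw [hq, ContinuousLinearMap.comp_apply, h1] at h2
    exact h2
  intro x₀ x₁
  -- The condition `x 1 = x₁` in the variation of constants formula, solved for the integral.
  obtain ⟨u, hu⟩ : exp ((-1 : ℝ) • A') x₁ - x₀ ∈ LinearMap.range R := hR ▸ Submodule.mem_top
  refine ⟨1, one_pos, u,
    fun t => exp (t • A') (x₀ + ∫ s in (0 : ℝ)..t, exp ((-s) • A') (B' (u s))),
    u.continuous.continuousOn, fun t _ => ?_, by simp, ?_⟩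
  · have h1 := (hcu _ u.continuous).integral_hasStrictDerivAt 0 t
    have h2 := (hasDerivAt_exp_smul_const' A' t).clm_apply (h1.hasDerivAt.const_add x₀)
    refine (h2.congr_deriv ?_).hasDerivWithinAt
    have h3 : exp (t • A') (exp ((-t) • A') (B' (u t))) = B' (u t) :=
      congrArg (fun L : (Fin n → ℝ) →L[ℝ] (Fin n → ℝ) => L (B' (u t))) (hinv t)
    rw [h3]; rfl
  · have h1 : x₀ + R u = exp ((-1 : ℝ) • A') x₁ := by rw [hu]; abel
    have h2 : exp ((1 : ℝ) • A') (exp ((-1 : ℝ) • A') x₁) = x₁ :=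
      congrArg (fun L : (Fin n → ℝ) →L[ℝ] (Fin n → ℝ) => L x₁) (hinv 1)
    change exp ((1 : ℝ) • A') (x₀ + R u) = x₁
    rw [h1, h2]

theorem controllable_iff {A : Matrix (Fin n) (Fin n) ℝ} {B : Matrix (Fin n) (Fin m) ℝ} :
    Controllable A B ↔ Kry A B = ⊤ :=
  ⟨Kry_eq_top_of_controllable, controllable_of_Kry_eq_top⟩

end ControllabilityCriterion

/-! ### Transfer between the reals, the integers and prime fields. -/

section Transfer

open Matrix Polynomial

variable {n : ℕ}

/-- The controllability matrix, with columns `A ^ k B e_j` for `k < n`. -/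
def ctrb {R ι : Type*} [CommRing R] (A : Matrix (Fin n) (Fin n) R) (B : Matrix (Fin n) ι R) :
    Matrix (Fin n) (ι × Fin n) R :=
  Matrix.of fun i q => (A ^ (q.2 : ℕ) * B) i q.1

theorem ctrb_map {R S ι : Type*} [CommRing R] [CommRing S] (f : R →+* S)
    (A : Matrix (Fin n) (Fin n) R) (B : Matrix (Fin n) ι R) :
    (ctrb A B).map f = ctrb (A.map f) (B.map f) := by
  ext i q
  change f ((A ^ (q.2 : ℕ) * B) i q.1) = (f.mapMatrix A ^ (q.2 : ℕ) * B.map f) i q.1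
  rw [← map_pow, RingHom.mapMatrix_apply, ← Matrix.map_mul, Matrix.map_apply]

theorem Kry_eq_range_ctrb {F ι : Type*} [Field F] [Fintype ι] (A : Matrix (Fin n) (Fin n) F)
    (B : Matrix (Fin n) ι F) : Kry A B = LinearMap.range (ctrb A B).mulVecLin := by
  rw [range_mulVecLin, Kry_eq_span_lt]
  rfl

/-- A right inverse is the form of the rank condition that can be lifted from a prime field to the
integers. -/
theorem Kry_eq_top_iff {F ι : Type*} [Field F] [Fintype ι] (A : Matrix (Fin n) (Fin n) F)
    (B : Matrix (Fin n) ι F) : Kry A B = ⊤ ↔ ∃ R : Matrix (ι × Fin n) (Fin n) F, ctrb A B * R = 1 := by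
  classical
  rw [Kry_eq_range_ctrb, LinearMap.range_eq_top, ← mulVec_surjective_iff_exists_right_inverse]
  rfl

theorem Kry_eq_top_of_det_ne_zero {F ι κ : Type*} [Field F] [Fintype ι] [Fintype κ]
    (A : Matrix (Fin n) (Fin n) F) (B : Matrix (Fin n) ι F) (R : Matrix (ι × Fin n) (Fin n) F)
    (h : (ctrb A B * R).det ≠ 0) : Kry A B = ⊤ := by
  refine (Kry_eq_top_iff A B).2 ⟨R * (ctrb A B * R)⁻¹, ?_⟩
  rw [← Matrix.mul_assoc, mul_nonsing_inv _ h.isUnit]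

/-- Controllability modulo a prime implies controllability over the reals. -/
theorem Kry_real_eq_top_of_zmod {ι : Type*} [Fintype ι] {p : ℕ} [Fact p.Prime]
    (A : Matrix (Fin n) (Fin n) ℤ) (B : Matrix (Fin n) ι ℤ)
    (h : Kry (A.map (Int.cast : ℤ → ZMod p)) (B.map Int.cast) = ⊤) :
    Kry (A.map (Int.cast : ℤ → ℝ)) (B.map Int.cast) = ⊤ := by
  obtain ⟨R, hR⟩ := (Kry_eq_top_iff _ _).1 h
  -- With integer representatives of the right inverse the determinant of the product is `1` modulo
  -- `p`, hence a nonzero integer, and it stays nonzero in `ℝ`.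
  set R' : Matrix (ι × Fin n) (Fin n) ℤ := R.map fun x => (x.val : ℤ) with hR'
  have hRR : R'.map (Int.castRingHom (ZMod p)) = R := by
    ext i j; simp [hR']
  have hdet : ((ctrb A B * R').det : ZMod p) = 1 := by
    have h1 := RingHom.map_det (Int.castRingHom (ZMod p)) (ctrb A B * R')
    rw [RingHom.mapMatrix_apply, Matrix.map_mul, hRR, ctrb_map] at h1
    have h2 : ctrb (A.map (Int.castRingHom (ZMod p))) (B.map (Int.castRingHom (ZMod p))) * R = 1 :=
      hR
    rw [h2, det_one] at h1
    exact h1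
  have hne : (ctrb A B * R').det ≠ 0 := by
    intro h0
    rw [h0] at hdet
    simp at hdet
  refine Kry_eq_top_of_det_ne_zero (κ := ι) _ _ (R'.map (Int.castRingHom ℝ)) ?_
  have h1 := RingHom.map_det (Int.castRingHom ℝ) (ctrb A B * R')
  rw [RingHom.mapMatrix_apply, Matrix.map_mul, ctrb_map] at h1
  intro h0
  have h2 : (ctrb (A.map (Int.castRingHom ℝ)) (B.map (Int.castRingHom ℝ)) *
    R'.map (Int.castRingHom ℝ)).det = 0 := h0
  rw [h2] at h1
  exact hne (Int.cast_injective (α := ℝ) (by simpa using h1))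

/-- Choose `n` independent columns. Once this choice is fixed, the rank condition is implied by the
nonvanishing of one polynomial in the entries of the input vector. -/
theorem exists_det_submatrix_ne_zero {F κ : Type*} [Field F] [Fintype κ]
    (K : Matrix (Fin n) κ F) (h : LinearMap.range K.mulVecLin = ⊤) :
    ∃ e : Fin n → κ, (K.submatrix id e).det ≠ 0 := by
  rw [range_mulVecLin] at h
  obtain ⟨κ', a, ha, hspan, hli⟩ := exists_linearIndependent' F K.col
  rw [h] at hspan
  have : Fintype κ' := Fintype.ofInjective a ha
  let bas : Module.Basis κ' F (Fin n → F) := Module.Basis.mk hli hspan.ge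
  have hcard : Fintype.card κ' = n := by
    rw [← Module.finrank_eq_card_basis bas, Module.finrank_fin_fun]
  let f : Fin n ≃ κ' := (Fintype.equivFinOfCardEq hcard).symm
  refine ⟨a ∘ f, ?_⟩
  have h2 : LinearIndependent F (K.submatrix id (a ∘ f)).col := hli.comp f f.injective
  exact ((Matrix.isUnit_iff_isUnit_det _).1 (linearIndependent_cols_iff_isUnit.1 h2)).ne_zero

/-- The determinant is a polynomial of degree at most `n` in the parameter and cannot vanish at `n +
1` points unless it is zero. The shift by `a` is there because the parameter is an increment to a
coordinate with value `a`, whose new value is to be `m`. -/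
theorem exists_natCast_det_ne_zero (M₀ M₁ : Matrix (Fin n) (Fin n) ℝ) (a t₀ : ℝ)
    (h : (t₀ • M₁ + M₀).det ≠ 0) : ∃ m : ℕ, m ≤ n ∧ (((m : ℝ) - a) • M₁ + M₀).det ≠ 0 := by
  set P : ℝ[X] := det ((X : ℝ[X]) • M₁.map C + M₀.map C) with hP
  have heval : ∀ t, P.eval t = (t • M₁ + M₀).det := by
    intro t
    rw [hP, ← coe_evalRingHom, RingHom.map_det]
    congr 1
    ext i j
    simp
    ring
  by_contra! hcon
  have hP0 : P = 0 := by
    refine eq_zero_of_natDegree_lt_card_of_eval_eq_zero P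
      (f := fun m : Fin (n + 1) => ((m : ℕ) : ℝ) - a) ?_ ?_ ?_
    · intro x y hxy
      simpa [Fin.ext_iff] using hxy
    · intro m
      rw [heval]; exact hcon m (Nat.lt_succ_iff.1 m.2)
    · have := natDegree_det_X_add_C_le M₁ M₀
      rw [← hP] at this
      simp only [Fintype.card_fin] at this ⊢
      omega
  apply h
  rw [← heval, hP0, eval_zero]

theorem ctrb_inject_add {R : Type*} [CommRing R] (vec : Bool) (A : Matrix (Fin n) (Fin n) R)
    (b : Fin n → R) (i : Fin n) (t : R) :
    ctrb A (inject vec (b + Pi.single i t)) =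
      t • ctrb A (inject vec (Pi.single i 1)) + ctrb A (inject vec b) := by
  have : inject vec (b + Pi.single i t) = t • inject vec (Pi.single i 1) + inject vec b := by
    ext k l
    by_cases hk : k = i
    · subst hk; by_cases h : vec = true ∨ k = l <;> simp [inject, h, add_comm]
    · by_cases h : vec = true ∨ k = l <;> simp [inject, h, hk]
  ext k q
  simp [ctrb, this, Matrix.mul_add]

/-- The coordinates are replaced one at a time, the minor depending affinely on the matrix
increment. Zero coordinates are left alone, so that the support does not grow. -/
theorem exists_nat_vector_det_ne_zero (vec : Bool) (A : Matrix (Fin n) (Fin n) ℝ) (b : Fin n → ℝ)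
    (e : Fin n → Fin n × Fin n) (h : ((ctrb A (inject vec b)).submatrix id e).det ≠ 0) :
    ∃ m : Fin n → ℕ, (∀ i, m i ≤ n) ∧ (∀ i, b i = 0 → m i = 0) ∧
      ((ctrb A (inject vec fun i => (m i : ℝ))).submatrix id e).det ≠ 0 := by
  have key : ∀ T : Finset (Fin n), ∃ b' : Fin n → ℝ, (∀ i, b i = 0 → b' i = 0) ∧
      (∀ i ∈ T, ∃ m : ℕ, m ≤ n ∧ b' i = m) ∧
      ((ctrb A (inject vec b')).submatrix id e).det ≠ 0 := by
    intro T
    induction T using Finset.induction_on with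
    | empty => exact ⟨b, by simp, by simp, h⟩
    | insert i T hi ih =>
      obtain ⟨b', h1, h2, h3⟩ := ih
      by_cases h0 : b i = 0
      · refine ⟨b', h1, fun j hj => ?_, h3⟩
        rcases Finset.mem_insert.1 hj with rfl | hj
        · exact ⟨0, Nat.zero_le _, by simp [h1 _ h0]⟩
        · exact h2 j hj
      · obtain ⟨m, hm, hdet⟩ := exists_natCast_det_ne_zero
          ((ctrb A (inject vec b')).submatrix id e)
          ((ctrb A (inject vec (Pi.single i 1))).submatrix id e) (b' i) 0 (by simpa using h3)
        refine ⟨b' + Pi.single i (m - b' i), fun j hj => ?_, fun j hj => ?_, ?_⟩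
        · have : j ≠ i := by rintro rfl; exact h0 hj
          simp [this, h1 j hj]
        · rcases Finset.mem_insert.1 hj with rfl | hj
          · exact ⟨m, hm, by simp⟩
          · have : j ≠ i := fun h => hi (h ▸ hj)
            simpa [this] using h2 j hj
        · rw [ctrb_inject_add]; exact hdet
  obtain ⟨b', h1, h2, h3⟩ := key Finset.univ
  choose m hm hb using fun i => h2 i (Finset.mem_univ i)
  refine ⟨m, hm, fun i hi => ?_, ?_⟩
  · have := hb i
    rw [h1 i hi] at this
    exact_mod_cast this.symm
  · have : b' = fun i => (m i : ℝ) := funext hb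
    rwa [this] at h3

theorem abs_pow_apply_le (A : Matrix (Fin n) (Fin n) ℤ) {a : ℤ} (hA : ∀ i j, |A i j| ≤ a)
    (k : ℕ) (i j : Fin n) : |(A ^ k) i j| ≤ (n * a) ^ k := by
  induction k generalizing i j with
  | zero => by_cases h : i = j <;> simp [h]
  | succ k ih =>
    rw [pow_succ, Matrix.mul_apply]
    refine (Finset.abs_sum_le_sum_abs _ _).trans ?_
    have : ∀ l ∈ Finset.univ, |(A ^ k) i l * A l j| ≤ (n * a) ^ k * a := fun l _ => by
      rw [abs_mul]
      exact mul_le_mul (ih _ _) (hA _ _) (abs_nonneg _) ((abs_nonneg _).trans (ih i l))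
    refine (Finset.sum_le_card_nsmul _ _ _ this).trans (le_of_eq ?_)
    simp; ring

/-- A crude Leibniz bound; all that matters is that its logarithm is polynomial in `n` and the bit
length of `a`. -/
theorem abs_det_ctrb_le (vec : Bool) (A : Matrix (Fin n) (Fin n) ℤ) {a : ℤ} (ha : 1 ≤ a)
    (hA : ∀ i j, |A i j| ≤ a) (m : Fin n → ℕ) (hm : ∀ i, m i ≤ n) (e : Fin n → Fin n × Fin n) :
    |((ctrb A (inject vec fun i => (m i : ℤ))).submatrix id e).det| ≤
      n.factorial * (n * n * (n * a) ^ n) ^ n := by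
  have hentry : ∀ i j, |(ctrb A (inject vec fun i => (m i : ℤ))).submatrix id e i j| ≤
      n * n * (n * a) ^ n := by
    intro i j
    have hn : (1 : ℤ) ≤ n := by exact_mod_cast i.pos
    have hna : (1 : ℤ) ≤ n * a := one_le_mul_of_one_le_of_one_le hn ha
    simp only [submatrix_apply, ctrb, of_apply, Matrix.mul_apply, id]
    refine (Finset.abs_sum_le_sum_abs _ _).trans ?_
    have : ∀ l ∈ Finset.univ, |(A ^ ((e j).2 : ℕ)) i l * inject vec (fun i => (m i : ℤ)) l (e j).1|
        ≤ (n * a) ^ n * n := fun l _ => by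
      rw [abs_mul]
      refine mul_le_mul ((abs_pow_apply_le A hA _ _ _).trans
        (pow_le_pow_right₀ hna (e j).2.2.le)) ?_ (abs_nonneg _) (by positivity)
      simp only [inject, of_apply]
      split_ifs
      · rw [abs_of_nonneg (by positivity)]; exact_mod_cast hm l
      · simp
    refine (Finset.sum_le_card_nsmul _ _ _ this).trans (le_of_eq ?_)
    simp; ring
  have := Matrix.det_le (abv := AbsoluteValue.abs) hentry
  simpa using this

end Transfer

/-! ### A small prime that does not divide a given integer. -/

section Primes

/-- Let `x = 16 (L + 1)²`. If all primes up to `x` divide `D`, then `2 ^ π(x) ≤ |D|` and `π(x) < L`.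
Chebyshev's bound `2 ^ x ≤ (x + 1) lcm(1, …, x)` together with `lcm(1, …, x) ≤ x ^ π(x)` then gives
`2 ^ x ≤ (x + 1) ^ L`. As `x + 1 < 2 ^ (10 (L + 1))`, this means `x ≤ 10 (L + 1) L`, which is false.
-/
theorem exists_prime_not_dvd {L : ℕ} {D : ℤ} (h0 : D ≠ 0) (hD : |D| < 2 ^ L) :
    ∃ p : ℕ, p.Prime ∧ p ≤ 16 * (L + 1) ^ 2 ∧ ¬ (p : ℤ) ∣ D := by
  by_contra! hcon
  set x := 16 * (L + 1) ^ 2 with hx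
  have hdvd : ∏ p ∈ Nat.primesLE x, p ∣ D.natAbs := by
    refine Finset.prod_primes_dvd _ (fun p hp => (Nat.prime_of_mem_primesLE hp).prime) fun p hp => ?_
    exact Int.natCast_dvd.1 (hcon p (Nat.prime_of_mem_primesLE hp) (Nat.le_of_mem_primesLE hp))
  have hle := Nat.le_of_dvd (Int.natAbs_pos.2 h0) hdvd
  have hlt : D.natAbs < 2 ^ L := by zify; exact hD
  have h2 : 2 ^ (Nat.primesLE x).card ≤ ∏ p ∈ Nat.primesLE x, p := by
    rw [← Finset.prod_const]
    exact Finset.prod_le_prod' fun p hp => (Nat.prime_of_mem_primesLE hp).two_le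
  have hcard : (Nat.primesLE x).card < L :=
    (Nat.pow_lt_pow_iff_right one_lt_two).1 (h2.trans_lt (hle.trans_lt hlt))
  have hx0 : x ≠ 0 := by positivity
  have h3 : Nat.lcmUpto x ≤ x ^ (Nat.primesLE x).card := by
    rw [Nat.lcmUpto_eq_prod_pow_log, ← Finset.prod_const]
    exact Finset.prod_le_prod' fun p _ => Nat.pow_log_le_self p hx0
  have h4 : 2 ^ x ≤ (x + 1) ^ L := calc
    2 ^ x ≤ (x + 1) * Nat.lcmUpto x := Chebyshev.two_pow_le_mul_lcmUpto x
    _ ≤ (x + 1) * (x + 1) ^ (Nat.primesLE x).card :=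
      Nat.mul_le_mul_left _ (h3.trans (Nat.pow_le_pow_left (Nat.le_succ _) _))
    _ = (x + 1) ^ ((Nat.primesLE x).card + 1) := by ring
    _ ≤ (x + 1) ^ L := Nat.pow_le_pow_right (Nat.succ_pos _) hcard
  have h5 : x + 1 < 2 ^ (10 * (L + 1)) := calc
    x + 1 ≤ (5 * (L + 1)) ^ 2 := by rw [hx]; nlinarith
    _ < (2 ^ (5 * (L + 1))) ^ 2 := Nat.pow_lt_pow_left Nat.lt_two_pow_self (by norm_num)
    _ = 2 ^ (10 * (L + 1)) := by rw [← pow_mul]; ring_nf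
  have h6 : (x + 1) ^ L ≤ 2 ^ (10 * (L + 1) * L) := by
    rw [pow_mul]; exact Nat.pow_le_pow_left h5.le _
  have h7 := (Nat.pow_le_pow_iff_right one_lt_two).1 (h4.trans h6)
  rw [hx] at h7
  nlinarith

end Primes

/-! ### A prime modulo which solutions are as sparse as over the reals. -/

section GoodPrime

open Matrix

/-- A bound for the primes that have to be tried. -/
def primeBound (w : ℕ) : ℕ := 16 * ((w + 2) ^ 3 + 1) ^ 2 + 1

/-- Replace `b` by a small integer vector whose support is no larger and for which a minor `D` is
nonzero; a prime that does not divide `D` preserves this minor. -/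
theorem exists_good_prime {n β w : ℕ} (vec : Bool) (A : Matrix (Fin n) (Fin n) ℤ)
    (hA : ∀ i j, |A i j| ≤ 2 ^ β) (hw : n + β ≤ w) (b : Fin n → ℝ)
    (hb : Kry (A.map (Int.cast : ℤ → ℝ)) (inject vec b) = ⊤) :
    ∃ p : ℕ, p.Prime ∧ n < p ∧ p < primeBound w ∧ ∀ [Fact p.Prime], ∃ c : Fin n → ZMod p,
      hammingNorm c ≤ hammingNorm b ∧
      Kry (A.map (Int.cast : ℤ → ZMod p)) (inject vec c) = ⊤ := by
  rw [Kry_eq_range_ctrb] at hb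
  obtain ⟨e, he⟩ := exists_det_submatrix_ne_zero _ hb
  obtain ⟨m, hm, hmb, hdet⟩ := exists_nat_vector_det_ne_zero vec _ b e he
  set D := ((ctrb A (inject vec fun i => (m i : ℤ))).submatrix id e).det with hD
  -- The same integer `D` specialises to the minor over `ℝ` and to the one over `ZMod p`.
  have hmap : ∀ {R : Type} [CommRing R],
      ((ctrb (A.map (Int.cast : ℤ → R)) (inject vec fun i => (m i : R))).submatrix id e).det =
      (D : R) := by
    intro R _
    have h1 := RingHom.map_det (Int.castRingHom R)
      ((ctrb A (inject vec fun i => (m i : ℤ))).submatrix id e)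
    rw [RingHom.mapMatrix_apply, ← submatrix_map, ctrb_map,
      inject_map vec _ (Int.castRingHom R) (map_zero _)] at h1
    rw [hD]
    simp only [eq_intCast] at h1
    rw [h1]
    simp [Function.comp_def]
  have hD0 : D ≠ 0 := by
    intro h0
    rw [hmap, h0] at hdet
    simp at hdet
  have hfac : ((n.factorial : ℕ) : ℤ) ≤ 2 ^ (n * n) := by
    have h1 : n.factorial ≤ n ^ n := Nat.factorial_le_pow n
    have h2 : n ^ n ≤ (2 ^ n) ^ n := Nat.pow_le_pow_left Nat.lt_two_pow_self.le n
    rw [← pow_mul] at h2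
    exact_mod_cast h1.trans h2
  have hn2 : (n : ℤ) ≤ 2 ^ n := by exact_mod_cast Nat.lt_two_pow_self.le
  -- The extra factor `n!` forces the prime to exceed `n`: the greedy step needs a field with more
  -- than `n` elements.
  have hbound : |D * n.factorial| < 2 ^ ((w + 2) ^ 3) := by
    rw [abs_mul, abs_of_nonneg (by positivity : (0 : ℤ) ≤ n.factorial)]
    have h1 := abs_det_ctrb_le vec A (one_le_pow₀ (by norm_num : (1 : ℤ) ≤ 2)) hA m hm e
    rw [← hD] at h1
    have h2 : (n.factorial : ℤ) * (n * n * (n * 2 ^ β) ^ n) ^ n ≤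
        2 ^ (n * n) * (2 ^ n * 2 ^ n * (2 ^ n * 2 ^ β) ^ n) ^ n := by gcongr
    calc |D| * n.factorial
        ≤ (2 ^ (n * n) * (2 ^ n * 2 ^ n * (2 ^ n * 2 ^ β) ^ n) ^ n) * 2 ^ (n * n) :=
          mul_le_mul (h1.trans h2) hfac (by positivity) (by positivity)
      _ = 2 ^ (n * n + (n + n + (n + β) * n) * n + n * n) := by
          simp only [← pow_add, ← pow_mul]
      _ < 2 ^ ((w + 2) ^ 3) := by
          refine pow_lt_pow_right₀ (by norm_num) ?_
          have hnw : n ≤ w := by omega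
          calc n * n + (n + n + (n + β) * n) * n + n * n
              ≤ w * w + (w + w + w * w) * w + w * w := by gcongr
            _ < (w + 2) ^ 3 := by ring_nf; omega
  obtain ⟨p, hp, hple, hpD⟩ := exists_prime_not_dvd
    (mul_ne_zero hD0 (by exact_mod_cast n.factorial_ne_zero)) hbound
  refine ⟨p, hp, ?_, ?_, ?_⟩
  · by_contra hlt
    have : p ∣ n.factorial := hp.dvd_factorial.2 (by omega)
    exact hpD (Dvd.dvd.mul_left (by exact_mod_cast this) _)
  · rw [primeBound]; omega
  · intro _
    refine ⟨fun i => (m i : ZMod p), ?_, ?_⟩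
    · refine Finset.card_le_card fun i => ?_
      simp only [Finset.mem_filter, Finset.mem_univ, true_and]
      intro h1 h2
      exact h1 (by rw [hmb i h2]; simp)
    · have hDp : (D : ZMod p) ≠ 0 := by
        rw [Ne, ZMod.intCast_zmod_eq_zero_iff_dvd]
        exact fun h => hpD (h.mul_right _)
      rw [← hmap] at hDp
      -- Multiplication by the columns of the identity matrix selected by `e` extracts the minor.
      refine Kry_eq_top_of_det_ne_zero (κ := Fin n) _ _
        ((1 : Matrix (Fin n × Fin n) (Fin n × Fin n) (ZMod p)).submatrix id e) ?_
      have h1 : ctrb (A.map (Int.cast : ℤ → ZMod p)) (inject vec fun i => (m i : ZMod p)) *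
          (1 : Matrix (Fin n × Fin n) (Fin n × Fin n) (ZMod p)).submatrix id e =
          (ctrb (A.map (Int.cast : ℤ → ZMod p)) (inject vec fun i => (m i : ZMod p))).submatrix id e := by
        ext i j
        simp [Matrix.mul_apply, Matrix.one_apply]
      rwa [h1]

end GoodPrime

namespace RAM

/-! ### A total language of bounded loops -/

/-- Programs whose loops run over the integers below a register, together with a primitive that adds
the bit length of the square of a register to another one. -/
inductive Cmd where
  | skip
  | assign (i : ℕ) (e : Expr)
  | store (a : ℕ) (e f g : Expr)
  | seq (P Q : Cmd)
  | ite (e : Expr) (P Q : Cmd)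
  | for_ (i j : ℕ) (P : Cmd)
  | addSize (w x : ℕ)

/-- The memory before iteration `k` of a loop with counter `i` and body `f`. -/
def forRun (i : ℕ) (f : State → State) : ℕ → State → State
  | 0, s => s
  | k + 1, s => f ((forRun i f k s).setReg i k)

/-- The effect of a program. -/
def Cmd.run : Cmd → State → State
  | .skip, s => s
  | .assign i e, s => s.setReg i (e.eval s)
  | .store a e f g, s => s.setArr a (e.eval s) (f.eval s) (g.eval s)
  | .seq P Q, s => Q.run (P.run s)
  | .ite e P Q, s => if e.eval s ≠ 0 then P.run s else Q.run s
  | .for_ i j P, s => (forRun i P.run (s.reg j).toNat s).setReg i (s.reg j).toNat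
  | .addSize w x, s =>
      (s.setReg w (s.reg w + Nat.size (s.reg x * s.reg x).toNat)).setReg x 0

/-- The cost of the loop control in one iteration. -/
def loopCost (k N : ℤ) : ℕ :=
  (len k + len N + (len k + len N)) + ((len k + len 1 + (len k + len 1)) + len (k + 1))

/-- The cost of the first iterations of a loop. -/
def forCost (i : ℕ) (f : State → State) (c : State → ℕ) (N : ℤ) : ℕ → State → ℕ
  | 0, _ => 0
  | k + 1, s => forCost i f c N k s + (c ((forRun i f k s).setReg i k) + loopCost k N)

/-- The cost of one step in the computation of the bit length. -/
def sizeStepCost (w x : ℤ) : ℕ :=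
  len x + ((len x + len 2 + len x * len 2 + len (x / 2)) + (len w + len 1 + (len w + len 1) + len (w + 1)))

/-- The cost of the computation of a bit length, in a recursion on that length. -/
def sizeCost : ℕ → ℤ → ℤ → ℕ
  | 0, _, x => len x
  | k + 1, w, x => sizeStepCost w x + sizeCost k (w + 1) (x / 2)

/-- A bound for the cost of a program. -/
def Cmd.cost : Cmd → State → ℕ
  | .skip, _ => 1
  | .assign _ e, s => e.cost s + len (e.eval s)
  | .store _ e f g, s =>
      e.cost s + f.cost s + g.cost s + (len (e.eval s) + len (f.eval s) + len (g.eval s))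
  | .seq P Q, s => P.cost s + Q.cost (P.run s)
  | .ite e P Q, s => e.cost s + if e.eval s ≠ 0 then P.cost s else Q.cost s
  | .for_ i j P, s => (len 0 + len 0) + (forCost i P.run P.cost (s.reg j) (s.reg j).toNat s +
      (len (s.reg j).toNat + len (s.reg j) + (len (s.reg j).toNat + len (s.reg j))))
  | .addSize w x, s => (len (s.reg x) + len (s.reg x) + len (s.reg x) * len (s.reg x) +
      len (s.reg x * s.reg x)) +
      sizeCost (Nat.size (s.reg x * s.reg x).toNat) (s.reg w) (s.reg x * s.reg x)

/-- The translation into programs of the machine. -/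
def Cmd.compile : Cmd → Program
  | .skip => .skip
  | .assign i e => .assign i e
  | .store a e f g => .store a e f g
  | .seq P Q => .seq P.compile Q.compile
  | .ite e P Q => .ite e P.compile Q.compile
  | .for_ i j P => .seq (.assign i (.lit 0)) (.loop (.op .lt (.reg i) (.reg j))
      (.seq P.compile (.assign i (.op .add (.reg i) (.lit 1)))))
  | .addSize w x => .seq (.assign x (.op .mul (.reg x) (.reg x))) (.loop (.reg x)
      (.seq (.assign x (.op .div (.reg x) (.lit 2))) (.assign w (.op .add (.reg w) (.lit 1)))))

/-- Whether a program may write into register `r`. -/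
def Cmd.modReg : Cmd → ℕ → Bool
  | .skip, _ => false
  | .assign i _, r => i == r
  | .store _ _ _ _, _ => false
  | .seq P Q, r => P.modReg r || Q.modReg r
  | .ite _ P Q, r => P.modReg r || Q.modReg r
  | .for_ i _ P, r => i == r || P.modReg r
  | .addSize w x, r => w == r || x == r

/-- Whether a program may write into array `a`. -/
def Cmd.modArr : Cmd → ℕ → Bool
  | .skip, _ => false
  | .assign _ _, _ => false
  | .store b _ _ _, a => b == a
  | .seq P Q, a => P.modArr a || Q.modArr a
  | .ite _ P Q, a => P.modArr a || Q.modArr a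
  | .for_ _ _ P, a => P.modArr a
  | .addSize _ _, _ => false

/-- The bodies of the loops leave the counters and the bounds unchanged. -/
def Cmd.wf : Cmd → Bool
  | .skip => true
  | .assign _ _ => true
  | .store _ _ _ _ => true
  | .seq P Q => P.wf && Q.wf
  | .ite _ P Q => P.wf && Q.wf
  | .for_ i j P => P.wf && !(P.modReg i) && !(P.modReg j) && i != j
  | .addSize w x => w != x

section StateLemmas

variable (s : State) (i j a b : ℕ) (v w x y x' y' : ℤ)

@[simp] theorem State.setReg_reg_self : (s.setReg i v).reg i = v := by simp [State.setReg]

@[simp] theorem State.setReg_reg_of_ne (h : j ≠ i) : (s.setReg i v).reg j = s.reg j := by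
  simp [State.setReg, h]

@[simp] theorem State.setReg_arr : (s.setReg i v).arr = s.arr := rfl

@[simp] theorem State.setArr_reg : (s.setArr a x y v).reg = s.reg := rfl

@[simp] theorem State.setArr_arr_self : (s.setArr a x y v).arr a x y = v := by simp [State.setArr]

@[simp] theorem State.setArr_arr_of_ne (h : b ≠ a) : (s.setArr a x y v).arr b = s.arr b := by
  funext x y; simp [State.setArr, h]

theorem State.setArr_arr (x' y' : ℤ) : (s.setArr a x y v).arr a x' y' =
    if x' = x ∧ y' = y then v else s.arr a x' y' := by
  simp [State.setArr]

@[simp] theorem State.setReg_setReg : (s.setReg i v).setReg i w = s.setReg i w := by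
  simp only [State.setReg]; congr; funext k; split_ifs <;> rfl

theorem State.setReg_comm (h : i ≠ j) :
    (s.setReg i v).setReg j w = (s.setReg j w).setReg i v := by
  simp only [State.setReg]; congr; funext k; grind

theorem State.setReg_eq_self (h : s.reg i = v) : s.setReg i v = s := by
  subst h
  cases s; simp only [State.setReg]; congr; funext k; split_ifs with h
  · rw [h]
  · rfl

end StateLemmas

theorem forRun_reg_of_unchanged {i r : ℕ} {f : State → State} (h : ∀ s, (f s).reg r = s.reg r)
    (hir : r ≠ i) (k : ℕ) (s : State) : (forRun i f k s).reg r = s.reg r := by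
  induction k with
  | zero => rfl
  | succ k ih => rw [forRun, h, State.setReg_reg_of_ne _ _ _ _ hir, ih]

theorem forRun_arr_of_unchanged {i a : ℕ} {f : State → State} (h : ∀ s, (f s).arr a = s.arr a)
    (k : ℕ) (s : State) : (forRun i f k s).arr a = s.arr a := by
  induction k with
  | zero => rfl
  | succ k ih => rw [forRun, h, State.setReg_arr, ih]

/-- The frame rule. Its hypothesis is a computation on the syntax, so for concrete programs `rfl`
usually proves it. -/
theorem Cmd.run_reg {P : Cmd} {r : ℕ} (h : P.modReg r = false) (s : State) :
    (P.run s).reg r = s.reg r := by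
  induction P generalizing s with
  | skip => rfl
  | assign i e =>
    have : r ≠ i := by simp [Cmd.modReg] at h; exact Ne.symm h
    simp [Cmd.run, this]
  | store => rfl
  | seq P Q ihP ihQ =>
    simp only [Cmd.modReg, Bool.or_eq_false_iff] at h
    rw [Cmd.run, ihQ h.2, ihP h.1]
  | ite e P Q ihP ihQ =>
    simp only [Cmd.modReg, Bool.or_eq_false_iff] at h
    rw [Cmd.run]; split_ifs
    · exact ihP h.1 s
    · exact ihQ h.2 s
  | for_ i j P ih =>
    simp only [Cmd.modReg, Bool.or_eq_false_iff] at h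
    have hne : r ≠ i := by have := h.1; simp at this; exact Ne.symm this
    rw [Cmd.run, State.setReg_reg_of_ne _ _ _ _ hne, forRun_reg_of_unchanged (ih h.2) hne]
  | addSize w x =>
    simp only [Cmd.modReg, Bool.or_eq_false_iff, beq_eq_false_iff_ne] at h
    rw [Cmd.run, State.setReg_reg_of_ne _ _ _ _ h.2.symm, State.setReg_reg_of_ne _ _ _ _ h.1.symm]

theorem Cmd.run_arr {P : Cmd} {a : ℕ} (h : P.modArr a = false) (s : State) :
    (P.run s).arr a = s.arr a := by
  induction P generalizing s with
  | skip => rfl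
  | assign i e => rfl
  | store b e f g =>
    have : a ≠ b := by simp [Cmd.modArr] at h; exact Ne.symm h
    simp [Cmd.run, this]
  | seq P Q ihP ihQ =>
    simp only [Cmd.modArr, Bool.or_eq_false_iff] at h
    rw [Cmd.run, ihQ h.2, ihP h.1]
  | ite e P Q ihP ihQ =>
    simp only [Cmd.modArr, Bool.or_eq_false_iff] at h
    rw [Cmd.run]; split_ifs
    · exact ihP h.1 s
    · exact ihQ h.2 s
  | for_ i j P ih =>
    rw [Cmd.run, State.setReg_arr, forRun_arr_of_unchanged (ih h)]
  | addSize w x => rfl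

/-- Halving a positive integer lowers its bit length by one, so the loop ends after `k` rounds. A
loop over the integers below the register would take exponential time on input entries. -/
theorem exec_sizeLoop {w x : ℕ} (hwx : w ≠ x) (k : ℕ) : ∀ s : State,
    Nat.size (s.reg x).toNat = k → 0 ≤ s.reg x →
    Exec (.loop (.reg x) (.seq (.assign x (.op .div (.reg x) (.lit 2)))
      (.assign w (.op .add (.reg w) (.lit 1))))) s (sizeCost k (s.reg w) (s.reg x))
      ((s.setReg w (s.reg w + k)).setReg x 0) := by
  induction k with
  | zero =>
    intro s hk h0
    have hx : s.reg x = 0 := by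
      have := Nat.size_eq_zero.1 hk; omega
    have h1 : (s.setReg w (s.reg w + (0 : ℕ))).setReg x 0 = s := by
      rw [State.setReg_eq_self s w _ (by simp), State.setReg_eq_self s x _ hx]
    rw [h1]
    exact Exec.loop_false hx
  | succ k ih =>
    intro s hk h0
    have hx : s.reg x ≠ 0 := by
      intro h; rw [h] at hk; simp at hk
    have hdiv : (s.reg x / 2).toNat = (s.reg x).toNat / 2 := by omega
    have hsize : Nat.size (s.reg x / 2).toNat = k := by
      rw [hdiv]
      have hpos : (s.reg x).toNat ≠ 0 := by omega
      have h2 : Nat.size ((s.reg x).toNat) = Nat.size ((s.reg x).toNat / 2) + 1 := by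
        refine le_antisymm ?_ ?_
        · rw [Nat.size_le, pow_succ]
          have := Nat.lt_size_self ((s.reg x).toNat / 2)
          omega
        · rw [Nat.succ_le_iff, Nat.lt_size]
          rcases Nat.eq_zero_or_pos ((s.reg x).toNat / 2) with h | h
          · rw [h]; simp; omega
          · have h3 : Nat.size ((s.reg x).toNat / 2) - 1 < Nat.size ((s.reg x).toNat / 2) := by
              have := Nat.size_pos.2 h; omega
            rw [Nat.lt_size] at h3
            have h4 : 2 ^ Nat.size ((s.reg x).toNat / 2) =
                2 * 2 ^ (Nat.size ((s.reg x).toNat / 2) - 1) := by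
              rw [← pow_succ']; congr 1
              have := Nat.size_pos.2 h; omega
            omega
      omega
    set s1 := s.setReg x (s.reg x / 2) with hs1
    set s2 := s1.setReg w (s.reg w + 1) with hs2
    have hw1 : s1.reg w = s.reg w := by rw [hs1, State.setReg_reg_of_ne _ _ _ _ hwx]
    have e1 := Exec.assign x (.op .div (.reg x) (.lit 2)) s
    have e2 := Exec.assign w (.op .add (.reg w) (.lit 1)) s1
    simp only [Expr.eval, Op.eval, Expr.cost, Op.cost, hw1] at e1 e2
    rw [← hs1] at e1
    rw [← hs2] at e2
    have h2x : s2.reg x = s.reg x / 2 := by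
      rw [hs2, State.setReg_reg_of_ne _ _ _ _ hwx.symm, hs1, State.setReg_reg_self]
    have h2w : s2.reg w = s.reg w + 1 := by rw [hs2, State.setReg_reg_self]
    have e3 := ih s2 (by rw [h2x]; exact hsize) (by rw [h2x]; omega)
    rw [h2x, h2w] at e3
    have hfin : (s2.setReg w (s.reg w + 1 + k)).setReg x 0 =
        (s.setReg w (s.reg w + (k + 1 : ℕ))).setReg x 0 := by
      rw [hs2, State.setReg_setReg, hs1, State.setReg_comm _ _ _ _ _ hwx.symm, State.setReg_setReg]
      congr 2; push_cast; ring
    rw [hfin] at e3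
    exact Exec.loop_true (e := .reg x) hx (Exec.seq e1 e2) e3

/-- Executions of a loop are built from the end, hence the induction on the number `d` of remaining
rounds. As the body preserves counter and bound, the comparison is always between `k` and the
initial value of `reg j`. -/
theorem exec_for {i j : ℕ} {P : Program} {f : State → State} {c : State → ℕ}
    (hP : ∀ s, ∃ t ≤ c s, Exec P s t (f s)) (hi : ∀ s, (f s).reg i = s.reg i)
    (hj : ∀ s, (f s).reg j = s.reg j) (hij : i ≠ j) (s : State) :
    ∃ t ≤ (len 0 + len 0) + (forCost i f c (s.reg j) (s.reg j).toNat s +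
      (len (s.reg j).toNat + len (s.reg j) + (len (s.reg j).toNat + len (s.reg j)))),
      Exec (.seq (.assign i (.lit 0)) (.loop (.op .lt (.reg i) (.reg j))
        (.seq P (.assign i (.op .add (.reg i) (.lit 1)))))) s t
        ((forRun i f (s.reg j).toNat s).setReg i (s.reg j).toNat) := by
  set N := (s.reg j).toNat with hN
  have hregj : ∀ k (v : ℤ), ((forRun i f k s).setReg i v).reg j = s.reg j := fun k v => by
    rw [State.setReg_reg_of_ne _ _ _ _ hij.symm, forRun_reg_of_unchanged hj hij.symm]
  have key : ∀ d k, k + d = N → ∃ t, forCost i f c (s.reg j) k s + t ≤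
      forCost i f c (s.reg j) N s + (len N + len (s.reg j) + (len N + len (s.reg j))) ∧
      Exec (.loop (.op .lt (.reg i) (.reg j)) (.seq P (.assign i (.op .add (.reg i) (.lit 1)))))
        ((forRun i f k s).setReg i k) t ((forRun i f N s).setReg i N) := by
    intro d
    induction d with
    | zero =>
      intro k hk
      have hkN : k = N := by omega
      subst hkN
      refine ⟨_, le_of_eq ?_, Exec.loop_false ?_⟩
      · simp only [Expr.cost, Op.cost, Expr.eval, hregj, State.setReg_reg_self]
      · simp only [Expr.eval, Op.eval, hregj, State.setReg_reg_self]
        rw [if_neg]; omega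
    | succ d ih =>
      intro k hk
      obtain ⟨t₂, ht₂, e₂⟩ := ih (k + 1) (by omega)
      obtain ⟨t₁, ht₁, e₁⟩ := hP ((forRun i f k s).setReg i k)
      have ea := Exec.assign i (.op .add (.reg i) (.lit 1)) (f ((forRun i f k s).setReg i k))
      simp only [Expr.eval, Op.eval, Expr.cost, Op.cost, hi, State.setReg_reg_self] at ea
      have h1 : (f ((forRun i f k s).setReg i k)).setReg i (k + 1) =
          (forRun i f (k + 1) s).setReg i (k + 1 : ℕ) := by
        rw [forRun]; push_cast; rfl
      rw [h1] at ea
      refine ⟨_, ?_, Exec.loop_true ?_ (Exec.seq e₁ ea) e₂⟩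
      · rw [forCost, loopCost] at ht₂
        simp only [Expr.cost, Op.cost, Expr.eval, hregj, State.setReg_reg_self]
        omega
      · simp only [Expr.eval, Op.eval, hregj, State.setReg_reg_self]
        rw [if_pos]
        · exact one_ne_zero
        · omega
  obtain ⟨t, ht, e⟩ := key N 0 (by omega)
  refine ⟨_, ?_, Exec.seq (Exec.assign i (.lit 0) s) e⟩
  simp only [forCost, zero_add] at ht
  simp only [Expr.cost, Expr.eval]
  omega

theorem Cmd.exec {P : Cmd} (h : P.wf = true) (s : State) :
    ∃ t ≤ P.cost s, Exec P.compile s t (P.run s) := by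
  induction P generalizing s with
  | skip => exact ⟨_, le_rfl, Exec.skip s⟩
  | assign i e => exact ⟨_, le_rfl, Exec.assign i e s⟩
  | store a e f g => exact ⟨_, le_rfl, Exec.store a e f g s⟩
  | seq P Q ihP ihQ =>
    simp only [Cmd.wf, Bool.and_eq_true] at h
    obtain ⟨t₁, h₁, e₁⟩ := ihP h.1 s
    obtain ⟨t₂, h₂, e₂⟩ := ihQ h.2 (P.run s)
    exact ⟨_, Nat.add_le_add h₁ h₂, Exec.seq e₁ e₂⟩
  | ite e P Q ihP ihQ =>
    simp only [Cmd.wf, Bool.and_eq_true] at h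
    by_cases he : e.eval s = 0
    · obtain ⟨t, ht, e₁⟩ := ihQ h.2 s
      refine ⟨_, ?_, by rw [Cmd.run, if_neg (not_not.2 he)]; exact Exec.ite_false he e₁⟩
      rw [Cmd.cost, if_neg (not_not.2 he)]; omega
    · obtain ⟨t, ht, e₁⟩ := ihP h.1 s
      refine ⟨_, ?_, by rw [Cmd.run, if_pos he]; exact Exec.ite_true he e₁⟩
      rw [Cmd.cost, if_pos he]; omega
  | for_ i j P ih =>
    simp only [Cmd.wf, Bool.and_eq_true, Bool.not_eq_true', bne_iff_ne] at h
    exact exec_for (ih h.1.1.1) (Cmd.run_reg h.1.1.2) (Cmd.run_reg h.1.2) h.2 s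
  | addSize w x =>
    simp only [Cmd.wf, bne_iff_ne] at h
    have e₁ := Exec.assign x (.op .mul (.reg x) (.reg x)) s
    simp only [Expr.eval, Op.eval, Expr.cost, Op.cost] at e₁
    -- Squaring provides the required sign: halving a negative integer would get stuck at `-1`.
    have e₂ := exec_sizeLoop h _ (s.setReg x (s.reg x * s.reg x)) rfl
      (by rw [State.setReg_reg_self]; exact mul_self_nonneg _)
    rw [State.setReg_reg_self, State.setReg_reg_of_ne _ _ _ _ h] at e₂
    refine ⟨_, le_rfl, ?_⟩
    have e₃ := Exec.seq e₁ e₂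
    rw [State.setReg_comm _ _ _ _ _ h.symm, State.setReg_setReg] at e₃
    exact e₃

/-! ### Bounds for bit lengths and costs -/

theorem len_le_natAbs (z : ℤ) : len z ≤ z.natAbs + 1 := by
  have : Nat.size z.natAbs ≤ z.natAbs := Nat.size_le.2 Nat.lt_two_pow_self
  rw [len]; omega

theorem len_mono {x y : ℤ} (h : x.natAbs ≤ y.natAbs) : len x ≤ len y :=
  Nat.add_le_add_right (Nat.size_le_size h) 1

theorem natAbs_lt_two_pow_len (z : ℤ) : z.natAbs < 2 ^ (len z - 1) := by
  rw [len]; exact Nat.lt_size_self _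

theorem one_le_len (z : ℤ) : 1 ≤ len z := by rw [len]; omega

theorem len_le_of_natAbs_lt {z : ℤ} {k : ℕ} (h : z.natAbs < 2 ^ k) : len z ≤ k + 1 := by
  rw [len]; exact Nat.add_le_add_right (Nat.size_le.2 h) 1

theorem len_mul_le (x y : ℤ) : len (x * y) ≤ len x + len y := by
  have hx := natAbs_lt_two_pow_len x
  have hy := natAbs_lt_two_pow_len y
  have h : (x * y).natAbs < 2 ^ ((len x - 1) + (len y - 1)) := by
    rw [Int.natAbs_mul, pow_add]; exact Nat.mul_lt_mul'' hx hy
  have := len_le_of_natAbs_lt h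
  have := one_le_len x
  have := one_le_len y
  omega

theorem len_le_of_natAbs_le_add {x y z : ℤ} (h : z.natAbs ≤ x.natAbs + y.natAbs) :
    len z ≤ len x + len y := by
  have hx := natAbs_lt_two_pow_len x
  have hy := natAbs_lt_two_pow_len y
  have h1 := one_le_len x
  have h2 := one_le_len y
  have h3 : 2 ^ (len x - 1) ≤ 2 ^ (len x + len y - 2) := Nat.pow_le_pow_right two_pos (by omega)
  have h4 : 2 ^ (len y - 1) ≤ 2 ^ (len x + len y - 2) := Nat.pow_le_pow_right two_pos (by omega)
  have h5 : z.natAbs < 2 ^ (len x + len y - 2 + 1) := by rw [pow_succ]; omega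
  have := len_le_of_natAbs_lt h5
  omega

theorem natAbs_div_le (x y : ℤ) : (x / y).natAbs ≤ x.natAbs := Int.natAbs_ediv_le_natAbs x y

theorem len_eval_op_le (o : Op) (x y : ℤ) : len (o.eval x y) ≤ len x + len y := by
  have h1 := one_le_len x
  have h2 := one_le_len y
  cases o with
  | add => exact len_le_of_natAbs_le_add (Int.natAbs_add_le x y)
  | sub => exact len_le_of_natAbs_le_add (Int.natAbs_sub_le x y)
  | mul => exact len_mul_le x y
  | div => exact (len_mono (natAbs_div_le x y)).trans (Nat.le_add_right _ _)
  | lt =>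
    have : len (if x < y then 1 else 0) ≤ 2 := by
      split_ifs <;> exact (len_le_natAbs _).trans (by decide)
    exact this.trans (by omega)
  | eq =>
    have : len (if x = y then 1 else 0) ≤ 2 := by
      split_ifs <;> exact (len_le_natAbs _).trans (by decide)
    exact this.trans (by omega)

theorem cost_op_le (o : Op) (x y : ℤ) : o.cost x y ≤ (len x + len y) * (len x + len y) := by
  have h1 := one_le_len x
  have h2 := one_le_len y
  cases o <;> simp only [Op.cost] <;> nlinarith

/-- The registers and the arrays other than `0` and `1` hold integers of absolute value at most `B`,
and the cells of the arrays `0` and `1` have bit length at most `B`. -/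
structure Bdd (B : ℕ) (s : State) : Prop where
  one_le : 1 ≤ B
  reg : ∀ i, |s.reg i| ≤ B
  arr : ∀ a, 2 ≤ a → ∀ x y, |s.arr a x y| ≤ B
  arr_len : ∀ a < 2, ∀ x y, len (s.arr a x y) ≤ B

theorem len_le_of_abs_le {z : ℤ} {B : ℕ} (h : |z| ≤ B) : len z ≤ B + 1 :=
  (len_le_natAbs z).trans (by have := abs_le.1 h; omega)

open Polynomial in
-- Values of subexpressions may exceed `B`, but every operation at most adds bit lengths, so lengths
-- and costs stay polynomial for a fixed expression.
theorem Expr.exists_poly (e : Expr) : ∃ q : Polynomial ℕ, ∀ B s, Bdd B s →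
    e.cost s ≤ q.eval B ∧ len (e.eval s) ≤ q.eval B := by
  induction e with
  | lit z => exact ⟨C (len z), fun B s _ => by simp [Expr.cost, Expr.eval]⟩
  | reg i =>
    exact ⟨X + 1, fun B s h => by simpa [Expr.cost, Expr.eval] using len_le_of_abs_le (h.reg i)⟩
  | arr a e f ihe ihf =>
    obtain ⟨p, hp⟩ := ihe
    obtain ⟨q, hq⟩ := ihf
    refine ⟨p + q + (p + q + (X + 1)), fun B s h => ?_⟩
    have hlen : len (s.arr a (e.eval s) (f.eval s)) ≤ B + 1 := by
      by_cases ha : 2 ≤ a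
      · exact len_le_of_abs_le (h.arr a ha _ _)
      · exact (h.arr_len a (by omega) _ _).trans (Nat.le_succ _)
    have h1 := hp B s h
    have h2 := hq B s h
    simp only [eval_add, eval_X, eval_one, Expr.cost, Expr.eval]
    omega
  | op o e f ihe ihf =>
    obtain ⟨p, hp⟩ := ihe
    obtain ⟨q, hq⟩ := ihf
    refine ⟨p + q + (p + q) * (p + q), fun B s h => ?_⟩
    have h1 := hp B s h
    have h2 := hq B s h
    have h3 := cost_op_le o (e.eval s) (f.eval s)
    have h4 := len_eval_op_le o (e.eval s) (f.eval s)
    have h5 : (len (e.eval s) + len (f.eval s)) * (len (e.eval s) + len (f.eval s)) ≤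
        (p.eval B + q.eval B) * (p.eval B + q.eval B) :=
      Nat.mul_le_mul (Nat.add_le_add h1.2 h2.2) (Nat.add_le_add h1.2 h2.2)
    simp only [eval_add, eval_mul, Expr.cost, Expr.eval]
    exact ⟨by omega, by omega⟩

/-- The values of the expression are bounded by the bound for the memory. -/
def Expr.Safe (e : Expr) : Prop := ∀ B s, Bdd B s → |e.eval s| ≤ B

/-- Programs that preserve all bounds for the memory. -/
def Cmd.Safe : Cmd → Prop
  | .skip => True
  | .assign _ e => e.Safe
  | .store a _ _ g => 2 ≤ a ∧ g.Safe
  | .seq P Q => P.Safe ∧ Q.Safe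
  | .ite _ P Q => P.Safe ∧ Q.Safe
  | .for_ _ _ P => P.Safe
  | .addSize _ _ => False

theorem Bdd.setReg {B : ℕ} {s : State} (h : Bdd B s) (i : ℕ) {v : ℤ} (hv : |v| ≤ B) :
    Bdd B (s.setReg i v) where
  one_le := h.one_le
  reg j := by
    by_cases hj : j = i
    · subst hj; simpa
    · simpa [hj] using h.reg j
  arr := h.arr
  arr_len := h.arr_len

theorem Bdd.setArr {B : ℕ} {s : State} (h : Bdd B s) {a : ℕ} (ha : 2 ≤ a) (x y : ℤ) {v : ℤ}
    (hv : |v| ≤ B) : Bdd B (s.setArr a x y v) where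
  one_le := h.one_le
  reg := h.reg
  arr b hb x' y' := by
    by_cases hab : b = a
    · subst hab
      rw [State.setArr_arr]
      split_ifs
      · exact hv
      · exact h.arr b hb x' y'
    · simpa [hab] using h.arr b hb x' y'
  arr_len b hb x' y' := by
    have : b ≠ a := by omega
    simpa [this] using h.arr_len b hb x' y'

open Polynomial in
/-- Safe programs run in polynomial time. -/
theorem Cmd.Safe.exists_poly {P : Cmd} (h : P.Safe) : ∃ q : Polynomial ℕ, ∀ B s, Bdd B s →
    Bdd B (P.run s) ∧ P.cost s ≤ q.eval B := by
  induction P with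
  | skip => exact ⟨1, fun B s hs => ⟨hs, by simp [Cmd.cost]⟩⟩
  | assign i e =>
    obtain ⟨p, hp⟩ := e.exists_poly
    refine ⟨p + p, fun B s hs => ⟨hs.setReg i (h B s hs), ?_⟩⟩
    have := hp B s hs
    simp only [Cmd.cost, eval_add]; omega
  | store a e f g =>
    obtain ⟨p, hp⟩ := e.exists_poly
    obtain ⟨q, hq⟩ := f.exists_poly
    obtain ⟨r, hr⟩ := g.exists_poly
    refine ⟨p + q + r + (p + q + r), fun B s hs => ⟨hs.setArr h.1 _ _ (h.2 B s hs), ?_⟩⟩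
    have h1 := hp B s hs
    have h2 := hq B s hs
    have h3 := hr B s hs
    simp only [Cmd.cost, eval_add]; omega
  | seq P Q ihP ihQ =>
    obtain ⟨p, hp⟩ := ihP h.1
    obtain ⟨q, hq⟩ := ihQ h.2
    refine ⟨p + q, fun B s hs => ?_⟩
    have h1 := hp B s hs
    have h2 := hq B _ h1.1
    refine ⟨h2.1, ?_⟩
    simp only [Cmd.cost, eval_add]; omega
  | ite e P Q ihP ihQ =>
    obtain ⟨r, hr⟩ := e.exists_poly
    obtain ⟨p, hp⟩ := ihP h.1
    obtain ⟨q, hq⟩ := ihQ h.2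
    refine ⟨r + p + q, fun B s hs => ?_⟩
    have h1 := hp B s hs
    have h2 := hq B s hs
    have h3 := hr B s hs
    simp only [Cmd.cost, Cmd.run, eval_add]
    split_ifs
    · exact ⟨h1.1, by omega⟩
    · exact ⟨h2.1, by omega⟩
  | for_ i j P ih =>
    obtain ⟨p, hp⟩ := ih h
    -- At most `B` rounds, each costing the body and the loop control; the last summand pays for
    -- initialisation and the final test.
    refine ⟨X * (p + (11 * X + 21)) + (4 * X + 8), fun B s hs => ?_⟩
    have hN : (s.reg j).toNat ≤ B := by have := abs_le.1 (hs.reg j); omega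
    -- The body preserves the very same bound, so nothing grows over the iterations, and the
    -- polynomial for the body may be used with the same argument in each round.
    have hbd : ∀ k ≤ (s.reg j).toNat, Bdd B (forRun i P.run k s) := by
      intro k
      induction k with
      | zero => exact fun _ => hs
      | succ k ihk =>
        intro hk
        refine (hp B _ ((ihk (by omega)).setReg i ?_)).1
        rw [abs_of_nonneg (by positivity)]; exact_mod_cast (by omega : k ≤ B)
    have hcost : ∀ k ≤ (s.reg j).toNat,
        forCost i P.run P.cost (s.reg j) k s ≤ k * (p.eval B + (11 * B + 21)) := by
      intro k
      induction k with
      | zero => simp [forCost]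
      | succ k ihk =>
        intro hk
        have hkB : |(k : ℤ)| ≤ B := by
          rw [abs_of_nonneg (by positivity)]; exact_mod_cast (by omega : k ≤ B)
        have hkB' : |((k : ℤ) + 1)| ≤ B := by
          rw [abs_of_nonneg (by positivity)]; exact_mod_cast (by omega : k + 1 ≤ B)
        have h1 := (hp B _ ((hbd k (by omega)).setReg i hkB)).2
        have h2 := ihk (by omega)
        have h3 : loopCost k (s.reg j) ≤ 11 * B + 21 := by
          have e1 := len_le_of_abs_le hkB
          have e2 := len_le_of_abs_le hkB'
          have e3 := len_le_of_abs_le (hs.reg j)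
          have e4 : len 1 ≤ 2 := len_le_natAbs 1
          have := hs.one_le
          rw [loopCost]; omega
        rw [forCost, Nat.succ_mul]; omega
    refine ⟨(hbd _ le_rfl).setReg i ?_, ?_⟩
    · rw [abs_of_nonneg (by positivity)]; exact_mod_cast hN
    · have h1 := hcost _ le_rfl
      have h2 : (s.reg j).toNat * (p.eval B + (11 * B + 21)) ≤ B * (p.eval B + (11 * B + 21)) :=
        Nat.mul_le_mul_right _ hN
      have h3 := len_le_of_abs_le (hs.reg j)
      have h4 : len ((s.reg j).toNat : ℤ) ≤ B + 1 := len_le_of_abs_le (by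
        rw [abs_of_nonneg (by positivity)]; exact_mod_cast hN)
      have h5 : len 0 ≤ 1 := len_le_natAbs 0
      simp only [Cmd.cost, eval_add, eval_mul, eval_X, eval_ofNat]
      have := hs.one_le
      omega
  | addSize w x => exact h.elim

/-! ### Safe expressions -/

/-- The residue of `e` modulo `m`, and `0` if `m` is zero. -/
def Expr.modz (e m : Expr) : Expr :=
  .op .mul (.op .sub (.lit 1) (.op .eq m (.lit 0))) (.op .sub e (.op .mul m (.op .div e m)))

theorem Op.eval_eq_pos {x y : ℤ} (h : x = y) : Op.eval .eq x y = 1 := if_pos h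

theorem Op.eval_eq_neg {x y : ℤ} (h : x ≠ y) : Op.eval .eq x y = 0 := if_neg h

theorem Op.eval_lt_pos {x y : ℤ} (h : x < y) : Op.eval .lt x y = 1 := if_pos h

theorem Op.eval_lt_neg {x y : ℤ} (h : ¬ x < y) : Op.eval .lt x y = 0 := if_neg h

theorem Op.eval_eq_ne_zero {x y : ℤ} : Op.eval .eq x y ≠ 0 ↔ x = y := by
  by_cases h : x = y
  · rw [Op.eval_eq_pos h]; simp [h]
  · rw [Op.eval_eq_neg h]; simp [h]

theorem Op.eval_lt_ne_zero {x y : ℤ} : Op.eval .lt x y ≠ 0 ↔ x < y := by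
  by_cases h : x < y
  · rw [Op.eval_lt_pos h]; simp [h]
  · rw [Op.eval_lt_neg h]; simp [h]

theorem Expr.eval_modz_of_eq_zero {e m : Expr} {s : State} (h : m.eval s = 0) :
    (e.modz m).eval s = 0 := by
  simp only [Expr.modz, Expr.eval, Op.eval_eq_pos h]
  simp [Op.eval]

theorem Expr.eval_modz {e m : Expr} {s : State} (h : m.eval s ≠ 0) :
    (e.modz m).eval s = e.eval s % m.eval s := by
  simp only [Expr.modz, Expr.eval, Op.eval_eq_neg h]
  simp [Op.eval, Int.emod_def]

/-- This is why `modz` vanishes for modulus zero: the ordinary remainder modulo `0` is `e` itself,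
which is not bounded by the memory. -/
theorem Expr.safe_modz (e : Expr) (i : ℕ) : (e.modz (.reg i)).Safe := by
  intro B s h
  by_cases h0 : (Expr.reg i).eval s = 0
  · rw [Expr.eval_modz_of_eq_zero h0]; simp
  · rw [Expr.eval_modz h0, abs_of_nonneg (Int.emod_nonneg _ h0)]
    exact (Int.emod_lt_abs _ h0).le.trans (h.reg i)

theorem Expr.safe_reg (i : ℕ) : (Expr.reg i).Safe := fun _ _ h => h.reg i

theorem Expr.safe_lit_zero : (Expr.lit 0).Safe := fun _ _ _ => by simp [Expr.eval]

theorem Expr.safe_lit_one : (Expr.lit 1).Safe := fun B _ h => by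
  simpa [Expr.eval] using h.one_le

theorem Expr.safe_arr {a : ℕ} (ha : 2 ≤ a) (e f : Expr) : (Expr.arr a e f).Safe :=
  fun _ _ h => h.arr a ha _ _

theorem Expr.safe_lt (e f : Expr) : (Expr.op .lt e f).Safe := fun B s h => by
  have := h.one_le
  simp only [Expr.eval, Op.eval]
  split_ifs <;> simp; omega

theorem Expr.safe_eq (e f : Expr) : (Expr.op .eq e f).Safe := fun B s h => by
  have := h.one_le
  simp only [Expr.eval, Op.eval]
  split_ifs <;> simp; omega

/-! ### Reasoning about loops -/

/-- `s'` agrees with `s` on everything that `P` leaves unchanged. -/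
structure Same (P : Cmd) (s s' : State) : Prop where
  reg : ∀ r, P.modReg r = false → s'.reg r = s.reg r
  arr : ∀ a, P.modArr a = false → s'.arr a = s.arr a

/-- The invariant rule for loops. `Same` supplies everything the loop cannot touch, so invariants
need to mention only what changes. -/
theorem Cmd.run_for {i j : ℕ} {P : Cmd} {s : State} {N : ℕ} (hN : s.reg j = N)
    (I : ℕ → State → Prop) (h0 : I 0 s)
    (hstep : ∀ k < N, ∀ s', Same (.for_ i j P) s s' → I k s' →
      I (k + 1) (P.run (s'.setReg i k))) :
    ∃ s', (Cmd.for_ i j P).run s = s'.setReg i N ∧ I N s' ∧ Same (.for_ i j P) s s' := by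
  have hsame : ∀ k, Same (.for_ i j P) s (forRun i P.run k s) := fun k =>
    { reg := fun r hr => by
        simp only [Cmd.modReg, Bool.or_eq_false_iff, beq_eq_false_iff_ne] at hr
        exact forRun_reg_of_unchanged (Cmd.run_reg hr.2) (Ne.symm hr.1) k s
      arr := fun a ha => by
        have ha' : P.modArr a = false := ha
        exact forRun_arr_of_unchanged (Cmd.run_arr ha') k s }
  have key : ∀ k ≤ N, I k (forRun i P.run k s) := by
    intro k
    induction k with
    | zero => exact fun _ => h0
    | succ k ih => exact fun hk => hstep k (by omega) _ (hsame k) (ih (by omega))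
  refine ⟨forRun i P.run N s, ?_, key N le_rfl, hsame N⟩
  rw [Cmd.run, hN, Int.toNat_natCast]

end RAM

namespace RAM

open Matrix

/-! ### Vectors and matrices modulo `p` -/

section Residues

variable {n : ℕ}

/-- The residues in column `0` of an array. -/
def vec (n p : ℕ) (s : State) (a : ℕ) : Fin n → ZMod p := fun i => (s.arr a i 0 : ZMod p)

/-- The residues in an array. -/
def mat (n p : ℕ) (s : State) (a : ℕ) : Matrix (Fin n) (Fin n) (ZMod p) :=
  Matrix.of fun i j => (s.arr a i j : ZMod p)

theorem vec_congr {p : ℕ} {s s' : State} {a : ℕ} (h : s'.arr a = s.arr a) :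
    vec n p s' a = vec n p s a := by
  funext i; simp only [vec, h]

theorem mat_congr {p : ℕ} {s s' : State} {a : ℕ} (h : s'.arr a = s.arr a) :
    mat n p s' a = mat n p s a := by
  simp only [mat, h]

/-- Register `0` holds the dimension, register `1` a larger number and register `2` the modulus. -/
structure Context (n N p : ℕ) (s : State) : Prop where
  dim : s.reg 0 = n
  bound : s.reg 1 = N
  modulus : s.reg 2 = p
  lt : n < N
  pos : p ≠ 0

theorem Context.congr {n N p : ℕ} {s s' : State} (h : Context n N p s) (h0 : s'.reg 0 = s.reg 0)
    (h1 : s'.reg 1 = s.reg 1) (h2 : s'.reg 2 = s.reg 2) : Context n N p s' where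
  dim := h0.trans h.dim
  bound := h1.trans h.bound
  modulus := h2.trans h.modulus
  lt := h.lt
  pos := h.pos

theorem Context.run {n N p : ℕ} {s : State} (h : Context n N p s) {P : Cmd}
    (h0 : P.modReg 0 = false) (h1 : P.modReg 1 = false) (h2 : P.modReg 2 = false) :
    Context n N p (P.run s) :=
  h.congr (Cmd.run_reg h0 s) (Cmd.run_reg h1 s) (Cmd.run_reg h2 s)

theorem Context.same {n N p : ℕ} {s s' : State} (h : Context n N p s) {P : Cmd}
    (hs : Same P s s')
    (h0 : P.modReg 0 = false) (h1 : P.modReg 1 = false) (h2 : P.modReg 2 = false) :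
    Context n N p s' :=
  h.congr (hs.reg 0 h0) (hs.reg 1 h1) (hs.reg 2 h2)

theorem Context.setReg {n N p : ℕ} {s : State} (h : Context n N p s) {i : ℕ} (hi : 2 < i)
    (v : ℤ) : Context n N p (s.setReg i v) :=
  h.congr (State.setReg_reg_of_ne _ _ _ _ (by omega)) (State.setReg_reg_of_ne _ _ _ _ (by omega))
    (State.setReg_reg_of_ne _ _ _ _ (by omega))

theorem Context.cast_modz {n N p : ℕ} {s : State} (h : Context n N p s) (e : Expr) :
    (((e.modz (.reg 2)).eval s : ℤ) : ZMod p) = (e.eval s : ZMod p) := by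
  have h0 : (Expr.reg 2).eval s = p := h.modulus
  rw [Expr.eval_modz (by rw [h0]; exact_mod_cast h.pos), h0, ZMod.intCast_mod]

theorem Context.modz_ne_zero_iff {n N p : ℕ} {s : State} (h : Context n N p s) (e : Expr) :
    (e.modz (.reg 2)).eval s ≠ 0 ↔ (e.eval s : ZMod p) ≠ 0 := by
  have h0 : (Expr.reg 2).eval s = p := h.modulus
  rw [Expr.eval_modz (by rw [h0]; exact_mod_cast h.pos), h0, Ne, Ne,
    ZMod.intCast_zmod_eq_zero_iff_dvd, Int.dvd_iff_emod_eq_zero]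

end Residues

/-! ### Products of matrices and vectors -/

/-- The product of the row with index `reg 24` of array `a` and the vector in array `x`. -/
def dot (a x : ℕ) : Cmd :=
  .seq (.assign 26 (.lit 0)) (.for_ 25 0 (.assign 26 (Expr.modz (.op .add (.reg 26)
    (.op .mul (.arr a (.reg 24) (.reg 25)) (.arr x (.reg 25) (.lit 0)))) (.reg 2))))

/-- The product of the matrix in array `a` and the vector in array `x` is written into `y`. -/
def matvec (a x y : ℕ) : Cmd :=
  .for_ 24 0 (.seq (dot a x) (.store y (.reg 24) (.lit 0) (.reg 26)))

/-- The vector in array `x` is copied into array `y`. -/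
def copy (x y : ℕ) : Cmd :=
  .for_ 24 0 (.store y (.reg 24) (.lit 0) (.arr x (.reg 24) (.lit 0)))

section Matvec

variable {n N p : ℕ}

theorem dot_run {s : State} (h : Context n N p s) (a x : ℕ) (i : Fin n) (hi : s.reg 24 = i) :
    (((dot a x).run s).reg 26 : ZMod p) = (mat n p s a *ᵥ vec n p s x) i := by
  set s₀ := s.setReg 26 0 with hs₀
  have hc : Context n N p s₀ := h.setReg (by norm_num) _
  obtain ⟨s', hs', hI, -⟩ := Cmd.run_for (i := 25)
    (P := .assign 26 (Expr.modz (.op .add (.reg 26)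
      (.op .mul (.arr a (.reg 24) (.reg 25)) (.arr x (.reg 25) (.lit 0)))) (.reg 2))) hc.dim
    (fun k s' => (s'.reg 26 : ZMod p) =
      ∑ l ∈ Finset.range k, (s.arr a i l : ZMod p) * (s.arr x l 0 : ZMod p))
    (by simp [hs₀])
    (by
      intro k hk s' hsame hI
      have hc' : Context n N p (s'.setReg 25 k) :=
        (hc.same hsame rfl rfl rfl).setReg (by norm_num) _
      have h24 : s'.reg 24 = i := by
        rw [hsame.reg 24 rfl, hs₀, State.setReg_reg_of_ne _ _ _ _ (by norm_num), hi]
      have harr : s'.arr = s.arr := by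
        funext b; rw [hsame.arr b rfl, hs₀, State.setReg_arr]
      rw [Cmd.run, State.setReg_reg_self, hc'.cast_modz, Finset.sum_range_succ, ← hI]
      simp [Expr.eval, Op.eval, h24, harr])
  have : ((dot a x).run s) = s'.setReg 25 n := hs'
  rw [this, State.setReg_reg_of_ne _ _ _ _ (by norm_num), hI, Finset.sum_range]
  rfl

theorem matvec_run {s : State} (h : Context n N p s) {a x y : ℕ} (hya : y ≠ a) (hyx : y ≠ x) :
    vec n p ((matvec a x y).run s) y = mat n p s a *ᵥ vec n p s x := by
  obtain ⟨s', hs', hI, -⟩ := Cmd.run_for (i := 24)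
    (P := .seq (dot a x) (.store y (.reg 24) (.lit 0) (.reg 26))) h.dim
    (fun k s' => ∀ i : Fin n, (i : ℕ) < k →
      (s'.arr y i 0 : ZMod p) = (mat n p s a *ᵥ vec n p s x) i)
    (by intro i hi; omega)
    (by
      intro k hk s' hsame hI i hi
      have hc' : Context n N p (s'.setReg 24 k) :=
        (h.same hsame rfl rfl rfl).setReg (by norm_num) _
      have hmod : ∀ b, b ≠ y → s'.arr b = s.arr b := fun b hb =>
        hsame.arr b (by simp [Cmd.modArr, dot, hb.symm])
      have h24 : ((dot a x).run (s'.setReg 24 k)).reg 24 = k := by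
        rw [Cmd.run_reg rfl, State.setReg_reg_self]
      have harr : ((dot a x).run (s'.setReg 24 k)).arr y = s'.arr y := by
        rw [Cmd.run_arr rfl, State.setReg_arr]
      rw [Cmd.run, Cmd.run]
      simp only [Expr.eval, h24]
      rw [State.setArr_arr, harr]
      by_cases hik : (i : ℕ) = k
      · rw [if_pos (by simp [hik])]
        rw [dot_run hc' a x i (by simp [hik])]
        rw [mat_congr (s' := s'.setReg 24 k) (hmod a hya.symm),
          vec_congr (s' := s'.setReg 24 k) (hmod x hyx.symm)]
      · rw [if_neg (by simp [hik])]
        exact hI i (by omega))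
  have : ((matvec a x y).run s) = s'.setReg 24 n := hs'
  rw [this]
  funext i
  exact hI i i.2

theorem copy_run {s : State} (h : Context n N p s) {x y : ℕ} (hyx : y ≠ x) :
    vec n p ((copy x y).run s) y = vec n p s x := by
  obtain ⟨s', hs', hI, -⟩ := Cmd.run_for (i := 24)
    (P := .store y (.reg 24) (.lit 0) (.arr x (.reg 24) (.lit 0))) h.dim
    (fun k s' => ∀ i : Fin n, (i : ℕ) < k → s'.arr y i 0 = s.arr x i 0)
    (by intro i hi; omega)
    (by
      intro k hk s' hsame hI i hi
      have hx : s'.arr x = s.arr x := hsame.arr x (by simp [Cmd.modArr, hyx])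
      rw [Cmd.run, State.setArr_arr]
      simp only [Expr.eval, State.setReg_reg_self, State.setReg_arr, hx]
      by_cases hik : (i : ℕ) = k
      · rw [if_pos (by simp [hik]), hik]
      · rw [if_neg (by simp [hik])]
        exact hI i (by omega))
  have : ((copy x y).run s) = s'.setReg 24 n := hs'
  rw [this]
  funext i
  exact congrArg _ (hI i i.2)

end Matvec

/-! ### Elimination -/

section LinearAlgebra

variable {F : Type*} [Field F] {n : ℕ}

/-- One step of elimination adds the vector `v` to the kernel of `M`. -/
theorem ker_elimination (M : Matrix (Fin n) (Fin n) F) (v : Fin n → F) (j : Fin n)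
    (hj : (M *ᵥ v) j ≠ 0) :
    LinearMap.ker (Matrix.of fun i l =>
      (M *ᵥ v) j * M i l - (M *ᵥ v) i * M j l : Matrix (Fin n) (Fin n) F).mulVecLin =
      LinearMap.ker M.mulVecLin ⊔ Submodule.span F {v} := by
  have hmul : ∀ x i, ((Matrix.of fun i l =>
      (M *ᵥ v) j * M i l - (M *ᵥ v) i * M j l : Matrix (Fin n) (Fin n) F) *ᵥ x) i =
      (M *ᵥ v) j * (M *ᵥ x) i - (M *ᵥ v) i * (M *ᵥ x) j := by
    intro x i
    simp only [mulVec, dotProduct, of_apply, Finset.mul_sum, ← Finset.sum_sub_distrib]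
    refine Finset.sum_congr rfl fun l _ => ?_
    ring
  refine le_antisymm (fun x hx => ?_) (sup_le (fun x hx => ?_) ?_)
  · rw [LinearMap.mem_ker, mulVecLin_apply] at hx
    -- This multiple of `v` cancels coordinate `j` of `M x`; the equations of the new matrix then
    -- cancel the other ones.
    refine Submodule.mem_sup.2 ⟨x - ((M *ᵥ x) j / (M *ᵥ v) j) • v, ?_,
      ((M *ᵥ x) j / (M *ᵥ v) j) • v, Submodule.smul_mem _ _ (Submodule.mem_span_singleton_self v),
      by abel⟩
    rw [LinearMap.mem_ker, mulVecLin_apply, mulVec_sub, mulVec_smul]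
    funext i
    have h := congrFun hx i
    rw [hmul] at h
    simp only [Pi.sub_apply, Pi.smul_apply, smul_eq_mul, Pi.zero_apply] at h ⊢
    field_simp
    linear_combination h
  · rw [LinearMap.mem_ker, mulVecLin_apply] at hx ⊢
    funext i
    rw [hmul, hx]; simp
  · rw [Submodule.span_singleton_le_iff_mem, LinearMap.mem_ker, mulVecLin_apply]
    funext i
    rw [hmul]; simp [mul_comm]

theorem finrank_sup_span_singleton {U : Submodule F (Fin n → F)} {v : Fin n → F} (hv : v ∉ U) :
    Module.finrank F (U ⊔ Submodule.span F {v} : Submodule F (Fin n → F)) =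
      Module.finrank F U + 1 := by
  have h0 : v ≠ 0 := by rintro rfl; exact hv (Submodule.zero_mem _)
  have h1 := Submodule.finrank_sup_add_finrank_inf_eq U (Submodule.span F {v})
  have h2 : U ⊓ Submodule.span F {v} = ⊥ := by
    rw [← disjoint_iff]
    exact ((Submodule.disjoint_span_singleton' h0).2 hv)
  rw [h2, finrank_bot, finrank_span_singleton h0] at h1
  omega

end LinearAlgebra

/-- The search for a nonzero entry of the vector in array `7`. -/
def findPivot : Cmd :=
  .seq (.assign 22 (.lit 0)) (.for_ 24 0 (.ite (Expr.modz (.arr 7 (.reg 24) (.lit 0)) (.reg 2))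
    (.seq (.assign 22 (.lit 1)) (.assign 23 (.reg 24))) .skip))

/-- The elimination step with the pivot row `reg 23`. -/
def eliminate : Cmd :=
  .seq (.for_ 25 0 (.store 9 (.reg 25) (.lit 0) (.arr 5 (.reg 23) (.reg 25))))
    (.seq (.assign 26 (.arr 7 (.reg 23) (.lit 0)))
      (.for_ 24 0 (.for_ 25 0 (.store 5 (.reg 24) (.reg 25) (Expr.modz
        (.op .sub (.op .mul (.reg 26) (.arr 5 (.reg 24) (.reg 25)))
          (.op .mul (.arr 7 (.reg 24) (.lit 0)) (.arr 9 (.reg 25) (.lit 0)))) (.reg 2))))))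

/-- The vector in array `6` is added to the kernel of the matrix in array `5`, whose dimension is
kept in register `21`. -/
def addToKernel : Cmd :=
  .seq (matvec 5 6 7) (.seq findPivot
    (.ite (.reg 22) (.seq eliminate
      (.assign 21 (Expr.modz (.op .add (.reg 21) (.lit 1)) (.reg 1)))) .skip))

section Elimination

variable {n N p : ℕ}

/-- The scan has no early exit, so the index found is that of the last nonzero entry; any nonzero
entry serves as a pivot. -/
theorem findPivot_run {s : State} (h : Context n N p s) :
    ((findPivot.run s).reg 22 = 0 ∧ vec n p s 7 = 0) ∨
      ((findPivot.run s).reg 22 ≠ 0 ∧ ∃ j : Fin n, (findPivot.run s).reg 23 = j ∧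
        vec n p s 7 j ≠ 0) := by
  set s₀ := s.setReg 22 0 with hs₀
  have hc : Context n N p s₀ := h.setReg (by norm_num) _
  obtain ⟨s', hs', hI, -⟩ := Cmd.run_for (i := 24)
    (P := .ite (Expr.modz (.arr 7 (.reg 24) (.lit 0)) (.reg 2))
      (.seq (.assign 22 (.lit 1)) (.assign 23 (.reg 24))) .skip) hc.dim
    (fun k s' => (s'.reg 22 = 0 ∧ ∀ i : Fin n, (i : ℕ) < k → vec n p s 7 i = 0) ∨
      (s'.reg 22 ≠ 0 ∧ ∃ j : Fin n, s'.reg 23 = j ∧ vec n p s 7 j ≠ 0))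
    (by
      refine Or.inl ⟨by simp [hs₀], fun i hi => by omega⟩)
    (by
      intro k hk s' hsame hI
      have hc' : Context n N p (s'.setReg 24 k) :=
        (hc.same hsame rfl rfl rfl).setReg (by norm_num) _
      have harr : s'.arr = s.arr := by
        funext b; rw [hsame.arr b rfl, hs₀, State.setReg_arr]
      have hev : (((Expr.arr 7 (.reg 24) (.lit 0)).eval (s'.setReg 24 k) : ℤ) : ZMod p) =
          vec n p s 7 ⟨k, hk⟩ := by
        simp [Expr.eval, harr, vec]
      rw [Cmd.run]
      by_cases hz : vec n p s 7 ⟨k, hk⟩ = 0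
      · rw [if_neg (by rw [hc'.modz_ne_zero_iff, hev]; exact not_not.2 hz)]
        simp only [Cmd.run]
        rw [State.setReg_reg_of_ne _ _ _ _ (by norm_num),
          State.setReg_reg_of_ne _ _ _ _ (by norm_num)]
        refine hI.imp (fun hI => ⟨hI.1, fun i hi => ?_⟩) id
        rcases Nat.lt_succ_iff_lt_or_eq.1 hi with hlt | heq
        · exact hI.2 i hlt
        · have : i = ⟨k, hk⟩ := Fin.ext heq
          rw [this]; exact hz
      · rw [if_pos (by rw [hc'.modz_ne_zero_iff, hev]; exact hz)]
        refine Or.inr ⟨?_, ⟨k, hk⟩, ?_, hz⟩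
        · simp [Cmd.run, Expr.eval]
        · simp [Cmd.run, Expr.eval])
  have hrun : findPivot.run s = s'.setReg 24 n := hs'
  rw [hrun, State.setReg_reg_of_ne _ _ _ _ (by norm_num),
    State.setReg_reg_of_ne _ _ _ _ (by norm_num)]
  exact hI.imp (fun hI => ⟨hI.1, funext fun i => hI.2 i i.2⟩) id

/-- The pivot row is copied beforehand because the matrix is overwritten in place and row `j` itself
becomes zero. The invariants record that the cells not yet reached are the original ones. -/
theorem eliminate_run {s : State} (h : Context n N p s) (j : Fin n) (hj : s.reg 23 = j) :
    mat n p (eliminate.run s) 5 = Matrix.of fun i l =>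
      vec n p s 7 j * mat n p s 5 i l - vec n p s 7 i * mat n p s 5 j l := by
  obtain ⟨s₁, hs₁, hI₁, hsame₁⟩ := Cmd.run_for (i := 25)
    (P := .store 9 (.reg 25) (.lit 0) (.arr 5 (.reg 23) (.reg 25))) h.dim
    (fun k s' => ∀ l : Fin n, (l : ℕ) < k → s'.arr 9 l 0 = s.arr 5 j l)
    (by intro i hi; omega)
    (by
      intro k hk s' hsame hI i hi
      have hx : s'.arr 5 = s.arr 5 := hsame.arr 5 rfl
      have hr : s'.reg 23 = j := (hsame.reg 23 rfl).trans hj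
      rw [Cmd.run, State.setArr_arr]
      simp only [Expr.eval, State.setReg_reg_self, State.setReg_arr, hx,
        State.setReg_reg_of_ne _ _ _ _ (by norm_num : (23 : ℕ) ≠ 25), hr]
      by_cases hik : (i : ℕ) = k
      · rw [if_pos (by simp [hik]), hik]
      · rw [if_neg (by simp [hik])]
        exact hI i (by omega))
  set s₂ := (s₁.setReg 25 n).setReg 26 (s.arr 7 j 0) with hs₂
  have hc₂ : Context n N p s₂ :=
    ((h.same hsame₁ rfl rfl rfl).setReg (by norm_num) _).setReg (by norm_num) _
  have h7₂ : s₂.arr 7 = s.arr 7 := hsame₁.arr 7 rfl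
  have h5₂ : s₂.arr 5 = s.arr 5 := hsame₁.arr 5 rfl
  have h9₂ : ∀ l : Fin n, s₂.arr 9 l 0 = s.arr 5 j l := fun l => hI₁ l l.2
  have h26₂ : s₂.reg 26 = s.arr 7 j 0 := by rw [hs₂, State.setReg_reg_self]
  have hrun : eliminate.run s = (Cmd.for_ 24 0 (.for_ 25 0 (.store 5 (.reg 24) (.reg 25) (Expr.modz
        (.op .sub (.op .mul (.reg 26) (.arr 5 (.reg 24) (.reg 25)))
          (.op .mul (.arr 7 (.reg 24) (.lit 0)) (.arr 9 (.reg 25) (.lit 0)))) (.reg 2))))).run s₂ := by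
    rw [eliminate, Cmd.run, hs₁, Cmd.run]
    congr 1
    rw [Cmd.run, hs₂]
    congr 1
    have hr : s₁.reg 23 = j := (hsame₁.reg 23 rfl).trans hj
    have h7 : s₁.arr 7 = s.arr 7 := hsame₁.arr 7 rfl
    simp [Expr.eval, hr, h7]
  set G : Matrix (Fin n) (Fin n) (ZMod p) := Matrix.of fun i l =>
      vec n p s 7 j * mat n p s 5 i l - vec n p s 7 i * mat n p s 5 j l with hG
  rw [hrun]
  obtain ⟨s₃, hs₃, hI₃, -⟩ := Cmd.run_for (i := 24) (P := .for_ 25 0 (.store 5 (.reg 24) (.reg 25)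
      (Expr.modz (.op .sub (.op .mul (.reg 26) (.arr 5 (.reg 24) (.reg 25)))
        (.op .mul (.arr 7 (.reg 24) (.lit 0)) (.arr 9 (.reg 25) (.lit 0)))) (.reg 2)))) hc₂.dim
    (fun k s' => (∀ i l : Fin n, (i : ℕ) < k → (s'.arr 5 i l : ZMod p) = G i l) ∧
      ∀ i l : Fin n, k ≤ (i : ℕ) → s'.arr 5 i l = s.arr 5 i l)
    ⟨fun i l hi => by omega, fun i l _ => by rw [h5₂]⟩
    (by
      intro k hk s' hsame hI
      have hc' : Context n N p (s'.setReg 24 k) :=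
        (hc₂.same hsame rfl rfl rfl).setReg (by norm_num) _
      obtain ⟨s₄, hs₄, hI₄, hsame₄⟩ := Cmd.run_for (i := 25) (P := .store 5 (.reg 24) (.reg 25)
          (Expr.modz (.op .sub (.op .mul (.reg 26) (.arr 5 (.reg 24) (.reg 25)))
            (.op .mul (.arr 7 (.reg 24) (.lit 0)) (.arr 9 (.reg 25) (.lit 0)))) (.reg 2))) hc'.dim
        (fun m s'' => (∀ l : Fin n, (l : ℕ) < m → (s''.arr 5 k l : ZMod p) = G ⟨k, hk⟩ l) ∧
          (∀ l : Fin n, m ≤ (l : ℕ) → s''.arr 5 k l = s'.arr 5 k l) ∧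
          ∀ i l : Fin n, (i : ℕ) ≠ k → s''.arr 5 i l = s'.arr 5 i l)
        ⟨fun l hl => by omega, fun l _ => rfl, fun i l _ => rfl⟩
        (by
          intro m hm s'' hsame' hI'
          have hc'' : Context n N p (s''.setReg 25 m) :=
            (hc'.same hsame' rfl rfl rfl).setReg (by norm_num) _
          have h24 : s''.reg 24 = k := by
            rw [hsame'.reg 24 rfl, State.setReg_reg_self]
          have h26 : s''.reg 26 = s.arr 7 j 0 := by
            rw [hsame'.reg 26 rfl, State.setReg_reg_of_ne _ _ _ _ (by norm_num),
              hsame.reg 26 rfl, h26₂]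
          have h7 : s''.arr 7 = s.arr 7 := by
            rw [hsame'.arr 7 rfl, State.setReg_arr, hsame.arr 7 rfl, h7₂]
          have h9 : s''.arr 9 m 0 = s.arr 5 j m := by
            rw [hsame'.arr 9 rfl, State.setReg_arr, hsame.arr 9 rfl]; exact h9₂ ⟨m, hm⟩
          have h5 : s''.arr 5 k m = s.arr 5 k m :=
            (hI'.2.1 ⟨m, hm⟩ le_rfl).trans (hI.2 ⟨k, hk⟩ ⟨m, hm⟩ le_rfl)
          rw [Cmd.run]
          have he1 : (Expr.reg 24).eval (s''.setReg 25 m) = k := by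
            simp [Expr.eval, h24]
          have he2 : (Expr.reg 25).eval (s''.setReg 25 m) = m := by
            simp [Expr.eval]
          rw [he1, he2]
          refine ⟨fun l hl => ?_, fun l hl => ?_, fun i l hi => ?_⟩
          · rw [State.setArr_arr]
            by_cases hlm : (l : ℕ) = m
            · rw [if_pos ⟨rfl, by simp [hlm]⟩, hc''.cast_modz]
              have hl' : l = ⟨m, hm⟩ := Fin.ext hlm
              subst hl'
              simp [Expr.eval, Op.eval, h24, h26, h7, h9, h5, hG, vec, mat]
            · rw [if_neg (by simp [hlm]), State.setReg_arr]
              exact hI'.1 l (by omega)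
          · rw [State.setArr_arr, if_neg (by rintro ⟨-, h2⟩; omega), State.setReg_arr]
            exact hI'.2.1 l (by omega)
          · rw [State.setArr_arr, if_neg (by rintro ⟨h1, -⟩; exact hi (by exact_mod_cast h1)),
              State.setReg_arr]
            exact hI'.2.2 i l hi)
      rw [hs₄, State.setReg_arr]
      refine ⟨fun i l hi => ?_, fun i l hi => ?_⟩
      · by_cases hik : (i : ℕ) = k
        · have hi' : i = ⟨k, hk⟩ := Fin.ext hik
          subst hi'
          exact hI₄.1 l l.2
        · rw [hI₄.2.2 i l hik]
          exact hI.1 i l (by omega)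
      · rw [hI₄.2.2 i l (by omega)]
        exact hI.2 i l (by omega))
  rw [hs₃]
  ext i l
  exact hI₃.1 i l i.2

/-- A subspace is stored as the kernel of a matrix. Membership of a vector is then tested by one
product, and a new vector is adjoined by one elimination step that raises the dimension by one. -/
theorem addToKernel_run [Fact p.Prime] {s : State} (h : Context n N p s)
    (hr : s.reg 21 = Module.finrank (ZMod p) (LinearMap.ker (mat n p s 5).mulVecLin)) :
    LinearMap.ker (mat n p (addToKernel.run s) 5).mulVecLin =
        LinearMap.ker (mat n p s 5).mulVecLin ⊔ Submodule.span (ZMod p) {vec n p s 6} ∧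
      (addToKernel.run s).reg 21 = Module.finrank (ZMod p)
        (LinearMap.ker (mat n p (addToKernel.run s) 5).mulVecLin) := by
  set s₁ := (matvec 5 6 7).run s with hs₁
  have hc₁ : Context n N p s₁ := h.run rfl rfl rfl
  have h7 : vec n p s₁ 7 = mat n p s 5 *ᵥ vec n p s 6 := matvec_run h (by norm_num) (by norm_num)
  have h5 : s₁.arr 5 = s.arr 5 := Cmd.run_arr rfl s
  have h21 : s₁.reg 21 = s.reg 21 := Cmd.run_reg rfl s
  set s₂ := findPivot.run s₁ with hs₂
  have hc₂ : Context n N p s₂ := hc₁.run rfl rfl rfl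
  have h7' : s₂.arr 7 = s₁.arr 7 := Cmd.run_arr rfl s₁
  have h5' : s₂.arr 5 = s.arr 5 := (Cmd.run_arr rfl s₁).trans h5
  have h21' : s₂.reg 21 = s.reg 21 := (Cmd.run_reg rfl s₁).trans h21
  have hm : mat n p s₂ 5 = mat n p s 5 := mat_congr h5'
  have hv : vec n p s₂ 7 = mat n p s 5 *ᵥ vec n p s 6 := (vec_congr h7').trans h7
  have hrun : addToKernel.run s = (Cmd.ite (.reg 22) (.seq eliminate
      (.assign 21 (Expr.modz (.op .add (.reg 21) (.lit 1)) (.reg 1)))) .skip).run s₂ := rfl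
  rw [hrun, Cmd.run]
  rcases findPivot_run hc₁ with ⟨h22, hz⟩ | ⟨h22, j, hj, hnz⟩
  · rw [if_neg (by exact not_not.2 h22), Cmd.run, hm, h21']
    have hmem : vec n p s 6 ∈ LinearMap.ker (mat n p s 5).mulVecLin := by
      rw [LinearMap.mem_ker, mulVecLin_apply, ← h7, hz]
    have hsup : LinearMap.ker (mat n p s 5).mulVecLin ⊔ Submodule.span (ZMod p) {vec n p s 6} =
        LinearMap.ker (mat n p s 5).mulVecLin :=
      sup_eq_left.2 ((Submodule.span_singleton_le_iff_mem _ _).2 hmem)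
    exact ⟨hsup.symm, hr⟩
  · rw [if_pos (by exact h22), Cmd.run, Cmd.run]
    set s₃ := eliminate.run s₂ with hs₃
    have hc₃ : Context n N p s₃ := hc₂.run rfl rfl rfl
    have hel := eliminate_run hc₂ j hj
    rw [← hs₃, hm, hv] at hel
    have hker := ker_elimination (mat n p s 5) (vec n p s 6) j (by rw [← h7]; exact hnz)
    rw [← hel] at hker
    have hnot : vec n p s 6 ∉ LinearMap.ker (mat n p s 5).mulVecLin := by
      rw [LinearMap.mem_ker, mulVecLin_apply, ← h7]
      intro h0; rw [h0] at hnz; exact hnz rfl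
    have hfin := finrank_sup_span_singleton hnot
    rw [← hker] at hfin
    have h21'' : s₃.reg 21 = s.reg 21 := (Cmd.run_reg rfl s₂).trans h21'
    refine ⟨hker, ?_⟩
    change (s₃.setReg 21 _).reg 21 = ((Module.finrank (ZMod p)
      (LinearMap.ker (mat n p s₃ 5).mulVecLin) : ℕ) : ℤ)
    have hle : Module.finrank (ZMod p) (LinearMap.ker (mat n p s₃ 5).mulVecLin) ≤ n := by
      have := Submodule.finrank_le (LinearMap.ker (mat n p s₃ 5).mulVecLin)
      rwa [Module.finrank_fin_fun] at this
    have h1 : (Expr.reg 1).eval s₃ = N := hc₃.bound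
    have hN : N ≠ 0 := by have := h.lt; omega
    rw [State.setReg_reg_self, Expr.eval_modz (by rw [h1]; exact_mod_cast hN), h1]
    have h2 : (Expr.op .add (.reg 21) (.lit 1)).eval s₃ = (Module.finrank (ZMod p)
        (LinearMap.ker (mat n p s₃ 5).mulVecLin) : ℕ) := by
      simp only [Expr.eval, Op.eval]
      rw [h21'', hr, hfin]; push_cast; rfl
    -- The reduction of the counter modulo `reg 1` only makes the assignment safe; there is no
    -- wrap-around, since dimensions are at most `n < N`.
    rw [h2, Int.emod_eq_of_lt (by positivity)]
    have := h.lt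
    exact_mod_cast (by omega)

end Elimination

end RAM

namespace RAM

open Matrix

/-! ### Filling arrays -/

theorem Same.setReg {i j : ℕ} {P : Cmd} {s s' : State} (h : Same (.for_ i j P) s s') (v : ℤ) :
    Same (.for_ i j P) s (s'.setReg i v) where
  reg r hr := by
    have h1 : r ≠ i := by
      simp only [Cmd.modReg, Bool.or_eq_false_iff, beq_eq_false_iff_ne] at hr
      exact Ne.symm hr.1
    rw [State.setReg_reg_of_ne _ _ _ _ h1, h.reg r hr]
  arr := h.arr

theorem Same.trans_body {i j : ℕ} {P : Cmd} {s s' s'' : State} (h : Same (.for_ i j P) s s')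
    (h' : Same P s' s'') : Same (.for_ i j P) s s'' where
  reg r hr := by
    have h1 : P.modReg r = false := by
      simp only [Cmd.modReg, Bool.or_eq_false_iff, beq_eq_false_iff_ne] at hr
      exact hr.2
    rw [h'.reg r h1, h.reg r hr]
  arr a ha := by
    have h1 : P.modArr a = false := ha
    rw [h'.arr a h1, h.arr a ha]

/-- For loops in which round `x` writes cell `x` and leaves the other cells alone: a condition on
single cells can be checked round by round, without an invariant. -/
theorem Cmd.run_fill {n : ℕ} {s : State} (h0 : s.reg 0 = n) {i a : ℕ} {P : Cmd}
    (C : Fin n → ℤ → Prop)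
    (hstep : ∀ x : Fin n, ∀ s', Same (.for_ i 0 P) s s' → s'.reg i = x →
      C x ((P.run s').arr a x 0) ∧
      ∀ x' : Fin n, x' ≠ x → (P.run s').arr a x' 0 = s'.arr a x' 0) (x : Fin n) :
    C x (((Cmd.for_ i 0 P).run s).arr a x 0) := by
  obtain ⟨s', hs', hI, -⟩ := Cmd.run_for (i := i) (P := P) h0
    (fun k s' => ∀ x : Fin n, (x : ℕ) < k → C x (s'.arr a x 0))
    (by intro i hi; omega)
    (by
      intro k hk s' hsame hI x hx
      obtain ⟨h1, h2⟩ := hstep ⟨k, hk⟩ (s'.setReg i k) (hsame.setReg _) (by simp)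
      by_cases hxk : x = ⟨k, hk⟩
      · subst hxk; exact h1
      · rw [h2 x hxk]
        exact hI x (by have : (x : ℕ) ≠ k := fun h => hxk (Fin.ext h); omega))
  rw [hs', State.setReg_arr]
  exact hI x x.2

theorem Cmd.run_fill₂ {n : ℕ} {s : State} (h0 : s.reg 0 = n) {i j a : ℕ} {P : Cmd}
    (hij : i ≠ j) (hPi : P.modReg i = false) (C : Fin n → Fin n → ℤ → Prop)
    (hstep : ∀ x y : Fin n, ∀ s', Same (.for_ i 0 (.for_ j 0 P)) s s' →
      s'.reg i = x → s'.reg j = y → C x y ((P.run s').arr a x y) ∧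
      ∀ x' y' : Fin n, x' ≠ x ∨ y' ≠ y → (P.run s').arr a x' y' = s'.arr a x' y')
    (h0' : (Cmd.for_ i 0 (.for_ j 0 P)).modReg 0 = false) (x y : Fin n) :
    C x y (((Cmd.for_ i 0 (.for_ j 0 P)).run s).arr a x y) := by
  obtain ⟨s', hs', hI, -⟩ := Cmd.run_for (i := i) (P := .for_ j 0 P) h0
    (fun k s' => ∀ x y : Fin n, (x : ℕ) < k → C x y (s'.arr a x y))
    (by intro i y hi; omega)
    (by
      intro k hk s' hsame hI
      obtain ⟨s₁, hs₁, hI₁, -⟩ := Cmd.run_for (i := j) (P := P) (s := s'.setReg i k)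
        (((hsame.setReg k).reg 0 h0').trans h0)
        (fun m s'' => (∀ y : Fin n, (y : ℕ) < m → C ⟨k, hk⟩ y (s''.arr a k y)) ∧
          ∀ x y : Fin n, (x : ℕ) < k → C x y (s''.arr a x y))
        ⟨fun y hy => by omega, hI⟩
        (by
          intro m hm s'' hsame' hI'
          have hi' : (s''.setReg j m).reg i = k := by
            rw [State.setReg_reg_of_ne _ _ _ _ hij, hsame'.reg i (by simp [Cmd.modReg, hPi, hij.symm]),
              State.setReg_reg_self]
          obtain ⟨h1, h2⟩ := hstep ⟨k, hk⟩ ⟨m, hm⟩ (s''.setReg j m)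
            ((hsame.setReg k).trans_body (hsame'.setReg m)) hi' (by simp)
          refine ⟨fun y hy => ?_, fun x y hx => ?_⟩
          · by_cases hym : y = ⟨m, hm⟩
            · subst hym; exact h1
            · have := h2 ⟨k, hk⟩ y (Or.inr hym)
              simp only at this
              rw [this]
              exact hI'.1 y (by have : (y : ℕ) ≠ m := fun h => hym (Fin.ext h); omega)
          · rw [h2 x y (Or.inl (by rintro rfl; simp at hx))]
            exact hI'.2 x y hx)
      rw [hs₁, State.setReg_arr]
      intro x y hx
      by_cases hxk : x = ⟨k, hk⟩
      · subst hxk; exact hI₁.1 y y.2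
      · exact hI₁.2 x y (by have : (x : ℕ) ≠ k := fun h => hxk (Fin.ext h); omega))
  rw [hs', State.setReg_arr]
  exact hI x y x.2

theorem setArr_fill {n : ℕ} (s : State) (a : ℕ) (x : Fin n) (v : ℤ) :
    (s.setArr a x 0 v).arr a x 0 = v ∧
      ∀ x' : Fin n, x' ≠ x → (s.setArr a x 0 v).arr a x' 0 = s.arr a x' 0 := by
  refine ⟨by simp, fun x' hx' => ?_⟩
  rw [State.setArr_arr, if_neg]
  rintro ⟨h, -⟩
  exact hx' (Fin.ext (by exact_mod_cast h))

theorem setArr_fill₂ {n : ℕ} (s : State) (a : ℕ) (x y : Fin n) (v : ℤ) :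
    (s.setArr a x y v).arr a x y = v ∧
      ∀ x' y' : Fin n, x' ≠ x ∨ y' ≠ y → (s.setArr a x y v).arr a x' y' = s.arr a x' y' := by
  refine ⟨by simp, fun x' y' h => ?_⟩
  rw [State.setArr_arr, if_neg]
  rintro ⟨h1, h2⟩
  rcases h with h | h
  · exact h (Fin.ext (by exact_mod_cast h1))
  · exact h (Fin.ext (by exact_mod_cast h2))

/-! ### The dimension of the controllable subspace modulo `p` -/

/-- The identity matrix is written into array `5`. -/
def setIdentity : Cmd :=
  .for_ 24 0 (.for_ 25 0 (.store 5 (.reg 24) (.reg 25) (.op .eq (.reg 24) (.reg 25))))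

/-- The factor of entry `(reg i, reg j)` of an input matrix. -/
def injectFactor (isVec : Bool) (i j : ℕ) : Expr :=
  if isVec = true then .lit 1 else .op .eq (.reg i) (.reg j)

/-- Column `reg 19` of the input matrix given by the vector in array `8` is written into array `6`. -/
def loadColumn (isVec : Bool) : Cmd :=
  .for_ 24 0 (.store 6 (.reg 24) (.lit 0)
    (Expr.modz (.op .mul (.arr 8 (.reg 24) (.lit 0)) (injectFactor isVec 24 19)) (.reg 2)))

/-- The vector in array `6` is multiplied by the matrix in array `3`. -/
def advance : Cmd := .seq (matvec 3 6 7) (copy 7 6)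

/-- The dimension of the controllable subspace is computed in register `21`. -/
def rank (isVec : Bool) : Cmd :=
  .seq setIdentity (.seq (.assign 21 (.lit 0))
    (.for_ 19 0 (.seq (loadColumn isVec) (.for_ 20 0 (.seq addToKernel advance)))))

section Rank

variable {n N p : ℕ}

theorem setIdentity_run {s : State} (h : Context n N p s) :
    mat n p (setIdentity.run s) 5 = 1 := by
  ext x y
  refine Cmd.run_fill₂ h.dim (a := 5) (by norm_num) rfl
    (fun x y v => (v : ZMod p) = (1 : Matrix (Fin n) (Fin n) (ZMod p)) x y) ?_ rfl x y
  intro x y s' _ hx hy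
  have h1 := setArr_fill₂ s' 5 x y (Op.eval .eq (s'.reg 24) (s'.reg 25))
  rw [Cmd.run]
  simp only [Expr.eval]
  rw [hx, hy] at h1 ⊢
  refine ⟨?_, h1.2⟩
  rw [h1.1]
  by_cases hxy : x = y
  · rw [Op.eval_eq_pos (by rw [hxy]), hxy, one_apply_eq]; simp
  · rw [Op.eval_eq_neg (by simpa [Fin.ext_iff] using hxy), one_apply_ne hxy]; simp

theorem eval_injectFactor (isVec : Bool) {i j : ℕ} {s : State} {x y : Fin n}
    (hx : s.reg i = x) (hy : s.reg j = y) :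
    (injectFactor isVec i j).eval s = if isVec = true ∨ x = y then 1 else 0 := by
  cases isVec
  · simp only [injectFactor, Bool.false_eq_true, if_false, false_or, Expr.eval]
    rw [hx, hy]
    split_ifs with h
    · rw [h]; exact Op.eval_eq_pos rfl
    · exact Op.eval_eq_neg (by simpa [Fin.ext_iff] using h)
  · simp [injectFactor, Expr.eval]

theorem loadColumn_run (isVec : Bool) {s : State} (h : Context n N p s) (j : Fin n)
    (hj : s.reg 19 = j) :
    vec n p ((loadColumn isVec).run s) 6 = (inject isVec (vec n p s 8)).col j := by
  ext x
  refine Cmd.run_fill h.dim (a := 6)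
    (fun x v => (v : ZMod p) = (inject isVec (vec n p s 8)).col j x) ?_ x
  intro x s' hsame hx
  have hc : Context n N p s' := h.same hsame rfl rfl rfl
  have h8 : s'.arr 8 = s.arr 8 := hsame.arr 8 rfl
  have h19 : s'.reg 19 = j := (hsame.reg 19 rfl).trans hj
  have h1 := setArr_fill s' 6 x ((Expr.modz (.op .mul (.arr 8 (.reg 24) (.lit 0))
    (injectFactor isVec 24 19)) (.reg 2)).eval s')
  rw [Cmd.run]
  have he : (Expr.reg 24).eval s' = x := hx
  have he0 : (Expr.lit 0).eval s' = 0 := rfl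
  rw [he, he0]
  refine ⟨?_, h1.2⟩
  rw [h1.1, hc.cast_modz, Expr.eval, eval_injectFactor isVec hx h19]
  simp only [Expr.eval, Op.eval, hx, h8, Matrix.col_apply, inject, of_apply, vec]
  split_ifs <;> simp

theorem advance_run {s : State} (h : Context n N p s) :
    vec n p (advance.run s) 6 = mat n p s 3 *ᵥ vec n p s 6 := by
  rw [← matvec_run h (by norm_num : 7 ≠ 3) (by norm_num : 7 ≠ 6)]
  exact copy_run (h.run rfl rfl rfl) (by norm_num)

theorem cyc_eq_span_image {F : Type*} [Field F] (A : Matrix (Fin n) (Fin n) F) (v : Fin n → F) :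
    cyc A v = Submodule.span F ((fun k : ℕ => (A ^ k) *ᵥ v) '' Set.Iio n) := by
  rw [cyc_eq_span_lt]
  congr 1
  ext x
  constructor
  · rintro ⟨k, rfl⟩; exact ⟨k, k.2, rfl⟩
  · rintro ⟨k, hk, rfl⟩; exact ⟨⟨k, hk⟩, rfl⟩

theorem iSup_lt_succ {V : Type*} [CompleteLattice V] (f : Fin n → V) {k : ℕ} (hk : k < n) :
    (⨆ (j : Fin n) (_ : (j : ℕ) < k + 1), f j) =
      (⨆ (j : Fin n) (_ : (j : ℕ) < k), f j) ⊔ f ⟨k, hk⟩ := by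
  refine le_antisymm (iSup₂_le fun j hj => ?_) (sup_le (iSup₂_le fun j hj => ?_) ?_)
  · rcases Nat.lt_succ_iff_lt_or_eq.1 hj with h | h
    · exact le_sup_of_le_left (le_iSup₂ (f := fun (j : Fin n) (_ : (j : ℕ) < k) => f j) j h)
    · have : j = ⟨k, hk⟩ := Fin.ext h
      rw [this]; exact le_sup_right
  · exact le_iSup₂ (f := fun (j : Fin n) (_ : (j : ℕ) < k + 1) => f j) j (by omega)
  · exact le_iSup₂ (f := fun (j : Fin n) (_ : (j : ℕ) < k + 1) => f j) ⟨k, hk⟩ (Nat.lt_succ_self k)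

/-- Starting from the kernel `⊥` of the identity matrix, the vectors `A ^ k B e_j` with `k < n` are
adjoined column by column; by Cayley-Hamilton these powers suffice. At the end the maintained
dimension is the rank. -/
theorem rank_run [Fact p.Prime] (isVec : Bool) {s : State} (h : Context n N p s) :
    ((rank isVec).run s).reg 21 =
      Module.finrank (ZMod p) (Kry (mat n p s 3) (inject isVec (vec n p s 8))) := by
  set A := mat n p s 3 with hA
  set B := inject isVec (vec n p s 8) with hB
  set s₁ := setIdentity.run s with hs₁
  set s₂ := s₁.setReg 21 0 with hs₂
  have hc₁ : Context n N p s₁ := h.run rfl rfl rfl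
  have hc₂ : Context n N p s₂ := hc₁.setReg (by norm_num) _
  have h3 : s₂.arr 3 = s.arr 3 := Cmd.run_arr (P := setIdentity) rfl s
  have h8 : s₂.arr 8 = s.arr 8 := Cmd.run_arr (P := setIdentity) rfl s
  have hid : mat n p s₂ 5 = 1 := setIdentity_run h
  obtain ⟨s', hs', hI, -⟩ := Cmd.run_for (i := 19)
    (P := .seq (loadColumn isVec) (.for_ 20 0 (.seq addToKernel advance))) hc₂.dim
    (fun j s' => LinearMap.ker (mat n p s' 5).mulVecLin =
        (⨆ (x : Fin n) (_ : (x : ℕ) < j), cyc A (B.col x)) ∧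
      s'.reg 21 = Module.finrank (ZMod p) (LinearMap.ker (mat n p s' 5).mulVecLin))
    (by
      have h0 : LinearMap.ker (mat n p s₂ 5).mulVecLin = ⊥ := by
        rw [hid, mulVecLin_one, LinearMap.ker_id]
      rw [h0]
      refine ⟨by simp, ?_⟩
      rw [finrank_bot, hs₂, State.setReg_reg_self]; rfl)
    (by
      intro j hj s' hsame ⟨hI1, hI2⟩
      have hsame' := hsame.setReg j
      have hc' : Context n N p (s'.setReg 19 j) := hc₂.same hsame' rfl rfl rfl
      have h8' : vec n p (s'.setReg 19 j) 8 = vec n p s 8 :=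
        vec_congr ((hsame'.arr 8 rfl).trans h8)
      set s₃ := (loadColumn isVec).run (s'.setReg 19 j) with hs₃
      have hc₃ : Context n N p s₃ := hc'.run rfl rfl rfl
      have hv₃ : vec n p s₃ 6 = B.col ⟨j, hj⟩ := by
        rw [hs₃, loadColumn_run isVec hc' ⟨j, hj⟩ (by simp), h8']
      have hm₃ : mat n p s₃ 5 = mat n p s' 5 := mat_congr (Cmd.run_arr rfl _)
      have h3₃ : mat n p s₃ 3 = A :=
        mat_congr ((Cmd.run_arr rfl _).trans ((hsame'.arr 3 rfl).trans h3))
      have hr₃ : s₃.reg 21 = s'.reg 21 :=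
        (Cmd.run_reg rfl _).trans (State.setReg_reg_of_ne _ _ _ _ (by norm_num))
      rw [Cmd.run, ← hs₃]
      obtain ⟨s₄, hs₄, hI₄, -⟩ := Cmd.run_for (i := 20)
        (P := .seq addToKernel advance) hc₃.dim
        (fun k s'' => vec n p s'' 6 = (A ^ k) *ᵥ B.col ⟨j, hj⟩ ∧
          LinearMap.ker (mat n p s'' 5).mulVecLin =
            (⨆ (x : Fin n) (_ : (x : ℕ) < j), cyc A (B.col x)) ⊔
              Submodule.span (ZMod p) ((fun k : ℕ => (A ^ k) *ᵥ B.col ⟨j, hj⟩) '' Set.Iio k) ∧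
          s''.reg 21 = Module.finrank (ZMod p) (LinearMap.ker (mat n p s'' 5).mulVecLin))
        (by
          refine ⟨by simp [hv₃], ?_, ?_⟩
          · rw [hm₃, hI1]; simp
          · rw [hr₃, hm₃, hI2])
        (by
          intro k hk s'' hsame'' ⟨hv, hker, hreg⟩
          have hc'' : Context n N p (s''.setReg 20 k) :=
            (hc₃.same hsame'' rfl rfl rfl).setReg (by norm_num) _
          have hreg' : (s''.setReg 20 k).reg 21 = Module.finrank (ZMod p)
              (LinearMap.ker (mat n p (s''.setReg 20 k) 5).mulVecLin) := by
            rw [State.setReg_reg_of_ne _ _ _ _ (by norm_num), hreg]; rfl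
          obtain ⟨hk1, hk2⟩ := addToKernel_run hc'' hreg'
          have hm5 : mat n p (s''.setReg 20 k) 5 = mat n p s'' 5 := rfl
          have hv6 : vec n p (s''.setReg 20 k) 6 = vec n p s'' 6 := rfl
          rw [hm5, hv6] at hk1
          set s₅ := addToKernel.run (s''.setReg 20 k) with hs₅
          have hc₅ : Context n N p s₅ := hc''.run rfl rfl rfl
          have h3₅ : mat n p s₅ 3 = A :=
            (mat_congr ((Cmd.run_arr (P := addToKernel) rfl (s''.setReg 20 k)).trans
              (hsame''.arr 3 rfl))).trans h3₃
          have h6₅ : vec n p s₅ 6 = vec n p s'' 6 :=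
            vec_congr (Cmd.run_arr rfl _)
          have h5₆ : mat n p (advance.run s₅) 5 = mat n p s₅ 5 := mat_congr (Cmd.run_arr rfl _)
          have h21₆ : (advance.run s₅).reg 21 = s₅.reg 21 := Cmd.run_reg rfl _
          rw [Cmd.run, ← hs₅]
          refine ⟨?_, ?_, ?_⟩
          · rw [advance_run hc₅, h3₅, h6₅, hv, pow_succ', mulVec_mulVec]
          · rw [h5₆, hk1, hker, hv]
            have hIio : Set.Iio (k + 1) = insert k (Set.Iio k) := by
              ext x; simp only [Set.mem_Iio, Set.mem_insert_iff]; omega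
            rw [hIio, Set.image_insert_eq, Submodule.span_insert, sup_assoc,
              sup_comm (Submodule.span (ZMod p) _) (Submodule.span (ZMod p) {_})]
          · rw [h21₆, h5₆, hk2])
      rw [hs₄]
      have hm5 : mat n p (s₄.setReg 20 n) 5 = mat n p s₄ 5 := rfl
      rw [State.setReg_reg_of_ne _ _ _ _ (by norm_num), hm5]
      refine ⟨?_, hI₄.2.2⟩
      rw [hI₄.2.1, iSup_lt_succ _ hj, ← cyc_eq_span_image])
  have hrun : (rank isVec).run s = s'.setReg 19 n := hs'
  rw [hrun, State.setReg_reg_of_ne _ _ _ _ (by norm_num), hI.2, hI.1]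
  have : (⨆ (x : Fin n) (_ : (x : ℕ) < n), cyc A (B.col x)) = Kry A B := by
    simp [Kry]
  rw [this]

end Rank

end RAM

namespace RAM

open Matrix

/-! ### The greedy algorithm modulo a prime -/

/-- The state of the greedy algorithm after `g` rounds: the rank is `r` after `c` improvements. -/
structure Progress (n m k g r c : ℕ) : Prop where
  rank_le : r ≤ n
  count_le_rank : c ≤ r
  count_le : c ≤ k
  count_eq : c = g ∨ r = n
  gap : m ^ c * (n - r) ≤ (m - 1) ^ c * n

/-- The field `gap` is `n - r ≤ n (1 - 1/m)^c` without denominators. Below full rank the assumed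
gain forces a strict improvement, which contributes another factor `1 - 1/m`; at full rank nothing
changes any more. -/
theorem Progress.step {n m k g r r' c : ℕ} (h : Progress n m k g r c) (hr : r ≤ r') (hr' : r' ≤ n)
    (hgain : r ≠ n → n - r ≤ m * (r' - r)) (hk : n * (m - 1) ^ k < m ^ k) :
    Progress n m k (g + 1) r' (if r < r' then c + 1 else c) := by
  by_cases hrn : r = n
  · have : r' = r := by omega
    subst this
    rw [if_neg (lt_irrefl _)]
    exact ⟨h.rank_le, h.count_le_rank, h.count_le, Or.inr hrn, h.gap⟩
  · have hg := hgain hrn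
    have hrn' : r < n := lt_of_le_of_ne h.rank_le hrn
    have hlt : r < r' := by
      by_contra hle
      have : r' - r = 0 := by omega
      rw [this] at hg; omega
    have hm : 1 ≤ m := by
      rcases Nat.eq_zero_or_pos m with h0 | h0
      · rw [h0] at hg; omega
      · exact h0
    rw [if_pos hlt]
    refine ⟨hr', by have := h.count_le_rank; omega, ?_, ?_, ?_⟩
    -- After `k` improvements the gap would be less than one, which contradicts `r < n`; so another
    -- improvement is possible only if `c < k`.
    · rcases Nat.lt_or_eq_of_le h.count_le with hck | hck
      · exact hck
      · exfalso
        have hgap := h.gap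
        rw [hck] at hgap
        have : m ^ k * 1 ≤ m ^ k * (n - r) := Nat.mul_le_mul_left _ (by omega)
        rw [mul_comm n] at hk
        omega
    · rcases h.count_eq with h1 | h1
      · exact Or.inl (by omega)
      · exact absurd h1 hrn
    · have h1 : m * (n - r') ≤ (m - 1) * (n - r) := by
        obtain ⟨m, rfl⟩ := Nat.exists_eq_add_of_le' hm
        obtain ⟨d, rfl⟩ := Nat.exists_eq_add_of_le hlt.le
        obtain ⟨e, rfl⟩ := Nat.exists_eq_add_of_le hr'
        have e1 : r + d + e - (r + d) = e := by omega
        have e2 : r + d + e - r = d + e := by omega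
        have e3 : r + d - r = d := by omega
        rw [e2, e3] at hg
        rw [e1, e2]
        simp only [Nat.add_sub_cancel]
        nlinarith
      calc m ^ (c + 1) * (n - r') = m ^ c * (m * (n - r')) := by ring
        _ ≤ m ^ c * ((m - 1) * (n - r)) := Nat.mul_le_mul_left _ h1
        _ = (m - 1) * (m ^ c * (n - r)) := by ring
        _ ≤ (m - 1) * ((m - 1) ^ c * n) := Nat.mul_le_mul_left _ h.gap
        _ = (m - 1) ^ (c + 1) * n := by ring

/-- Every improvement raises the rank, so `n` rounds always suffice; the program need not know `k`.
-/
theorem Progress.rank_eq {n m k r c : ℕ} (h : Progress n m k n r c) : r = n := by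
  have h1 := h.rank_le
  have h2 := h.count_le_rank
  rcases h.count_eq with h3 | h3 <;> omega

/-- Array `8` receives the vector in array `4`, with entry `reg 11` increased by `reg 12`. -/
def setCandidate : Cmd :=
  .for_ 24 0 (.store 8 (.reg 24) (.lit 0) (Expr.modz (.op .add (.arr 4 (.reg 24) (.lit 0))
    (.op .mul (.reg 12) (.op .eq (.reg 24) (.reg 11)))) (.reg 2)))

/-- The best candidate found so far is recorded in the registers `13`, `14` and `15`. -/
def record : Cmd :=
  .ite (.op .lt (.reg 13) (.reg 21))
    (.seq (.assign 13 (.reg 21)) (.seq (.assign 14 (.reg 11)) (.assign 15 (.reg 12)))) .skip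

/-- The search for the best change of a coordinate. -/
def search (isVec : Bool) : Cmd :=
  .for_ 11 0 (.for_ 12 2 (.seq setCandidate (.seq (rank isVec) record)))

/-- A round of the greedy algorithm. -/
def greedyRound (isVec : Bool) : Cmd :=
  .seq (.seq (.assign 13 (.reg 16)) (.seq (.assign 14 (.lit 0)) (.assign 15 (.lit 0))))
    (.seq (search isVec)
      (.seq (.store 4 (.reg 14) (.lit 0)
          (Expr.modz (.op .add (.arr 4 (.reg 14) (.lit 0)) (.reg 15)) (.reg 2)))
        (.seq (.assign 17 (Expr.modz (.op .add (.reg 17) (.op .lt (.reg 16) (.reg 13))) (.reg 1)))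
          (.assign 16 (.reg 13)))))

/-- The greedy algorithm, with the vector in array `4`, its rank in register `16` and the number of
improvements in register `17`. -/
def greedy (isVec : Bool) : Cmd :=
  .seq (.for_ 24 0 (.store 4 (.reg 24) (.lit 0) (.lit 0)))
    (.seq (.seq (.assign 16 (.lit 0)) (.assign 17 (.lit 0))) (.for_ 10 0 (greedyRound isVec)))

section Greedy

variable {n N p : ℕ}

/-- The dimension of the controllable subspace. -/
noncomputable def krank {F : Type*} [Field F] (isVec : Bool) (A : Matrix (Fin n) (Fin n) F)
    (b : Fin n → F) : ℕ :=
  Module.finrank F (Kry A (inject isVec b))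

theorem krank_le {F : Type*} [Field F] (isVec : Bool) (A : Matrix (Fin n) (Fin n) F)
    (b : Fin n → F) : krank isVec A b ≤ n := by
  have := Submodule.finrank_le (Kry A (inject isVec b))
  rwa [Module.finrank_fin_fun] at this

theorem krank_eq_iff {F : Type*} [Field F] (isVec : Bool) (A : Matrix (Fin n) (Fin n) F)
    (b : Fin n → F) : krank isVec A b = n ↔ Kry A (inject isVec b) = ⊤ := by
  refine ⟨fun h => Submodule.eq_top_of_finrank_eq ?_, fun h => ?_⟩
  · rw [Module.finrank_fin_fun]; exact h
  · rw [krank, h, finrank_top, Module.finrank_fin_fun]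

theorem krank_zero {F : Type*} [Field F] (isVec : Bool) (A : Matrix (Fin n) (Fin n) F) :
    krank isVec A 0 = 0 := by
  have h : Kry A (inject isVec (0 : Fin n → F)) = ⊥ := by
    have : ∀ j, (inject isVec (0 : Fin n → F)).col j = 0 := fun j => by
      ext i; simp [inject]
    simp [Kry, this, cyc_zero]
  rw [krank, h, finrank_bot]

theorem setCandidate_run {s : State} (h : Context n N p s) (i : Fin n) (t : ℤ)
    (hi : s.reg 11 = i) (ht : s.reg 12 = t) :
    vec n p (setCandidate.run s) 8 = vec n p s 4 + Pi.single i (t : ZMod p) := by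
  ext x
  refine Cmd.run_fill h.dim (a := 8)
    (fun x v => (v : ZMod p) = (vec n p s 4 + Pi.single i (t : ZMod p) : Fin n → ZMod p) x) ?_ x
  intro x s' hsame hx
  have hc : Context n N p s' := h.same hsame rfl rfl rfl
  have h4 : s'.arr 4 = s.arr 4 := hsame.arr 4 rfl
  have h11 : s'.reg 11 = i := (hsame.reg 11 rfl).trans hi
  have h12 : s'.reg 12 = t := (hsame.reg 12 rfl).trans ht
  have h1 := setArr_fill s' 8 x ((Expr.modz (.op .add (.arr 4 (.reg 24) (.lit 0))
    (.op .mul (.reg 12) (.op .eq (.reg 24) (.reg 11)))) (.reg 2)).eval s')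
  rw [Cmd.run]
  have he : (Expr.reg 24).eval s' = x := hx
  have he0 : (Expr.lit 0).eval s' = 0 := rfl
  rw [he, he0]
  refine ⟨?_, h1.2⟩
  rw [h1.1, hc.cast_modz]
  simp only [Expr.eval, hx, h11, h12, h4]
  by_cases hxi : x = i
  · rw [Op.eval_eq_pos (by rw [hxi])]
    subst hxi
    simp [Op.eval, vec]
  · rw [Op.eval_eq_neg (by simpa [Fin.ext_iff] using hxi)]
    simp [Op.eval, vec, hxi]

/-- The best candidate in the set `D` is recorded in the registers `13`, `14` and `15`, the rank to
be exceeded being `r`. -/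
def Searched (f : Fin n → ℕ → ℕ) (p r : ℕ) (D : Fin n → ℕ → Prop) (s : State) : Prop :=
  ∃ r' : ℕ, s.reg 13 = r' ∧ (∀ i t, D i t → f i t ≤ r') ∧
    ((r' = r ∧ s.reg 14 = 0 ∧ s.reg 15 = 0) ∨
      (r < r' ∧ ∃ (i : Fin n) (t : ℕ), t < p ∧ s.reg 14 = i ∧ s.reg 15 = t ∧ f i t = r'))

theorem Searched.congr {f : Fin n → ℕ → ℕ} {p r : ℕ} {D D' : Fin n → ℕ → Prop} {s s' : State}
    (h : Searched f p r D s) (hD : ∀ i t, D' i t → D i t) (h13 : s'.reg 13 = s.reg 13)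
    (h14 : s'.reg 14 = s.reg 14) (h15 : s'.reg 15 = s.reg 15) : Searched f p r D' s' := by
  obtain ⟨r', h1, h2, h3⟩ := h
  refine ⟨r', h13.trans h1, fun i t hi => h2 i t (hD i t hi), ?_⟩
  rw [h14, h15]; exact h3

theorem record_run {f : Fin n → ℕ → ℕ} {p r : ℕ} {D : Fin n → ℕ → Prop} {s : State}
    (h : Searched f p r D s) (i : Fin n) {t : ℕ} (ht : t < p) (hi : s.reg 11 = i)
    (h12 : s.reg 12 = t) (h21 : s.reg 21 = f i t) :
    Searched f p r (fun i' t' => D i' t' ∨ (i' = i ∧ t' = t)) (record.run s) := by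
  obtain ⟨r', h1, h2, h3⟩ := h
  rw [record, Cmd.run]
  have hcond : (Expr.op .lt (.reg 13) (.reg 21)).eval s ≠ 0 ↔ r' < f i t := by
    simp only [Expr.eval]
    rw [Op.eval_lt_ne_zero, h1, h21]; simp
  by_cases hlt : r' < f i t
  · rw [if_pos (hcond.2 hlt)]
    refine ⟨f i t, ?_, ?_, Or.inr ⟨?_, i, t, ht, ?_, ?_, rfl⟩⟩
    · simp [Cmd.run, Expr.eval, h21]
    · rintro i' t' (hD | ⟨rfl, rfl⟩)
      · exact (h2 i' t' hD).trans hlt.le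
      · exact le_rfl
    · rcases h3 with h3 | h3 <;> omega
    · simp [Cmd.run, Expr.eval, hi]
    · simp [Cmd.run, Expr.eval, h12]
  · rw [if_neg (fun h => hlt (hcond.1 h))]
    refine ⟨r', h1, ?_, h3⟩
    rintro i' t' (hD | ⟨rfl, rfl⟩)
    · exact h2 i' t' hD
    · exact not_lt.1 hlt

/-- Brute force over all positions and all residues. The invariant is `Searched` for the set of
candidates visited so far, which `record_run` enlarges by one. -/
theorem search_run [Fact p.Prime] (isVec : Bool) {s : State} (h : Context n N p s) {r : ℕ}
    (h13 : s.reg 13 = r) (h14 : s.reg 14 = 0) (h15 : s.reg 15 = 0) :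
    Searched (fun i t => krank isVec (mat n p s 3) (vec n p s 4 + Pi.single i (t : ZMod p))) p r
      (fun _ t => t < p) ((search isVec).run s) := by
  set f : Fin n → ℕ → ℕ :=
    fun i t => krank isVec (mat n p s 3) (vec n p s 4 + Pi.single i (t : ZMod p)) with hf
  obtain ⟨s', hs', hI, -⟩ := Cmd.run_for (i := 11)
    (P := .for_ 12 2 (.seq setCandidate (.seq (rank isVec) record))) h.dim
    (fun k s' => Searched f p r (fun i t => (i : ℕ) < k ∧ t < p) s')
    ⟨r, h13, fun i t hi => by omega, Or.inl ⟨rfl, h14, h15⟩⟩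
    (by
      intro k hk s' hsame hI
      have hsame' := hsame.setReg k
      have hc' : Context n N p (s'.setReg 11 k) := h.same hsame' rfl rfl rfl
      obtain ⟨s₁, hs₁, hI₁, -⟩ := Cmd.run_for (i := 12)
        (P := .seq setCandidate (.seq (rank isVec) record)) hc'.modulus
        (fun m s'' => Searched f p r
          (fun i t => ((i : ℕ) < k ∧ t < p) ∨ (i = ⟨k, hk⟩ ∧ t < m)) s'')
        (by
          refine hI.congr (fun i t hit => ?_) (State.setReg_reg_of_ne _ _ _ _ (by norm_num))
            (State.setReg_reg_of_ne _ _ _ _ (by norm_num))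
            (State.setReg_reg_of_ne _ _ _ _ (by norm_num))
          rcases hit with hit | hit
          · exact hit
          · omega)
        (by
          intro m hm s'' hsame'' hI'
          have hs''' := hsame'.trans_body (hsame''.setReg m)
          set s₂ := s''.setReg 12 m with hs₂
          have hc₂ : Context n N p s₂ := h.same hs''' rfl rfl rfl
          have h11₂ : s₂.reg 11 = k :=
            ((hsame''.setReg m).reg 11 rfl).trans (State.setReg_reg_self _ _ _)
          have h12₂ : s₂.reg 12 = (m : ℤ) := State.setReg_reg_self _ _ _
          set s₃ := setCandidate.run s₂ with hs₃
          have hc₃ : Context n N p s₃ := hc₂.run rfl rfl rfl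
          have h8₃ : vec n p s₃ 8 = vec n p s 4 + Pi.single ⟨k, hk⟩ (m : ZMod p) := by
            rw [hs₃, setCandidate_run hc₂ ⟨k, hk⟩ m h11₂ h12₂, vec_congr (hs'''.arr 4 rfl),
              Int.cast_natCast]
          have h3₃ : mat n p s₃ 3 = mat n p s 3 :=
            mat_congr ((Cmd.run_arr (P := setCandidate) rfl s₂).trans (hs'''.arr 3 rfl))
          set s₄ := (rank isVec).run s₃ with hs₄
          have hrank : s₄.reg 21 = f ⟨k, hk⟩ m := by
            rw [hs₄, rank_run isVec hc₃, h8₃, h3₃]; rfl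
          have hreg : ∀ q, q = 11 ∨ q = 12 ∨ q = 13 ∨ q = 14 ∨ q = 15 →
              s₄.reg q = s₂.reg q := by
            rintro q (rfl | rfl | rfl | rfl | rfl) <;>
              exact (Cmd.run_reg (P := rank isVec) rfl s₃).trans
                (Cmd.run_reg (P := setCandidate) rfl s₂)
          have hI₄ : Searched f p r
              (fun i t => ((i : ℕ) < k ∧ t < p) ∨ (i = ⟨k, hk⟩ ∧ t < m)) s₄ := by
            refine hI'.congr (fun _ _ h => h) ?_ ?_ ?_ <;> rw [hreg _ (by simp), hs₂] <;>
              exact State.setReg_reg_of_ne _ _ _ _ (by norm_num)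
          have hrec := record_run hI₄ ⟨k, hk⟩ hm ((hreg 11 (by simp)).trans h11₂)
            ((hreg 12 (by simp)).trans h12₂) hrank
          have hrun : (Cmd.seq setCandidate (.seq (rank isVec) record)).run s₂ = record.run s₄ := rfl
          rw [hrun]
          refine hrec.congr (fun i t hit => ?_) rfl rfl rfl
          rcases hit with hit | ⟨hit, ht⟩
          · exact Or.inl (Or.inl hit)
          · rcases Nat.lt_succ_iff_lt_or_eq.1 ht with ht | ht
            · exact Or.inl (Or.inr ⟨hit, ht⟩)
            · exact Or.inr ⟨hit, ht⟩)
      rw [hs₁]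
      refine hI₁.congr (fun i t hit => ?_) (State.setReg_reg_of_ne _ _ _ _ (by norm_num))
        (State.setReg_reg_of_ne _ _ _ _ (by norm_num))
        (State.setReg_reg_of_ne _ _ _ _ (by norm_num))
      rcases Nat.lt_succ_iff_lt_or_eq.1 hit.1 with hik | hik
      · exact Or.inl ⟨hik, hit.2⟩
      · exact Or.inr ⟨Fin.ext hik, hit.2⟩)
  have hrun : (search isVec).run s = s'.setReg 11 n := hs'
  rw [hrun]
  exact hI.congr (fun i t ht => ⟨i.2, ht⟩) (State.setReg_reg_of_ne _ _ _ _ (by norm_num))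
    (State.setReg_reg_of_ne _ _ _ _ (by norm_num)) (State.setReg_reg_of_ne _ _ _ _ (by norm_num))

/-- The integers in column `0` of an array. -/
def cells (n : ℕ) (s : State) (a : ℕ) : Fin n → ℤ := fun i => s.arr a i 0

theorem hammingNorm_le_of_forall {b b' : Fin n → ℤ} (h : ∀ i, b i = 0 → b' i = 0) :
    hammingNorm b' ≤ hammingNorm b := by
  refine Finset.card_le_card fun i => ?_
  simp only [Finset.mem_filter, Finset.mem_univ, true_and]
  exact fun h1 h2 => h1 (h i h2)

theorem hammingNorm_le_succ {b b' : Fin n → ℤ} (j : Fin n) (h : ∀ i, i ≠ j → b' i = b i) :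
    hammingNorm b' ≤ hammingNorm b + 1 := by
  refine (Finset.card_le_card (t := insert j (Finset.univ.filter fun i => b i ≠ 0)) fun i => ?_).trans
    (Finset.card_insert_le _ _)
  simp only [Finset.mem_filter, Finset.mem_univ, true_and, Finset.mem_insert]
  intro h1
  by_cases hij : i = j
  · exact Or.inl hij
  · rw [h i hij] at h1; exact Or.inr h1

/-- The counter goes up only if the rank does, and only then can a zero entry become nonzero. This
keeps the weight of the vector below the number of improvements. -/
theorem greedyRound_run [Fact p.Prime] (isVec : Bool) {s : State} (h : Context n N p s) {c : ℕ}
    (hc : c + 1 < N)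
    (h16 : s.reg 16 = krank isVec (mat n p s 3) (vec n p s 4)) (h17 : s.reg 17 = c)
    (hb : hammingNorm (cells n s 4) ≤ c) :
    ∃ r' : ℕ, ((greedyRound isVec).run s).reg 16 = r' ∧
      r' = krank isVec (mat n p s 3) (vec n p ((greedyRound isVec).run s) 4) ∧
      krank isVec (mat n p s 3) (vec n p s 4) ≤ r' ∧
      (∀ i (t : ZMod p), krank isVec (mat n p s 3) (vec n p s 4 + Pi.single i t) ≤ r') ∧
      ((greedyRound isVec).run s).reg 17 =
        ((if krank isVec (mat n p s 3) (vec n p s 4) < r' then c + 1 else c : ℕ) : ℤ) ∧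
      hammingNorm (cells n ((greedyRound isVec).run s) 4) ≤
        if krank isVec (mat n p s 3) (vec n p s 4) < r' then c + 1 else c := by
  set r := krank isVec (mat n p s 3) (vec n p s 4) with hr
  set s₁ := ((s.setReg 13 r).setReg 14 0).setReg 15 0 with hs₁
  have hc₁ : Context n N p s₁ :=
    ((h.setReg (by norm_num) _).setReg (by norm_num) _).setReg (by norm_num) _
  have hsearch := search_run isVec hc₁ (r := r) (by simp [hs₁]) (by simp [hs₁]) (by simp [hs₁])
  set s₂ := (search isVec).run s₁ with hs₂
  have hc₂ : Context n N p s₂ := hc₁.run rfl rfl rfl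
  have h4₂ : s₂.arr 4 = s.arr 4 := Cmd.run_arr (P := search isVec) rfl s₁
  have h16₂ : s₂.reg 16 = r := by
    rw [hs₂, Cmd.run_reg (P := search isVec) rfl s₁, hs₁]
    simpa using h16
  have h17₂ : s₂.reg 17 = c := by
    rw [hs₂, Cmd.run_reg (P := search isVec) rfl s₁, hs₁]
    simpa using h17
  obtain ⟨r', h13, hbest, hcase⟩ := hsearch
  set v : ℤ := (Expr.modz (.op .add (.arr 4 (.reg 14) (.lit 0)) (.reg 15)) (.reg 2)).eval s₂ with hv
  set s₃ := s₂.setArr 4 (s₂.reg 14) 0 v with hs₃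
  have hc₃ : Context n N p s₃ := hc₂.congr rfl rfl rfl
  set c' : ℤ := (Expr.modz (.op .add (.reg 17) (.op .lt (.reg 16) (.reg 13))) (.reg 1)).eval s₃
    with hc'
  have hrun : (greedyRound isVec).run s = (s₃.setReg 17 c').setReg 16 (s₂.reg 13) := by
    have h1 : (greedyRound isVec).run s = (Cmd.seq (search isVec)
      (.seq (.store 4 (.reg 14) (.lit 0)
          (Expr.modz (.op .add (.arr 4 (.reg 14) (.lit 0)) (.reg 15)) (.reg 2)))
        (.seq (.assign 17 (Expr.modz (.op .add (.reg 17) (.op .lt (.reg 16) (.reg 13))) (.reg 1)))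
          (.assign 16 (.reg 13))))).run (((s.setReg 13 (s.reg 16)).setReg 14 0).setReg 15 0) := rfl
    rw [h1, h16]
    change (s₃.setReg 17 c').setReg 16 ((s₃.setReg 17 c').reg 13) = _
    rw [State.setReg_reg_of_ne _ _ _ _ (by norm_num)]
    rfl
  have hrr' : r ≤ r' := by rcases hcase with hcase | hcase <;> omega
  have hc'val : c' = ((if r < r' then c + 1 else c : ℕ) : ℤ) := by
    have h1 : (Expr.reg 1).eval s₃ = N := hc₃.bound
    have hN : N ≠ 0 := by omega
    have h2 : (Expr.op .add (.reg 17) (.op .lt (.reg 16) (.reg 13))).eval s₃ =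
        ((if r < r' then c + 1 else c : ℕ) : ℤ) := by
      simp only [Expr.eval, hs₃, State.setArr_reg, h16₂, h17₂, h13]
      split_ifs with hlt
      · rw [Op.eval_lt_pos (by exact_mod_cast hlt)]; simp [Op.eval]
      · rw [Op.eval_lt_neg (by exact_mod_cast hlt)]; simp [Op.eval]
    rw [hc', Expr.eval_modz (by rw [h1]; exact_mod_cast hN), h1, h2,
      Int.emod_eq_of_lt (by positivity)]
    split_ifs <;> exact_mod_cast (by omega)
  have hv4 : (v : ZMod p) = (s.arr 4 (s₂.reg 14) 0 : ZMod p) + (s₂.reg 15 : ZMod p) := by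
    rw [hv, hc₂.cast_modz]
    simp [Expr.eval, Op.eval, h4₂]
  have harr : ((greedyRound isVec).run s).arr 4 = s₃.arr 4 := by rw [hrun]; rfl
  have hcells : ∀ i : Fin n, s₃.arr 4 i 0 =
      if (i : ℤ) = s₂.reg 14 then v else s.arr 4 i 0 := by
    intro i
    rw [hs₃, State.setArr_arr, h4₂]
    simp
  refine ⟨r', by rw [hrun, State.setReg_reg_self, h13], ?_, hrr', ?_, ?_, ?_⟩
  · have hvec : ∀ x, vec n p ((greedyRound isVec).run s) 4 x =
        vec n p s 4 x + if (x : ℤ) = s₂.reg 14 then (s₂.reg 15 : ZMod p) else 0 := by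
      intro x
      simp only [vec, harr, hcells]
      split_ifs with hx
      · rw [hv4, hx]
      · simp
    rcases hcase with ⟨h1, h14, h15⟩ | ⟨h1, i, t, ht, h14, h15, h2⟩
    · have : vec n p ((greedyRound isVec).run s) 4 = vec n p s 4 := by
        funext x; rw [hvec, h15]; simp
      rw [this, h1]
    · have : vec n p ((greedyRound isVec).run s) 4 = vec n p s 4 + Pi.single i (t : ZMod p) := by
        funext x; rw [hvec, h14, h15]
        by_cases hx : x = i
        · subst hx; simp
        · rw [if_neg (by simpa [Fin.ext_iff] using hx)]; simp [hx]
      rw [this]; exact h2.symm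
  · intro i t
    have := hbest i t.val (ZMod.val_lt t)
    simp only [ZMod.natCast_val, ZMod.cast_id', id] at this
    exact this
  · rw [hrun, State.setReg_reg_of_ne _ _ _ _ (by norm_num), State.setReg_reg_self, hc'val]
  · rcases hcase with ⟨h1, h14, h15⟩ | ⟨h1, i, t, ht, h14, h15, h2⟩
    · rw [if_neg (by omega)]
      refine (hammingNorm_le_of_forall fun i hi => ?_).trans hb
      simp only [cells, harr, hcells] at hi ⊢
      split_ifs with hx
      -- Without an improvement the update adds `0` to cell `0`: the cell is merely reduced modulo
      -- `p`, and a zero stays a zero.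
      · have h2 : (Expr.reg 2).eval s₂ = p := hc₂.modulus
        rw [hv, Expr.eval_modz (by rw [h2]; exact_mod_cast h.pos), h2]
        simp only [Expr.eval, Op.eval, h15, h4₂, add_zero]
        rw [← hx, hi, Int.zero_emod]
      · exact hi
    · rw [if_pos h1]
      refine (hammingNorm_le_succ (b := cells n s 4) i fun x hx => ?_).trans (by omega)
      simp only [cells, harr, hcells]
      rw [if_neg (by rw [h14]; simpa [Fin.ext_iff] using hx)]

/-- The first claims hold for every prime. The bound on the number of improvements is stated for all
`m` and `k` at once, because the optimal weight is unknown to the program and enters only the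
analysis. -/
theorem greedy_run [Fact p.Prime] (isVec : Bool) {s : State} (h : Context n N p s) (hN : n + 1 < N) :
    ∃ c : ℕ, ((greedy isVec).run s).reg 17 = c ∧
      ((greedy isVec).run s).reg 16 =
        krank isVec (mat n p s 3) (vec n p ((greedy isVec).run s) 4) ∧
      hammingNorm (cells n ((greedy isVec).run s) 4) ≤ c ∧ c ≤ n ∧
      ∀ m k : ℕ, n < p → n * (m - 1) ^ k < m ^ k →
        (∃ b : Fin n → ZMod p, hammingNorm b ≤ m ∧ Kry (mat n p s 3) (inject isVec b) = ⊤) →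
        ((greedy isVec).run s).reg 16 = n ∧ c ≤ k := by
  set s₁ := (Cmd.for_ 24 0 (.store 4 (.reg 24) (.lit 0) (.lit 0))).run s with hs₁
  have hz : ∀ i : Fin n, s₁.arr 4 i 0 = 0 := by
    refine Cmd.run_fill h.dim (a := 4) (fun _ v => v = 0) ?_
    intro x s' _ hx
    rw [Cmd.run]
    have he : (Expr.reg 24).eval s' = x := hx
    have he0 : (Expr.lit 0).eval s' = 0 := rfl
    rw [he, he0]
    exact setArr_fill s' 4 x 0
  set s₂ := (s₁.setReg 16 0).setReg 17 0 with hs₂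
  have hc₂ : Context n N p s₂ :=
    ((h.run (P := .for_ 24 0 (.store 4 (.reg 24) (.lit 0) (.lit 0))) rfl rfl rfl).setReg
      (by norm_num) _).setReg (by norm_num) _
  have h3₂ : s₂.arr 3 = s.arr 3 :=
    Cmd.run_arr (P := .for_ 24 0 (.store 4 (.reg 24) (.lit 0) (.lit 0))) rfl s
  have hv₂ : vec n p s₂ 4 = 0 := by
    funext i
    have : s₂.arr 4 i 0 = 0 := hz i
    simp [vec, this]
  obtain ⟨s', hs', hI, -⟩ := Cmd.run_for (i := 10) (P := greedyRound isVec) hc₂.dim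
    (fun g s' => ∃ c : ℕ, s'.reg 17 = c ∧
      s'.reg 16 = krank isVec (mat n p s 3) (vec n p s' 4) ∧
      hammingNorm (cells n s' 4) ≤ c ∧ c ≤ g ∧
      ∀ m k : ℕ, n < p → n * (m - 1) ^ k < m ^ k →
        (∃ b : Fin n → ZMod p, hammingNorm b ≤ m ∧ Kry (mat n p s 3) (inject isVec b) = ⊤) →
        Progress n m k g (krank isVec (mat n p s 3) (vec n p s' 4)) c)
    (by
      refine ⟨0, by simp [hs₂], ?_, ?_, le_rfl, fun m k hp hk _ => ?_⟩
      · rw [hv₂, krank_zero]; simp [hs₂]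
      · rw [Nat.le_zero, hammingNorm_eq_zero]
        funext i; exact hz i
      · rw [hv₂, krank_zero]
        exact ⟨Nat.zero_le _, le_rfl, Nat.zero_le _, Or.inl rfl, by simp⟩)
    (by
      rintro g hg s' hsame ⟨c, h17, h16, hb, hcg, hprog⟩
      have hsame' := hsame.setReg g
      set s₃ := s'.setReg 10 g with hs₃
      have hc₃ : Context n N p s₃ := hc₂.same hsame' rfl rfl rfl
      have h3₃ : mat n p s₃ 3 = mat n p s 3 := mat_congr ((hsame'.arr 3 rfl).trans h3₂)
      have h17₃ : s₃.reg 17 = c := (State.setReg_reg_of_ne _ _ _ _ (by norm_num)).trans h17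
      have h16₃ : s₃.reg 16 = krank isVec (mat n p s₃ 3) (vec n p s₃ 4) := by
        rw [h3₃]
        exact (State.setReg_reg_of_ne _ _ _ _ (by norm_num)).trans h16
      obtain ⟨r', e1, e2, e3, e4, e5, e6⟩ :=
        greedyRound_run isVec hc₃ (by omega : c + 1 < N) h16₃ h17₃ hb
      rw [h3₃] at e2 e3 e4 e5 e6
      have hv₃ : vec n p s₃ 4 = vec n p s' 4 := rfl
      rw [hv₃] at e3 e4 e5 e6
      refine ⟨_, e5, ?_, e6, ?_, fun m k hp hk hex => ?_⟩
      · rw [← e2, e1]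
      · split_ifs <;> omega
      · rw [← e2]
        refine (hprog m k hp hk hex).step e3 (by rw [e2]; exact krank_le _ _ _) (fun hne => ?_) hk
        obtain ⟨b, hbm, hbt⟩ := hex
        have hp0 : NeZero p := ⟨h.pos⟩
        -- All residues serve as increments; this is where `n < p` is needed.
        obtain ⟨i, t, -, hit⟩ := exists_greedy_step isVec (mat n p s 3) Finset.univ
          (by rw [Finset.card_univ, ZMod.card]; exact hp) hbm hbt (vec n p s' 4)
          (fun htop => hne ((krank_eq_iff _ _ _).2 htop))
        refine hit.trans (Nat.mul_le_mul_left _ (Nat.sub_le_sub_right (e4 i t) _)))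
  have hrun : (greedy isVec).run s = s'.setReg 10 n := hs'
  obtain ⟨c, h17, h16, hb, hcn, hprog⟩ := hI
  have hr16 : ((greedy isVec).run s).reg 16 = s'.reg 16 := by
    rw [hrun, State.setReg_reg_of_ne _ _ _ _ (by norm_num)]
  refine ⟨c, ?_, ?_, ?_, hcn, fun m k hp hk hex => ?_⟩
  · rw [hrun, State.setReg_reg_of_ne _ _ _ _ (by norm_num), h17]
  · rw [hr16, h16, hrun]; rfl
  · rw [hrun]; exact hb
  · have := hprog m k hp hk hex
    refine ⟨?_, this.count_le⟩
    rw [hr16, h16, this.rank_eq]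

end Greedy

end RAM

namespace RAM

open Matrix

/-! ### The main program -/

/-- Register `3` is set to a nonzero value exactly if `reg 2` is a prime. -/
def primeTest : Cmd :=
  .seq (.assign 3 (.op .lt (.lit 1) (.reg 2))) (.for_ 4 2
    (.ite (.op .mul (.op .lt (.lit 1) (.reg 4)) (.op .eq (Expr.modz (.reg 2) (.reg 4)) (.lit 0)))
      (.assign 3 (.lit 0)) .skip))

/-- Register `9` is multiplied by all the denominators except the one with index
`(reg 5, reg 6)`. -/
def mulDenominators : Cmd :=
  .for_ 7 0 (.for_ 8 0 (.ite (.op .mul (.op .eq (.reg 7) (.reg 5)) (.op .eq (.reg 8) (.reg 6)))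
    .skip (.assign 9 (Expr.modz (.op .mul (.reg 9) (.arr 1 (.reg 7) (.reg 8))) (.reg 2)))))

/-- The matrix with cleared denominators is reduced and written into array `3`. -/
def reduce : Cmd :=
  .for_ 5 0 (.for_ 6 0 (.seq (.assign 9 (Expr.modz (.arr 0 (.reg 5) (.reg 6)) (.reg 2)))
    (.seq mulDenominators (.store 3 (.reg 5) (.reg 6) (.reg 9)))))

/-- The input matrix for the vector in array `4` is written into array `2`. -/
def writeOutput (isVec : Bool) : Cmd :=
  .for_ 24 0 (.for_ 25 0 (.store 2 (.reg 24) (.reg 25)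
    (Expr.modz (.op .mul (.arr 4 (.reg 24) (.lit 0)) (injectFactor isVec 24 25)) (.reg 2))))

/-- The result of the greedy algorithm is kept if it is better than the previous ones. -/
def update (isVec : Bool) : Cmd :=
  .ite (.op .mul (.op .eq (.reg 16) (.reg 0)) (.op .lt (.reg 17) (.reg 18)))
    (.seq (.assign 18 (.reg 17)) (writeOutput isVec)) .skip

/-- The computation modulo `reg 2`. -/
def tryPrime (isVec : Bool) : Cmd :=
  .seq primeTest (.ite (.reg 3) (.seq reduce (.seq (greedy isVec) (update isVec))) .skip)

/-- All primes below `reg 1` are tried. -/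
def tryPrimes (isVec : Bool) : Cmd :=
  .seq (.assign 18 (.reg 1)) (.for_ 2 1 (tryPrime isVec))

/-- Every assigned or stored expression is a residue, a comparison, a small literal, a register or a
cell of a work array; raw input entries are always reduced first. -/
theorem tryPrimes_safe (isVec : Bool) : (tryPrimes isVec).Safe := by
  simp only [tryPrimes, tryPrime, primeTest, mulDenominators, reduce, writeOutput, update, greedy,
    greedyRound, search, record, setCandidate, rank, advance, loadColumn, setIdentity, addToKernel,
    eliminate, findPivot, copy, matvec, dot, Cmd.Safe]
  and_intros <;> first
    | trivial
    | with_reducible exact Expr.safe_modz _ _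
    | with_reducible exact Expr.safe_reg _
    | with_reducible exact Expr.safe_lit_zero
    | with_reducible exact Expr.safe_lit_one
    | with_reducible exact Expr.safe_lt _ _
    | with_reducible exact Expr.safe_eq _ _
    | with_reducible exact Expr.safe_arr (by norm_num) _ _

theorem tryPrimes_wf (isVec : Bool) : (tryPrimes isVec).wf = true := by
  cases isVec <;> decide

section Main

variable {n N p : ℕ}

theorem primeTest_run {s : State} (h : s.reg 2 = p) :
    (primeTest.run s).reg 3 ≠ 0 ↔ p.Prime := by
  set s₀ := s.setReg 3 (Op.eval .lt 1 (s.reg 2)) with hs₀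
  have h2 : s₀.reg 2 = p := h
  obtain ⟨s', hs', hI, -⟩ := Cmd.run_for (i := 4)
    (P := .ite (.op .mul (.op .lt (.lit 1) (.reg 4))
      (.op .eq (Expr.modz (.reg 2) (.reg 4)) (.lit 0))) (.assign 3 (.lit 0)) .skip) h2
    (fun k s' => s'.reg 3 ≠ 0 ↔ 2 ≤ p ∧ ∀ d, 2 ≤ d → d < k → ¬ d ∣ p)
    (by
      rw [hs₀, State.setReg_reg_self, Op.eval_lt_ne_zero, h]
      constructor
      · intro h1; exact ⟨by omega, fun d _ hd => by omega⟩
      · intro h1; have := h1.1; omega)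
    (by
      intro k hk s' hsame hI
      have h2' : (s'.setReg 4 k).reg 2 = p := ((hsame.setReg k).reg 2 rfl).trans h2
      have hcond : (Expr.op .mul (.op .lt (.lit 1) (.reg 4))
          (.op .eq (Expr.modz (.reg 2) (.reg 4)) (.lit 0))).eval (s'.setReg 4 k) ≠ 0 ↔
          2 ≤ k ∧ k ∣ p := by
        have he : ∀ e f : Expr, ∀ t, (Expr.op .mul e f).eval t = e.eval t * f.eval t :=
          fun _ _ _ => rfl
        rw [he, mul_ne_zero_iff]
        have h1 : (Expr.op .lt (.lit 1) (.reg 4)).eval (s'.setReg 4 k) ≠ 0 ↔ 2 ≤ k := by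
          simp only [Expr.eval]
          rw [Op.eval_lt_ne_zero, State.setReg_reg_self]; omega
        rw [h1]
        refine and_congr_right fun hk2 => ?_
        have h4 : (Expr.reg 4).eval (s'.setReg 4 k) = k := State.setReg_reg_self _ _ _
        have h3 : (Expr.op .eq (Expr.modz (.reg 2) (.reg 4)) (.lit 0)).eval (s'.setReg 4 k) =
          Op.eval .eq ((Expr.modz (.reg 2) (.reg 4)).eval (s'.setReg 4 k)) 0 := rfl
        rw [h3, Op.eval_eq_ne_zero, Expr.eval_modz (by rw [h4]; omega), h4]
        simp only [Expr.eval]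
        rw [h2', ← Int.dvd_iff_emod_eq_zero, Int.natCast_dvd_natCast]
      rw [Cmd.run]
      by_cases hd : 2 ≤ k ∧ k ∣ p
      · rw [if_pos (hcond.2 hd)]
        simp only [Cmd.run, Expr.eval, State.setReg_reg_self, ne_eq, not_true_eq_false, false_iff,
          not_and, not_forall]
        exact fun _ => ⟨k, hd.1, by omega, not_not.2 hd.2⟩
      · rw [if_neg (fun h => hd (hcond.1 h)), Cmd.run,
          State.setReg_reg_of_ne _ _ _ _ (by norm_num), hI]
        refine and_congr_right fun _ => ⟨fun h d hd2 hdk => ?_, fun h d hd2 hdk => h d hd2 (by omega)⟩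
        rcases Nat.lt_succ_iff_lt_or_eq.1 hdk with hdk | rfl
        · exact h d hd2 hdk
        · exact fun hdp => hd ⟨hd2, hdp⟩)
  have hrun : primeTest.run s = s'.setReg 4 p := hs'
  rw [hrun, State.setReg_reg_of_ne _ _ _ _ (by norm_num), hI, Nat.prime_def_lt']

/-- The matrix with numerators `a` and denominators `d`, multiplied by all denominators. -/
def clearDenominators (a d : Fin n → Fin n → ℤ) : Matrix (Fin n) (Fin n) ℤ :=
  Matrix.of fun i j => a i j * ∏ k, ∏ l, if k = i ∧ l = j then 1 else d k l

theorem mulDenominators_run {s : State} (h : Context n N p s) (i j : Fin n)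
    (hi : s.reg 5 = i) (hj : s.reg 6 = j) :
    ((mulDenominators.run s).reg 9 : ZMod p) = (s.reg 9 : ZMod p) *
      ∏ k : Fin n, ∏ l : Fin n, if k = i ∧ l = j then 1 else (s.arr 1 k l : ZMod p) := by
  set g : ℕ → ℕ → ZMod p := fun k l =>
    if k = i ∧ l = j then 1 else (s.arr 1 k l : ZMod p) with hg
  obtain ⟨s', hs', hI, -⟩ := Cmd.run_for (i := 7)
    (P := .for_ 8 0 (.ite (.op .mul (.op .eq (.reg 7) (.reg 5)) (.op .eq (.reg 8) (.reg 6)))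
      .skip (.assign 9 (Expr.modz (.op .mul (.reg 9) (.arr 1 (.reg 7) (.reg 8))) (.reg 2))))) h.dim
    (fun k s' => (s'.reg 9 : ZMod p) =
      (s.reg 9 : ZMod p) * ∏ k' ∈ Finset.range k, ∏ l' ∈ Finset.range n, g k' l')
    (by simp)
    (by
      intro k hk s' hsame hI
      have hsame' := hsame.setReg k
      have hc' : Context n N p (s'.setReg 7 k) := h.same hsame' rfl rfl rfl
      obtain ⟨s₁, hs₁, hI₁, -⟩ := Cmd.run_for (i := 8)
        (P := .ite (.op .mul (.op .eq (.reg 7) (.reg 5)) (.op .eq (.reg 8) (.reg 6)))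
          .skip (.assign 9 (Expr.modz (.op .mul (.reg 9) (.arr 1 (.reg 7) (.reg 8))) (.reg 2))))
        hc'.dim
        (fun m s'' => (s''.reg 9 : ZMod p) =
          (s'.reg 9 : ZMod p) * ∏ l' ∈ Finset.range m, g k l')
        (by simp)
        (by
          intro m hm s'' hsame'' hI'
          have hs''' := hsame'.trans_body (hsame''.setReg m)
          set s₂ := s''.setReg 8 m with hs₂
          have hc₂ : Context n N p s₂ := h.same hs''' rfl rfl rfl
          have h5 : s₂.reg 5 = i := (hs'''.reg 5 rfl).trans hi
          have h6 : s₂.reg 6 = j := (hs'''.reg 6 rfl).trans hj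
          have h7 : s₂.reg 7 = (k : ℤ) :=
            ((hsame''.setReg m).reg 7 rfl).trans (State.setReg_reg_self _ _ _)
          have h8 : s₂.reg 8 = (m : ℤ) := State.setReg_reg_self _ _ _
          have h9 : s₂.reg 9 = s''.reg 9 := State.setReg_reg_of_ne _ _ _ _ (by norm_num)
          have h1 : s₂.arr 1 = s.arr 1 := hs'''.arr 1 rfl
          have hcond : (Expr.op .mul (.op .eq (.reg 7) (.reg 5))
              (.op .eq (.reg 8) (.reg 6))).eval s₂ ≠ 0 ↔ k = (i : ℕ) ∧ m = (j : ℕ) := by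
            have he : ∀ e f : Expr, ∀ t, (Expr.op .mul e f).eval t = e.eval t * f.eval t :=
              fun _ _ _ => rfl
            rw [he, mul_ne_zero_iff]
            simp only [Expr.eval]
            rw [Op.eval_eq_ne_zero, Op.eval_eq_ne_zero, h5, h6, h7, h8]
            simp
          rw [Cmd.run, Finset.prod_range_succ, ← mul_assoc, ← hI']
          by_cases hkm : k = (i : ℕ) ∧ m = (j : ℕ)
          · rw [if_pos (hcond.2 hkm), Cmd.run, h9, hg]
            simp only [if_pos hkm, mul_one]
          · rw [if_neg (fun h => hkm (hcond.1 h)), Cmd.run, State.setReg_reg_self, hc₂.cast_modz, hg]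
            simp only [if_neg hkm, Expr.eval, Op.eval, h7, h8, h9, h1]
            push_cast; ring)
      rw [hs₁, State.setReg_reg_of_ne _ _ _ _ (by norm_num), hI₁, hI, Finset.prod_range_succ]
      ring)
  have hrun : mulDenominators.run s = s'.setReg 7 n := hs'
  rw [hrun, State.setReg_reg_of_ne _ _ _ _ (by norm_num), hI, Finset.prod_range]
  congr 1
  refine Finset.prod_congr rfl fun k _ => ?_
  rw [Finset.prod_range]
  refine Finset.prod_congr rfl fun l _ => ?_
  simp [hg, Fin.ext_iff]

theorem reduce_run {s : State} (h : Context n N p s) :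
    mat n p (reduce.run s) 3 = (clearDenominators (fun i j : Fin n => s.arr 0 i j)
      (fun i j : Fin n => s.arr 1 i j)).map (Int.cast : ℤ → ZMod p) := by
  ext x y
  refine Cmd.run_fill₂ h.dim (a := 3) (by norm_num) rfl
    (fun x y v => (v : ZMod p) = (clearDenominators (fun i j : Fin n => s.arr 0 i j)
      (fun i j : Fin n => s.arr 1 i j)).map (Int.cast : ℤ → ZMod p) x y) ?_ rfl x y
  intro x y s' hsame hx hy
  have hc : Context n N p s' := h.same hsame rfl rfl rfl
  set s₁ := s'.setReg 9 ((Expr.modz (.arr 0 (.reg 5) (.reg 6)) (.reg 2)).eval s') with hs₁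
  have hc₁ : Context n N p s₁ := hc.setReg (by norm_num) _
  set s₂ := mulDenominators.run s₁ with hs₂
  have h5₁ : s₁.reg 5 = x := hx
  have h6₁ : s₁.reg 6 = y := hy
  have h5 : s₂.reg 5 = x := (Cmd.run_reg (P := mulDenominators) rfl s₁).trans h5₁
  have h6 : s₂.reg 6 = y := (Cmd.run_reg (P := mulDenominators) rfl s₁).trans h6₁
  have hm := mulDenominators_run hc₁ x y h5₁ h6₁
  rw [← hs₂, hs₁, State.setReg_reg_self, hc.cast_modz] at hm
  have h3 : s₂.arr 3 = s'.arr 3 := Cmd.run_arr (P := mulDenominators) rfl s₁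
  have hrun : (Cmd.seq (.assign 9 (Expr.modz (.arr 0 (.reg 5) (.reg 6)) (.reg 2)))
      (.seq mulDenominators (.store 3 (.reg 5) (.reg 6) (.reg 9)))).run s' =
      s₂.setArr 3 x y (s₂.reg 9) := by
    rw [← h5, ← h6]; rfl
  rw [hrun]
  obtain ⟨f1, f2⟩ := setArr_fill₂ s₂ 3 x y (s₂.reg 9)
  refine ⟨?_, fun x' y' hne => by rw [f2 x' y' hne, h3]⟩
  have h0 : s'.arr 0 = s.arr 0 := hsame.arr 0 rfl
  have h1 : s'.arr 1 = s.arr 1 := hsame.arr 1 rfl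
  rw [f1, hm]
  simp only [Expr.eval, hx, hy, h0, State.setReg_arr, h1, clearDenominators, map_apply, of_apply]
  push_cast
  congr 1

theorem writeOutput_run (isVec : Bool) {s : State} (h : Context n N p s) (x y : Fin n) :
    ((writeOutput isVec).run s).arr 2 x y = inject isVec (fun i : Fin n => s.arr 4 i 0 % (p : ℤ)) x y := by
  refine Cmd.run_fill₂ h.dim (a := 2) (by norm_num) rfl
    (fun x y v => v = inject isVec (fun i : Fin n => s.arr 4 i 0 % (p : ℤ)) x y) ?_ rfl x y
  intro x y s' hsame hx hy
  have hc : Context n N p s' := h.same hsame rfl rfl rfl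
  have h4 : s'.arr 4 = s.arr 4 := hsame.arr 4 rfl
  have h1 := setArr_fill₂ s' 2 x y ((Expr.modz (.op .mul (.arr 4 (.reg 24) (.lit 0))
    (injectFactor isVec 24 25)) (.reg 2)).eval s')
  rw [Cmd.run]
  have he : (Expr.reg 24).eval s' = x := hx
  have he' : (Expr.reg 25).eval s' = y := hy
  rw [he, he']
  refine ⟨?_, h1.2⟩
  have h2 : (Expr.reg 2).eval s' = p := hc.modulus
  rw [h1.1, Expr.eval_modz (by rw [h2]; exact_mod_cast h.pos), h2, Expr.eval,
    eval_injectFactor isVec hx hy]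
  simp only [Expr.eval, Op.eval, hx, h4, inject, of_apply]
  split_ifs <;> simp

/-- The result of the trials with moduli less than `k`. -/
def Result (isVec : Bool) (A : Matrix (Fin n) (Fin n) ℤ) (N k : ℕ) (s : State) : Prop :=
  ∃ best : ℕ, s.reg 18 = best ∧
    (best = N ∨ ∃ b : Fin n → ℤ, (∀ i j : Fin n, s.arr 2 i j = inject isVec b i j) ∧
      Kry (A.map (Int.cast : ℤ → ℝ)) (inject isVec fun i => (b i : ℝ)) = ⊤ ∧
      hammingNorm b ≤ best) ∧
    ∀ p < k, p.Prime → n < p → ∀ m k' : ℕ, n * (m - 1) ^ k' < m ^ k' →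
      (∀ [Fact p.Prime], ∃ c : Fin n → ZMod p, hammingNorm c ≤ m ∧
        Kry (A.map (Int.cast : ℤ → ZMod p)) (inject isVec c) = ⊤) → best ≤ k' ∧ best ≤ n

/-- Correctness of the stored vector needs no assumption on the prime, since full rank modulo `p`
lifts to the reals. The quality bound comes only from primes `p > n` modulo which a sparse solution
exists, and later updates only improve it. -/
theorem tryPrime_run (isVec : Bool) {s : State} {A : Matrix (Fin n) (Fin n) ℤ}
    (hA : A = clearDenominators (fun i j : Fin n => s.arr 0 i j) (fun i j : Fin n => s.arr 1 i j))
    (h0 : s.reg 0 = n) (h1 : s.reg 1 = N) (h2 : s.reg 2 = p) (hN : n + 1 < N)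
    (h : Result isVec A N p s) : Result isVec A N (p + 1) ((tryPrime isVec).run s) := by
  obtain ⟨best, hb, hcur, hopt⟩ := h
  set s₁ := primeTest.run s with hs₁
  have hreg : ∀ r, primeTest.modReg r = false → s₁.reg r = s.reg r := fun r hr => Cmd.run_reg hr s
  have harr : s₁.arr = s.arr := by funext a; exact Cmd.run_arr (P := primeTest) rfl s
  rw [tryPrime, Cmd.run, ← hs₁, Cmd.run]
  have hprime : (Expr.reg 3).eval s₁ ≠ 0 ↔ p.Prime := primeTest_run h2
  by_cases hp : p.Prime
  swap
  · rw [if_neg (fun h => hp (hprime.1 h)), Cmd.run]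
    refine ⟨best, (hreg 18 rfl).trans hb, by rw [harr]; exact hcur, fun q hq hqp => ?_⟩
    rcases Nat.lt_succ_iff_lt_or_eq.1 hq with hq | rfl
    · exact hopt q hq hqp
    · exact absurd hqp hp
  rw [if_pos (hprime.2 hp)]
  have _ : Fact p.Prime := ⟨hp⟩
  have hc₁ : Context n N p s₁ :=
    ⟨(hreg 0 rfl).trans h0, (hreg 1 rfl).trans h1, (hreg 2 rfl).trans h2, by omega, hp.ne_zero⟩
  set s₂ := reduce.run s₁ with hs₂
  have hc₂ : Context n N p s₂ := hc₁.run rfl rfl rfl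
  have hmat : mat n p s₂ 3 = A.map (Int.cast : ℤ → ZMod p) := by
    rw [hs₂, reduce_run hc₁, hA, harr]
  set s₃ := (greedy isVec).run s₂ with hs₃
  have hc₃ : Context n N p s₃ := hc₂.run rfl rfl rfl
  obtain ⟨c, h17, h16, hham, hcn, hgood⟩ := greedy_run isVec hc₂ hN
  rw [← hs₃, hmat] at h16
  rw [← hs₃] at h17 hham hgood
  rw [hmat] at hgood
  have h18 : s₃.reg 18 = best := by
    rw [hs₃, Cmd.run_reg (P := greedy isVec) rfl, hs₂, Cmd.run_reg (P := reduce) rfl,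
      hreg 18 rfl, hb]
  have h2₃ : s₃.arr 2 = s.arr 2 := by
    rw [hs₃, Cmd.run_arr (P := greedy isVec) rfl, hs₂, Cmd.run_arr (P := reduce) rfl, harr]
  have hrun : (Cmd.seq reduce (.seq (greedy isVec) (update isVec))).run s₁ =
    (update isVec).run s₃ := rfl
  have hcond : (Expr.op .mul (.op .eq (.reg 16) (.reg 0)) (.op .lt (.reg 17) (.reg 18))).eval s₃
      ≠ 0 ↔ s₃.reg 16 = n ∧ c < best := by
    have he : ∀ e f : Expr, ∀ t, (Expr.op .mul e f).eval t = e.eval t * f.eval t :=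
      fun _ _ _ => rfl
    rw [he, mul_ne_zero_iff]
    simp only [Expr.eval]
    rw [Op.eval_eq_ne_zero, Op.eval_lt_ne_zero, hc₃.dim, h17, h18]
    simp
  rw [hrun, update, Cmd.run]
  by_cases hup : s₃.reg 16 = n ∧ c < best
  · rw [if_pos (hcond.2 hup), Cmd.run, Cmd.run]
    set s₄ := s₃.setReg 18 ((Expr.reg 17).eval s₃) with hs₄
    have hc₄ : Context n N p s₄ := hc₃.setReg (by norm_num) _
    refine ⟨c, ?_, Or.inr ⟨fun i => s₃.arr 4 i 0 % (p : ℤ), ?_, ?_, ?_⟩, ?_⟩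
    · rw [Cmd.run_reg (P := writeOutput isVec) rfl, hs₄, State.setReg_reg_self]
      exact h17
    · exact fun i j => writeOutput_run isVec hc₄ i j
    · have hk : krank isVec (A.map (Int.cast : ℤ → ZMod p)) (vec n p s₃ 4) = n := by
        have := h16.symm.trans hup.1
        exact_mod_cast this
      rw [krank_eq_iff] at hk
      have hz := Kry_real_eq_top_of_zmod (p := p) A
        (inject isVec fun i : Fin n => s₃.arr 4 i 0 % (p : ℤ)) (by
          rw [inject_map isVec _ _ Int.cast_zero]
          have hv : ((Int.cast : ℤ → ZMod p) ∘ fun i : Fin n => s₃.arr 4 i 0 % (p : ℤ)) =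
              vec n p s₃ 4 := by
            funext i; simp [vec]
          rw [hv]; exact hk)
      rw [inject_map isVec _ _ Int.cast_zero] at hz
      exact hz
    · refine le_trans (hammingNorm_le_of_forall fun i hi => ?_) hham
      have hi' : s₃.arr 4 i 0 = 0 := hi
      rw [hi', Int.zero_emod]
    · intro q hq hqp hnq m k' hk' hex
      rcases Nat.lt_succ_iff_lt_or_eq.1 hq with hq | rfl
      · have := hopt q hq hqp hnq m k' hk' hex
        have := hup.2
        omega
      · exact ⟨(hgood m k' hnq hk' hex).2, hcn⟩
  · rw [if_neg (fun h => hup (hcond.1 h)), Cmd.run]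
    refine ⟨best, h18, by rw [h2₃]; exact hcur, ?_⟩
    intro q hq hqp hnq m k' hk' hex
    rcases Nat.lt_succ_iff_lt_or_eq.1 hq with hq | rfl
    · exact hopt q hq hqp hnq m k' hk' hex
    · obtain ⟨g1, g2⟩ := hgood m k' hnq hk' hex
      -- At a good prime the greedy algorithm reaches full rank, so a missing update means that the
      -- stored value was at least as good.
      have : ¬ c < best := fun h => hup ⟨g1, h⟩
      omega

/-- The initial value `N` of `reg 18` stands for the absence of a solution; it exceeds every
possible count. -/
theorem tryPrimes_run (isVec : Bool) {s : State} {A : Matrix (Fin n) (Fin n) ℤ}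
    (hA : A = clearDenominators (fun i j : Fin n => s.arr 0 i j) (fun i j : Fin n => s.arr 1 i j))
    (h0 : s.reg 0 = n) (h1 : s.reg 1 = N) (hN : n + 1 < N) :
    Result isVec A N N ((tryPrimes isVec).run s) := by
  set s₁ := s.setReg 18 N with hs₁
  obtain ⟨s', hs', hI, -⟩ := Cmd.run_for (i := 2) (j := 1) (P := tryPrime isVec) (s := s₁)
    (by rw [hs₁]; exact h1) (fun k s' => Result isVec A N k s')
    ⟨N, by rw [hs₁, State.setReg_reg_self], Or.inl rfl, fun p hp => by omega⟩
    (by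
      intro k hk s' hsame hI
      have hsame' := hsame.setReg k
      have ha0 : (s'.setReg 2 k).arr 0 = s.arr 0 := hsame'.arr 0 rfl
      have ha1 : (s'.setReg 2 k).arr 1 = s.arr 1 := hsame'.arr 1 rfl
      refine tryPrime_run isVec (by rw [hA, ha0, ha1]) ((hsame'.reg 0 rfl).trans h0)
        ((hsame'.reg 1 rfl).trans h1) (State.setReg_reg_self _ _ _) hN ?_
      obtain ⟨best, hb, hcur, hopt⟩ := hI
      exact ⟨best, (State.setReg_reg_of_ne _ _ _ _ (by norm_num)).trans hb, hcur, hopt⟩)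
  have hrun : (tryPrimes isVec).run s = s'.setReg 2 N := by
    rw [← hs', hs₁, ← h1]; rfl
  rw [hrun]
  obtain ⟨best, hb, hcur, hopt⟩ := hI
  exact ⟨best, (State.setReg_reg_of_ne _ _ _ _ (by norm_num)).trans hb, hcur, hopt⟩

end Main

end RAM

namespace RAM

/-! ### The bound for the primes -/

/-- The bit lengths of the squares of the entries of the arrays `0` and `1` at the current position
are added to `reg 27`. -/
def addSizes : Cmd :=
  .seq (.assign 28 (.arr 0 (.reg 29) (.reg 30))) (.seq (.addSize 27 28)
    (.seq (.assign 28 (.arr 1 (.reg 29) (.reg 30))) (.addSize 27 28)))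

/-- Register `27` is set to a measure of the size of the input. -/
def inputSize : Cmd := .seq (.assign 27 (.reg 0)) (.for_ 29 0 (.for_ 30 0 addSizes))

/-- An expression for the bound for the primes in terms of `reg 27`. -/
def primeBoundExpr : Expr :=
  let u : Expr := .op .add (.reg 27) (.lit 2)
  let v : Expr := .op .add (.op .mul u (.op .mul u u)) (.lit 1)
  .op .add (.op .mul (.lit 16) (.op .mul v v)) (.lit 1)

/-- Register `1` is set to a bound for the primes that have to be tried. -/
def setPrimeBound : Cmd := .seq inputSize (.assign 1 primeBoundExpr)

/-- The whole program. -/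
def controlProgram (isVec : Bool) : Cmd := .seq setPrimeBound (tryPrimes isVec)

theorem controlProgram_wf (isVec : Bool) : (controlProgram isVec).wf = true := by
  have h := tryPrimes_wf isVec
  rw [controlProgram, Cmd.wf, h]; rfl

theorem eval_primeBoundExpr {s : State} {w : ℕ} (h : s.reg 27 = w) :
    primeBoundExpr.eval s = (primeBound w : ℕ) := by
  simp only [primeBoundExpr, Expr.eval, Op.eval, h, primeBound]
  push_cast; ring

/-- The loop rule with costs, for the measurement of the input: it is not `Safe`, as its accumulator
grows and a register temporarily holds raw entries. -/
theorem Cmd.run_for_cost {i j : ℕ} {P : Cmd} {s : State} {N : ℕ} (hN : s.reg j = N) {c : ℕ}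
    (I : ℕ → State → Prop) (h0 : I 0 s)
    (hstep : ∀ k < N, ∀ s', Same (.for_ i j P) s s' → I k s' →
      I (k + 1) (P.run (s'.setReg i k)) ∧ P.cost (s'.setReg i k) ≤ c) :
    ∃ s', (Cmd.for_ i j P).run s = s'.setReg i N ∧ I N s' ∧ Same (.for_ i j P) s s' ∧
      (Cmd.for_ i j P).cost s ≤ N * (c + (11 * N + 21)) + (4 * N + 8) := by
  have hsame : ∀ k, Same (.for_ i j P) s (forRun i P.run k s) := fun k =>
    { reg := fun r hr => by
        simp only [Cmd.modReg, Bool.or_eq_false_iff, beq_eq_false_iff_ne] at hr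
        exact forRun_reg_of_unchanged (Cmd.run_reg hr.2) (Ne.symm hr.1) k s
      arr := fun a ha => forRun_arr_of_unchanged (Cmd.run_arr (P := P) ha) k s }
  have hlen : ∀ k : ℕ, len (k : ℤ) ≤ k + 1 := fun k => by simpa using len_le_natAbs k
  have key : ∀ k ≤ N, I k (forRun i P.run k s) ∧
      forCost i P.run P.cost N k s ≤ k * (c + (11 * N + 21)) := by
    intro k
    induction k with
    | zero => exact fun _ => ⟨h0, by simp [forCost]⟩
    | succ k ih =>
      intro hk
      have ih' := ih (by omega)
      have h1 := hstep k (by omega) _ (hsame k) ih'.1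
      refine ⟨h1.1, ?_⟩
      have e1 := hlen k
      have e2 := hlen (k + 1)
      have e3 := hlen N
      have e4 : len 1 ≤ 2 := len_le_natAbs 1
      have h3 : loopCost k N ≤ 11 * N + 21 := by
        push_cast at e2
        rw [loopCost]; omega
      rw [forCost, Nat.succ_mul]
      have := ih'.2
      have := h1.2
      omega
  refine ⟨forRun i P.run N s, by rw [Cmd.run, hN, Int.toNat_natCast], (key N le_rfl).1, hsame N, ?_⟩
  have h1 := (key N le_rfl).2
  have h2 := hlen N
  have h3 : len 0 ≤ 1 := len_le_natAbs 0
  rw [Cmd.cost, hN, Int.toNat_natCast]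
  omega

theorem sizeCost_le {W M : ℕ} (k : ℕ) : ∀ w x : ℤ, 0 ≤ w → w + k ≤ W → len x ≤ M →
    sizeCost k w x ≤ (k + 1) * (6 * M + 3 * W + 20) := by
  induction k with
  | zero => intro w x _ _ hx; rw [sizeCost]; omega
  | succ k ih =>
    intro w x h0 hw hx
    have hx2 : len (x / 2) ≤ M := (len_mono (natAbs_div_le x 2)).trans hx
    have h1 := ih (w + 1) (x / 2) (by omega) (by push_cast at hw; omega) hx2
    have e1 : len 2 = 3 := by decide
    have e2 : len 1 = 2 := by decide
    have e3 := len_le_natAbs w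
    have e4 := len_le_natAbs (w + 1)
    have h2 : sizeStepCost w x ≤ 6 * M + 3 * W + 20 := by
      rw [sizeStepCost, e1, e2]; push_cast at hw; omega
    rw [sizeCost, Nat.succ_mul]
    omega

/-- The amount by which `addSize` increases its target. -/
def sqSize (z : ℤ) : ℕ := Nat.size (z * z).toNat

theorem toNat_mul_self (z : ℤ) : (z * z).toNat = z.natAbs * z.natAbs := by
  rw [← Int.natAbs_mul_self' z]; norm_cast

theorem sqSize_le (z : ℤ) : sqSize z ≤ 2 * len z := by
  rw [sqSize, toNat_mul_self, Nat.size_le, len]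
  have := Nat.lt_size_self z.natAbs
  calc _ < 2 ^ z.natAbs.size * 2 ^ z.natAbs.size := Nat.mul_lt_mul'' this this
    _ = 2 ^ (z.natAbs.size + z.natAbs.size) := (pow_add _ _ _).symm
    _ ≤ _ := Nat.pow_le_pow_right two_pos (by omega)

theorem natAbs_le_two_pow_sqSize (z : ℤ) : z.natAbs ≤ 2 ^ sqSize z := by
  rw [sqSize, toNat_mul_self]
  exact (Nat.le_mul_self _).trans (Nat.lt_size_self _).le

theorem Cmd.cost_addSize_le {w x : ℕ} {s : State} {D : ℕ} (h0 : 0 ≤ s.reg w)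
    (hw : s.reg w + sqSize (s.reg x) ≤ D) (hx : len (s.reg x) ≤ D) :
    (Cmd.addSize w x).cost s ≤ 2 * D + D * D + 2 * D + (2 * D + 1) * (15 * D + 20) := by
  have h1 : len (s.reg x * s.reg x) ≤ 2 * D := (len_mul_le _ _).trans (by omega)
  have h2 := sizeCost_le (W := D) (M := 2 * D) (sqSize (s.reg x)) (s.reg w) _ h0 hw h1
  have h3 : sqSize (s.reg x) ≤ 2 * D := (sqSize_le _).trans (by omega)
  have h4 : (sqSize (s.reg x) + 1) * (6 * (2 * D) + 3 * D + 20) ≤ (2 * D + 1) * (15 * D + 20) :=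
    Nat.mul_le_mul (by omega) (by omega)
  have h5 : len (s.reg x) * len (s.reg x) ≤ D * D := Nat.mul_le_mul hx hx
  rw [Cmd.cost]
  rw [sqSize] at h2 h4
  omega

/-- The contribution of a position to the size of the input. -/
def entrySize (s : State) (x y : ℤ) : ℕ := sqSize (s.arr 0 x y) + sqSize (s.arr 1 x y)

theorem addSizes_run (s : State) : (addSizes.run s).reg 28 = 0 ∧
    (addSizes.run s).reg 27 = s.reg 27 + entrySize s (s.reg 29) (s.reg 30) := by
  simp [addSizes, Cmd.run, Expr.eval, entrySize, sqSize, add_assoc]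

theorem addSizes_cost {s : State} {D : ℕ} (h0 : 0 ≤ s.reg 27)
    (hw : s.reg 27 + entrySize s (s.reg 29) (s.reg 30) ≤ D) (hb : Bdd D s) :
    addSizes.cost s ≤ 2 * (8 * D + 8 + (2 * D + D * D + 2 * D + (2 * D + 1) * (15 * D + 20))) := by
  set a := s.arr 0 (s.reg 29) (s.reg 30) with ha
  set b := s.arr 1 (s.reg 29) (s.reg 30) with hb'
  have hla : len a ≤ D := hb.arr_len 0 (by norm_num) _ _
  have hlb : len b ≤ D := hb.arr_len 1 (by norm_num) _ _
  have h29 := len_le_of_abs_le (hb.reg 29)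
  have h30 := len_le_of_abs_le (hb.reg 30)
  have hsz : entrySize s (s.reg 29) (s.reg 30) = sqSize a + sqSize b := rfl
  rw [hsz] at hw
  push_cast at hw
  set s₁ := s.setReg 28 a with hs₁
  set s₂ := (Cmd.addSize 27 28).run s₁ with hs₂
  set s₃ := s₂.setReg 28 b with hs₃
  have h1 := Cmd.cost_addSize_le (w := 27) (x := 28) (s := s₁) (D := D) (by simpa [hs₁])
    (by simp [hs₁]; omega) (by simpa [hs₁])
  have h27 : s₃.reg 27 = s.reg 27 + sqSize a := by
    simp [hs₃, hs₂, hs₁, Cmd.run, sqSize]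
  have h2 := Cmd.cost_addSize_le (w := 27) (x := 28) (s := s₃) (D := D) (by omega)
    (by rw [h27]; simp [hs₃]; omega) (by simpa [hs₃])
  have hc : addSizes.cost s = (len (s.reg 29) + len (s.reg 30) +
      (len (s.reg 29) + len (s.reg 30) + len a) + len a) + ((Cmd.addSize 27 28).cost s₁ +
      ((len (s.reg 29) + len (s.reg 30) +
      (len (s.reg 29) + len (s.reg 30) + len b) + len b) + (Cmd.addSize 27 28).cost s₃)) := rfl
  rw [hc]
  omega

/-- A bound for the running time of `inputSize`. -/
noncomputable def inputSizePoly : Polynomial ℕ :=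
  let X := Polynomial.X
  let c₀ := 2 * (8 * X + 8 + (2 * X + X * X + 2 * X + (2 * X + 1) * (15 * X + 20)))
  let c₁ := X * (c₀ + (11 * X + 21)) + (4 * X + 8)
  2 * X + 2 + (X * (c₁ + (11 * X + 21)) + (4 * X + 8))

theorem inputSize_run {n D : ℕ} {s : State} (h0 : s.reg 0 = n) (hb : Bdd D s)
    (h28 : s.reg 28 = 0)
    (hD : n + ∑ x ∈ Finset.range n, ∑ y ∈ Finset.range n, entrySize s x y ≤ D) :
    (inputSize.run s).reg 27 =
      (n + ∑ x ∈ Finset.range n, ∑ y ∈ Finset.range n, entrySize s x y : ℕ) ∧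
    Bdd D (inputSize.run s) ∧ inputSize.cost s ≤ inputSizePoly.eval D := by
  have hnD : n ≤ D := by omega
  set s₀ := s.setReg 27 (s.reg 0) with hs₀
  have h00 : s₀.reg 0 = n := h0
  have hnD' : |(n : ℤ)| ≤ D := by rw [abs_of_nonneg (by positivity)]; exact_mod_cast hnD
  have hb₀ : Bdd D s₀ := hb.setReg _ (hb.reg 0)
  set c₀ := 2 * (8 * D + 8 + (2 * D + D * D + 2 * D + (2 * D + 1) * (15 * D + 20))) with hc₀
  set c₁ := n * (c₀ + (11 * n + 21)) + (4 * n + 8) with hc₁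
  set f : ℕ → ℕ → ℕ := fun x y => entrySize s x y with hf
  replace hD : n + ∑ x ∈ Finset.range n, ∑ y ∈ Finset.range n, f x y ≤ D := hD
  -- Every intermediate value of the accumulator is at most its final value, hence at most `D`.
  have hpart : ∀ k < n, ∀ m < n, n + ∑ x ∈ Finset.range k, ∑ y ∈ Finset.range n, f x y +
      ∑ y ∈ Finset.range (m + 1), f k y ≤ D := by
    intro k hk m hm
    have e1 : ∑ y ∈ Finset.range (m + 1), f k y ≤ ∑ y ∈ Finset.range n, f k y :=
      Finset.sum_le_sum_of_subset (Finset.range_subset_range.2 hm)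
    have e2 : ∑ x ∈ Finset.range (k + 1), ∑ y ∈ Finset.range n, f x y ≤
        ∑ x ∈ Finset.range n, ∑ y ∈ Finset.range n, f x y :=
      Finset.sum_le_sum_of_subset (Finset.range_subset_range.2 hk)
    rw [Finset.sum_range_succ] at e2
    omega
  obtain ⟨s', hs', hI, hsame, hcost⟩ := Cmd.run_for_cost (i := 29) (P := .for_ 30 0 addSizes)
    (c := c₁) h00
    (fun k s' => s'.reg 27 = (n + ∑ x ∈ Finset.range k, ∑ y ∈ Finset.range n, f x y : ℕ) ∧
      Bdd D s' ∧ s'.reg 28 = 0)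
    ⟨by simp [hs₀, h0], hb₀, by simpa [hs₀] using h28⟩
    (by
      rintro k hk s' hsame ⟨h27', hb', h28'⟩
      have hkD : |(k : ℤ)| ≤ D := by rw [abs_of_nonneg (by positivity)]; norm_cast; omega
      set s₁ := s'.setReg 29 k with hs₁
      have hb₁ : Bdd D s₁ := hb'.setReg 29 hkD
      have h0' : s₁.reg 0 = n := ((hsame.setReg k).reg 0 rfl).trans h00
      obtain ⟨s'', hs'', hI', hsame', hcost'⟩ := Cmd.run_for_cost (i := 30) (P := addSizes)
        (c := c₀) h0'
        (fun m s'' => s''.reg 27 = (n + ∑ x ∈ Finset.range k, ∑ y ∈ Finset.range n, f x y +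
          ∑ y ∈ Finset.range m, f k y : ℕ) ∧ Bdd D s'' ∧ s''.reg 28 = 0)
        ⟨by simpa [hs₁] using h27', hb₁, h28'⟩
        (by
          rintro m hm t hsame'' ⟨h27, hbt, h28t⟩
          have hmD : |(m : ℤ)| ≤ D := by rw [abs_of_nonneg (by positivity)]; norm_cast; omega
          set u := t.setReg 30 m with hu
          have hbu : Bdd D u := hbt.setReg 30 hmD
          have hsu := hsame''.setReg m
          have ha : ∀ a < 2, u.arr a = s.arr a := fun a ha => by
            have e1 := hsu.arr a (by interval_cases a <;> rfl)
            have e2 := (hsame.setReg k).arr a (by interval_cases a <;> rfl)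
            exact e1.trans e2
          have h29 : u.reg 29 = k := (hsu.reg 29 rfl).trans (State.setReg_reg_self _ _ _)
          have h30 : u.reg 30 = m := State.setReg_reg_self _ _ _
          have h27u : u.reg 27 = _ := h27
          have hes : entrySize u (u.reg 29) (u.reg 30) = f k m := by
            rw [h29, h30, hf]
            simp only [entrySize, ha 0 (by norm_num), ha 1 (by norm_num)]
          have hr := addSizes_run u
          have hp := hpart k hk m hm
          rw [Finset.sum_range_succ] at hp
          have h27' : (addSizes.run u).reg 27 =
              (n + ∑ x ∈ Finset.range k, ∑ y ∈ Finset.range n, f x y +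
          ∑ y ∈ Finset.range (m + 1), f k y : ℕ) := by
            rw [hr.2, hes, h27u, Finset.sum_range_succ]; push_cast; ring
          -- Inside `addSizes` the bound `Bdd D` may fail, since register `28` holds an input entry;
          -- it is restored because `addSize` leaves that register at `0`.
          refine ⟨⟨h27', ⟨hb.one_le, fun i => ?_, fun a ha' x y => ?_, fun a ha' x y => ?_⟩, hr.1⟩,
            addSizes_cost (by rw [h27u]; positivity) (by rw [hes, h27u]; norm_cast; omega) hbu⟩
          · by_cases hi : i = 27
            · rw [hi, h27', abs_of_nonneg (by positivity)]
              exact_mod_cast hpart k hk m hm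
            · by_cases hi' : i = 28
              · rw [hi', hr.1]; simp
              · rw [Cmd.run_reg (P := addSizes)
                  (by simp [addSizes, Cmd.modReg]; omega)]
                exact hbu.reg i
          · rw [Cmd.run_arr (P := addSizes) rfl]; exact hbu.arr a ha' x y
          · rw [Cmd.run_arr (P := addSizes) rfl]; exact hbu.arr_len a ha' x y)
      refine ⟨?_, hcost'⟩
      rw [hs'']
      refine ⟨?_, hI'.2.1.setReg 30 hnD', by simpa using hI'.2.2⟩
      rw [State.setReg_reg_of_ne _ _ _ _ (by norm_num), hI'.1, Finset.sum_range_succ, add_assoc])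
  have hrun : inputSize.run s = s'.setReg 29 n := hs'
  have hc : inputSize.cost s = (len (s.reg 0) + len (s.reg 0)) +
    (Cmd.for_ 29 0 (Cmd.for_ 30 0 addSizes)).cost s₀ := rfl
  refine ⟨by rw [hrun, State.setReg_reg_of_ne _ _ _ _ (by norm_num), hI.1],
    hrun ▸ hI.2.1.setReg 29 hnD', ?_⟩
  have h1 := len_le_of_abs_le (hb.reg 0)
  have h2 : c₁ ≤ D * (c₀ + (11 * D + 21)) + (4 * D + 8) := by
    rw [hc₁]; gcongr
  have h3 : n * (c₁ + (11 * n + 21)) + (4 * n + 8) ≤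
      D * (D * (c₀ + (11 * D + 21)) + (4 * D + 8) + (11 * D + 21)) + (4 * D + 8) := by
    gcongr
  have h4 : inputSizePoly.eval D = 2 * D + 2 + (D * (D * (c₀ + (11 * D + 21)) + (4 * D + 8) +
      (11 * D + 21)) + (4 * D + 8)) := by
    simp [inputSizePoly, hc₀]
  rw [hc, h4]
  omega

end RAM

/-! ### The encoded input, denominators and the prime bound. -/

namespace RAM

section Input

variable {n : ℕ}

theorem input_arr_zero (A : Matrix (Fin n) (Fin n) ℚ) :
    (input A).arr 0 = matrixCells (A.map fun q => q.num) := rfl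

theorem input_arr_one (A : Matrix (Fin n) (Fin n) ℚ) :
    (input A).arr 1 = matrixCells (A.map fun q => (q.den : ℤ)) := rfl

theorem matrixCells_apply (M : Matrix (Fin n) (Fin n) ℤ) (i j : Fin n) :
    matrixCells M i j = M i j := by
  simp [matrixCells]

theorem len_matrixCells_le {M : Matrix (Fin n) (Fin n) ℤ} {D : ℕ} (hD : 1 ≤ D)
    (h : ∀ i j, len (M i j) ≤ D) (x y : ℤ) : len (matrixCells M x y) ≤ D := by
  rw [matrixCells]
  split_ifs
  · exact h _ _
  · exact hD

theorem len_add_len_le_bits (A : Matrix (Fin n) (Fin n) ℚ) (i j : Fin n) :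
    len (A i j).num + len ((A i j).den : ℤ) ≤ bits A :=
  (Finset.single_le_sum (f := fun j => len (A i j).num + len ((A i j).den : ℤ))
    (fun _ _ => Nat.zero_le _) (Finset.mem_univ j)).trans
    (Finset.single_le_sum (f := fun i => ∑ j, (len (A i j).num + len ((A i j).den : ℤ)))
      (fun _ _ => Nat.zero_le _) (Finset.mem_univ i))

/-- The factor `2` makes room for `entryBits`, in which sizes of squares are summed. -/
theorem bdd_input (A : Matrix (Fin n) (Fin n) ℚ) : Bdd (2 * (n + bits A) + 1) (input A) where
  one_le := by omega
  reg i := by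
    simp only [input]
    split_ifs
    · rw [abs_of_nonneg (by positivity)]; norm_cast; omega
    · simp; positivity
  arr a ha x y := by
    have h0 : a ≠ 0 := by omega
    have h1 : a ≠ 1 := by omega
    simp only [input, if_neg h0, if_neg h1]
    simp; positivity
  arr_len a ha x y := by
    interval_cases a
    · refine len_matrixCells_le (by omega) (fun i j => ?_) x y
      have := len_add_len_le_bits A i j
      simp only [Matrix.map_apply]; omega
    · refine len_matrixCells_le (by omega) (fun i j => ?_) x y
      have := len_add_len_le_bits A i j
      simp only [Matrix.map_apply]; omega

/-- The logarithm of a bound for the entries after clearing denominators. -/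
def entryBits (A : Matrix (Fin n) (Fin n) ℚ) : ℕ :=
  ∑ i, ∑ j, (sqSize (A i j).num + sqSize ((A i j).den : ℤ))

theorem entryBits_le (A : Matrix (Fin n) (Fin n) ℚ) : entryBits A ≤ 2 * bits A := by
  rw [entryBits, bits, Finset.mul_sum]
  refine Finset.sum_le_sum fun i _ => ?_
  rw [Finset.mul_sum]
  refine Finset.sum_le_sum fun j _ => ?_
  have := sqSize_le (A i j).num
  have := sqSize_le ((A i j).den : ℤ)
  omega

theorem sum_entrySize (A : Matrix (Fin n) (Fin n) ℚ) :
    ∑ x ∈ Finset.range n, ∑ y ∈ Finset.range n, entrySize (input A) x y = entryBits A := by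
  rw [Finset.sum_range, entryBits]
  refine Finset.sum_congr rfl fun i _ => ?_
  rw [Finset.sum_range]
  refine Finset.sum_congr rfl fun j _ => ?_
  rw [entrySize, input_arr_zero, input_arr_one, matrixCells_apply, matrixCells_apply]
  rfl

theorem primeBound_mono {v w : ℕ} (h : v ≤ w) : primeBound v ≤ primeBound w := by
  rw [primeBound, primeBound]; gcongr

theorem lt_primeBound (w : ℕ) : w + 1 < primeBound w := by
  rw [primeBound]
  have h1 : w + 2 ≤ (w + 2) ^ 3 := Nat.le_self_pow (by norm_num) _
  have h2 : (w + 2) ^ 3 + 1 ≤ ((w + 2) ^ 3 + 1) ^ 2 := Nat.le_self_pow (by norm_num) _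
  omega

open Polynomial in
theorem exists_poly_setPrimeBound : ∃ q : Polynomial ℕ, ∀ (n : ℕ) (A : Matrix (Fin n) (Fin n) ℚ),
    (setPrimeBound.run (input A)).reg 0 = n ∧
    (setPrimeBound.run (input A)).reg 1 = (primeBound (n + entryBits A) : ℕ) ∧
    (setPrimeBound.run (input A)).arr = (input A).arr ∧
    Bdd (primeBound (2 * (n + bits A) + 1)) (setPrimeBound.run (input A)) ∧
    setPrimeBound.cost (input A) ≤ q.eval (n + bits A) := by
  obtain ⟨q, hq⟩ := primeBoundExpr.exists_poly
  refine ⟨(inputSizePoly + (q + q)).comp (2 * X + 1), fun n A => ?_⟩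
  set D := 2 * (n + bits A) + 1 with hD
  have hle := entryBits_le A
  obtain ⟨h27, hb, hc⟩ := inputSize_run (s := input A) (n := n) rfl (bdd_input A) rfl
    (by rw [sum_entrySize]; omega)
  rw [sum_entrySize] at h27
  set s := inputSize.run (input A) with hs
  have hrun : setPrimeBound.run (input A) = s.setReg 1 (primeBound (n + entryBits A) : ℕ) := by
    rw [← eval_primeBoundExpr h27]; rfl
  have hmono : D ≤ primeBound D := (Nat.le_succ D).trans (lt_primeBound D).le
  have hb' : Bdd (primeBound D) s :=
    { one_le := hb.one_le.trans hmono
      reg := fun i => (hb.reg i).trans (by exact_mod_cast hmono)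
      arr := fun a ha x y => (hb.arr a ha x y).trans (by exact_mod_cast hmono)
      arr_len := fun a ha x y => (hb.arr_len a ha x y).trans hmono }
  rw [hrun]
  refine ⟨?_, State.setReg_reg_self _ _ _, ?_, hb'.setReg 1 ?_, ?_⟩
  · rw [State.setReg_reg_of_ne _ _ _ _ (by norm_num), hs, Cmd.run_reg (P := inputSize) rfl]; rfl
  · rw [State.setReg_arr]; exact funext fun a => Cmd.run_arr (P := inputSize) rfl _
  · rw [Nat.abs_cast, Nat.cast_le]
    exact primeBound_mono (by omega)
  · have h1 := hq D s hb
    have hcost : setPrimeBound.cost (input A) = inputSize.cost (input A) +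
        (primeBoundExpr.cost s + len (primeBoundExpr.eval s)) := rfl
    rw [hcost]
    simp only [eval_comp, eval_add, eval_mul, eval_ofNat, eval_X, eval_one]
    rw [← hD] at hc ⊢
    omega

/-- The input matrix with cleared denominators. -/
def clearedInput (A : Matrix (Fin n) (Fin n) ℚ) : Matrix (Fin n) (Fin n) ℤ :=
  clearDenominators (fun i j => (A i j).num) (fun i j => ((A i j).den : ℤ))

/-- Omitting the own denominator of an entry amounts to multiplying that entry by the product of all
of them. The matrix is thus a nonzero multiple of `A` and has the same controllable subspaces. -/
theorem clearedInput_map (A : Matrix (Fin n) (Fin n) ℚ) :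
    (clearedInput A).map (Int.cast : ℤ → ℝ) =
      (∏ k, ∏ l, ((A k l).den : ℝ)) • A.map fun q => (q : ℝ) := by
  ext i j
  have hden : ((A i j).den : ℝ) ≠ 0 := by exact_mod_cast (A i j).den_ne_zero
  simp only [clearedInput, clearDenominators, Matrix.map_apply, Matrix.of_apply, Matrix.smul_apply,
    smul_eq_mul, ← Finset.prod_product']
  push_cast
  rw [← Finset.mul_prod_erase _ _ (Finset.mem_product.2 ⟨Finset.mem_univ i, Finset.mem_univ j⟩ :
      (i, j) ∈ Finset.univ ×ˢ Finset.univ),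
    ← Finset.mul_prod_erase _ (fun x : Fin n × Fin n => ((A x.1 x.2).den : ℝ))
      (Finset.mem_product.2 ⟨Finset.mem_univ i, Finset.mem_univ j⟩ :
      (i, j) ∈ Finset.univ ×ˢ Finset.univ)]
  have hprod : ∏ x ∈ (Finset.univ ×ˢ Finset.univ).erase (i, j),
      (if x.1 = i ∧ x.2 = j then (1 : ℝ) else ((A x.1 x.2).den : ℝ)) =
      ∏ x ∈ (Finset.univ ×ˢ Finset.univ).erase (i, j), ((A x.1 x.2).den : ℝ) :=
    Finset.prod_congr rfl fun x hx => if_neg fun h =>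
      (Finset.mem_erase.1 hx).1 (Prod.ext h.1 h.2)
  rw [hprod]
  have hA : ((A i j : ℚ) : ℝ) = (A i j).num / (A i j).den := Rat.cast_def _
  rw [hA]
  simp only [and_self, if_true]
  field_simp

/-- Each factor is at most two to the power of its `sqSize`, and the exponents add up. So the
register computed by `inputSize` is exactly the parameter `w` for `exists_good_prime`. -/
theorem abs_clearedInput_le (A : Matrix (Fin n) (Fin n) ℚ) (i j : Fin n) :
    |clearedInput A i j| ≤ 2 ^ entryBits A := by
  simp only [clearedInput, clearDenominators, Matrix.of_apply, entryBits,
    ← Finset.prod_product', ← Finset.sum_product']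
  have hmem : (i, j) ∈ (Finset.univ : Finset (Fin n)) ×ˢ (Finset.univ : Finset (Fin n)) :=
    Finset.mem_product.2 ⟨Finset.mem_univ i, Finset.mem_univ j⟩
  rw [← Finset.mul_prod_erase _ _ hmem, ← Finset.prod_pow_eq_pow_sum,
    ← Finset.mul_prod_erase _ _ hmem, abs_mul, abs_mul, Finset.abs_prod]
  have hz : ∀ z : ℤ, |z| ≤ 2 ^ sqSize z := fun z => by
    have := natAbs_le_two_pow_sqSize z
    rw [Int.abs_eq_natAbs]; exact_mod_cast this
  have hone : ∀ k, (1 : ℤ) ≤ 2 ^ k := fun k => one_le_pow₀ (by norm_num)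
  simp only [and_self, if_true, abs_one, one_mul]
  refine mul_le_mul ?_ (Finset.prod_le_prod (fun _ _ => abs_nonneg _) fun x _ => ?_)
    (Finset.prod_nonneg fun _ _ => abs_nonneg _) (by positivity)
  · rw [pow_add]
    exact (hz _).trans (le_mul_of_one_le_right (by positivity) (hone _))
  · rw [pow_add]
    refine le_trans ?_ (le_mul_of_one_le_left (by positivity) (hone _))
    split_ifs
    · simpa using hone _
    · exact hz _

theorem Kry_clearedInput {ι : Type*} (A : Matrix (Fin n) (Fin n) ℚ) (B : Matrix (Fin n) ι ℝ) :
    Kry ((clearedInput A).map (Int.cast : ℤ → ℝ)) B = Kry (A.map fun q => (q : ℝ)) B := by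
  rw [clearedInput_map, Kry_smul]
  exact Finset.prod_ne_zero_iff.2 fun k _ => Finset.prod_ne_zero_iff.2 fun l _ => by
    exact_mod_cast (A k l).den_ne_zero

end Input

/-! ### The logarithmic factor and the final assembly. -/

theorem exists_greedy_length {n m : ℕ} (hn : 1 ≤ n) (hm : 1 ≤ m) :
    ∃ k : ℕ, n * (m - 1) ^ k < m ^ k ∧ (k : ℝ) ≤ m * Real.log n + 1 := by
  have hn' : (1 : ℝ) ≤ n := by exact_mod_cast hn
  have hm' : (0 : ℝ) < m := by exact_mod_cast hm
  have hlog : 0 ≤ Real.log n := Real.log_nonneg hn'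
  -- The least integer above `m log n`, for which `n (1 - 1/m)^k ≤ n exp(-k/m) < 1`.
  refine ⟨⌊m * Real.log n⌋₊ + 1, ?_, ?_⟩
  · set k := ⌊m * Real.log n⌋₊ + 1 with hk
    have h1 : m * Real.log n < k := by rw [hk]; push_cast; exact Nat.lt_floor_add_one _
    have h2 : (1 - (m : ℝ)⁻¹) ≤ Real.exp (-(m : ℝ)⁻¹) := Real.one_sub_le_exp_neg _
    have h0 : 0 ≤ 1 - (m : ℝ)⁻¹ := by
      have : (m : ℝ)⁻¹ ≤ 1 := inv_le_one_of_one_le₀ (by exact_mod_cast hm)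
      linarith
    have h3 : (1 - (m : ℝ)⁻¹) ^ k ≤ Real.exp (-(k / m)) := by
      refine (pow_le_pow_left₀ h0 h2 k).trans (le_of_eq ?_)
      rw [← Real.exp_nat_mul]; congr 1; ring
    have h4 : Real.log n < k / m := by rw [lt_div_iff₀ hm']; linarith
    have h5 : n * (1 - (m : ℝ)⁻¹) ^ k < 1 := by
      calc _ ≤ n * Real.exp (-(k / m)) := by gcongr
        _ < n * Real.exp (-Real.log n) := by gcongr
        _ = 1 := by rw [Real.exp_neg, Real.exp_log (by linarith)]; field_simp
    have h6 : ((n * (m - 1) ^ k : ℕ) : ℝ) = n * (1 - (m : ℝ)⁻¹) ^ k * m ^ k := by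
      rw [mul_assoc, ← mul_pow, sub_mul, inv_mul_cancel₀ hm'.ne', one_mul]
      push_cast [Nat.cast_sub hm]; ring
    have h7 : ((n * (m - 1) ^ k : ℕ) : ℝ) < (m ^ k : ℕ) := by
      rw [h6]; push_cast
      exact mul_lt_of_lt_one_left (by positivity) h5
    exact_mod_cast h7
  · push_cast
    have := Nat.floor_le (mul_nonneg hm'.le hlog)
    linarith

/-- The rounding term is absorbed by `1 ≤ log n / log 2`; hence the constant and the restriction to
`n ≥ 2`. -/
theorem add_one_le_const_mul {n m : ℕ} (hn : 2 ≤ n) (hm : 1 ≤ m) :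
    m * Real.log n + 1 ≤ (1 + (Real.log 2)⁻¹) * Real.log n * m := by
  have h2 : 0 < Real.log 2 := Real.log_pos (by norm_num)
  have hn2 : Real.log 2 ≤ Real.log n := Real.log_le_log (by norm_num) (by exact_mod_cast hn)
  have h3 : 1 ≤ (Real.log 2)⁻¹ * Real.log n := by
    rw [inv_mul_eq_div, one_le_div h2]; exact hn2
  have hm' : (1 : ℝ) ≤ m := by exact_mod_cast hm
  nlinarith

theorem hammingNorm_pos_of_Kry_eq_top {F : Type*} [Field F] [DecidableEq F] {n : ℕ} (hn : 1 ≤ n)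
    {isVec : Bool} {A : Matrix (Fin n) (Fin n) F} {b : Fin n → F}
    (hb : Kry A (inject isVec b) = ⊤) : 1 ≤ hammingNorm b := by
  refine hammingNorm_pos_iff.2 ?_
  rintro rfl
  have h := (krank_eq_iff isVec A 0).2 hb
  rw [krank_zero] at h
  omega

/-- The program runs in polynomial time and computes an integer solution of small weight. -/
theorem controlProgram_spec (isVec : Bool) : ∃ p : Polynomial ℕ,
    ∀ (n : ℕ) (A : Matrix (Fin n) (Fin n) ℚ), ∃ (t : ℕ) (s : State),
      Exec (controlProgram isVec).compile (input A) t s ∧ t ≤ p.eval (n + bits A) ∧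
      ∀ b : Fin n → ℝ, Kry (A.map fun q => (q : ℝ)) (inject isVec b) = ⊤ →
        ∃ b' : Fin n → ℤ, (∀ i j : Fin n, s.arr 2 i j = inject isVec b' i j) ∧
          Kry (A.map fun q => (q : ℝ)) (inject isVec fun i => (b' i : ℝ)) = ⊤ ∧
          (2 ≤ n → (hammingNorm b' : ℝ) ≤ (1 + (Real.log 2)⁻¹) * Real.log n * hammingNorm b) := by
  obtain ⟨q₁, hq₁⟩ := exists_poly_setPrimeBound
  obtain ⟨q₂, hq₂⟩ := (tryPrimes_safe isVec).exists_poly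
  -- The search runs in a memory bounded by the prime bound, which is itself polynomial in the input
  -- size, so the running times compose.
  obtain ⟨q₃, hq₃⟩ : ∃ q : Polynomial ℕ, ∀ x, q.eval x = primeBound (2 * x + 1) := by
    open Polynomial in
    refine ⟨16 * ((2 * X + 1 + 2) ^ 3 + 1) ^ 2 + 1, fun x => ?_⟩
    simp [primeBound]
  refine ⟨q₁ + q₂.comp q₃, fun n A => ?_⟩
  obtain ⟨h0, h1, harr, hbdd, hcost⟩ := hq₁ n A
  set s₁ := setPrimeBound.run (input A) with hs₁
  obtain ⟨t, ht, hex⟩ := Cmd.exec (controlProgram_wf isVec) (input A)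
  refine ⟨t, _, hex, ?_, fun b hb => ?_⟩
  · have hc : (controlProgram isVec).cost (input A) =
      setPrimeBound.cost (input A) + (tryPrimes isVec).cost s₁ := rfl
    have h2 := (hq₂ _ _ hbdd).2
    rw [Polynomial.eval_add, Polynomial.eval_comp, hq₃]
    omega
  · have hrun : (controlProgram isVec).run (input A) = (tryPrimes isVec).run s₁ := rfl
    rw [hrun]
    set w := n + entryBits A with hw
    have hlt := lt_primeBound w
    obtain ⟨best, -, hcur, hopt⟩ := tryPrimes_run isVec (A := clearedInput A) (s := s₁)
      (n := n) (N := primeBound w)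
      (by
        rw [clearedInput, harr, input_arr_zero, input_arr_one]
        congr 1 <;> funext i j <;> rw [matrixCells_apply] <;> rfl) h0 h1 (by omega)
    simp only [Kry_clearedInput] at hcur
    rcases Nat.eq_zero_or_pos n with rfl | hn
    · exact ⟨0, fun i => i.elim0, Subsingleton.elim _ _, fun h => absurd h (by norm_num)⟩
    have hm := hammingNorm_pos_of_Kry_eq_top hn hb
    obtain ⟨p, hp, hnp, hpw, hc⟩ := exists_good_prime (w := w) isVec (clearedInput A)
      (abs_clearedInput_le A) le_rfl b (by rw [Kry_clearedInput]; exact hb)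
    obtain ⟨k, hk, hkle⟩ := exists_greedy_length hn hm
    obtain ⟨hbk, hbn⟩ := hopt p hpw hp hnp (hammingNorm b) k hk hc
    rcases hcur with hN | ⟨b', hout, hK, hham⟩
    -- A good prime gives `best ≤ n`, so the initial value `N` has been replaced.
    · omega
    refine ⟨b', hout, hK, fun hn2 => ?_⟩
    have h3 : (hammingNorm b' : ℝ) ≤ k := by exact_mod_cast hham.trans hbk
    exact h3.trans (hkle.trans (add_one_le_const_mul hn2 hm))

end RAM

/-- One column and `n` equal columns generate the same subspace, which links the scalar input to the
square matrices used by the program. -/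
theorem mem_controllingVectors_iff {n : ℕ} {A : Matrix (Fin n) (Fin n) ℝ} {b : Fin n → ℝ} :
    b ∈ controllingVectors A ↔ Kry A (inject true b) = ⊤ := by
  have h : Kry A (Matrix.replicateCol (Fin 1) b) = cyc A b := by
    simp only [Kry, ciSup_unique]
    rfl
  rw [controllingVectors, Set.mem_ofPred_eq, controllable_iff, h, Kry_inject_vec]

theorem eq_inject_diag {n : ℕ} {B : Matrix (Fin n) (Fin n) ℝ} (h : B.IsDiag) :
    B = inject false B.diag := by
  ext i j
  by_cases hij : i = j
  · subst hij; simp [inject]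
  · simp [inject, hij, h hij]

theorem mem_controllingDiagonals_iff {n : ℕ} {A : Matrix (Fin n) (Fin n) ℝ} {b : Fin n → ℝ} :
    inject false b ∈ controllingDiagonals A ↔ Kry A (inject false b) = ⊤ := by
  rw [controllingDiagonals, Set.mem_ofPred_eq, controllable_iff, and_iff_right]
  intro i j hij
  simp [inject, hij]

theorem hammingNorm_intCast {n : ℕ} (b : Fin n → ℤ) :
    hammingNorm (fun i => (b i : ℝ)) = hammingNorm b := by
  simp [hammingNorm]

theorem matNonzeros_inject {n : ℕ} (b : Fin n → ℝ) :
    matNonzeros (inject false b) = hammingNorm b := by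
  rw [matNonzeros, hammingNorm, hammingNorm]
  symm
  refine Finset.card_bij (fun i _ => (i, i)) ?_ ?_ ?_
  · intro i hi; simpa [inject] using hi
  · intro i _ j _ h; exact (Prod.ext_iff.1 h).1
  · rintro ⟨i, j⟩ hij
    have h : i = j ∧ b i ≠ 0 := by simpa [inject] using hij
    obtain ⟨rfl, h⟩ := h
    exact ⟨i, by simpa using h, rfl⟩

theorem theorem2 :
    (∃ c : ℝ, 0 < c ∧ ∃ (P : RAM.Program) (p : Polynomial ℕ),
      ∀ (n : ℕ) (A : Matrix (Fin n) (Fin n) ℚ),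
        ∃ (t : ℕ) (s : RAM.State), RAM.Exec P (RAM.input A) t s ∧
          t ≤ p.eval (n + RAM.bits A) ∧
          ((controllingVectors (A.map fun q => (q : ℝ))).Nonempty →
            RAM.outputVec n s ∈ controllingVectors (A.map fun q => (q : ℝ)) ∧
            (2 ≤ n → ∀ b ∈ controllingVectors (A.map fun q => (q : ℝ)),
              (vecNonzeros (RAM.outputVec n s) : ℝ) ≤ c * Real.log n * vecNonzeros b))) ∧
    (∃ c : ℝ, 0 < c ∧ ∃ (P : RAM.Program) (p : Polynomial ℕ),
      ∀ (n : ℕ) (A : Matrix (Fin n) (Fin n) ℚ),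
        ∃ (t : ℕ) (s : RAM.State), RAM.Exec P (RAM.input A) t s ∧
          t ≤ p.eval (n + RAM.bits A) ∧
          ((controllingDiagonals (A.map fun q => (q : ℝ))).Nonempty →
            RAM.outputMat n s ∈ controllingDiagonals (A.map fun q => (q : ℝ)) ∧
            (2 ≤ n → ∀ B ∈ controllingDiagonals (A.map fun q => (q : ℝ)),
              (matNonzeros (RAM.outputMat n s) : ℝ) ≤ c * Real.log n * matNonzeros B))) := by
  have hc : 0 < 1 + (Real.log 2)⁻¹ := by
    have : 0 < Real.log 2 := Real.log_pos (by norm_num)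
    positivity
  constructor
  · obtain ⟨p, hp⟩ := RAM.controlProgram_spec true
    refine ⟨_, hc, (RAM.controlProgram true).compile, p, fun n A => ?_⟩
    obtain ⟨t, s, hex, ht, h⟩ := hp n A
    refine ⟨t, s, hex, ht, ?_⟩
    have key : ∀ b ∈ controllingVectors (A.map fun q => (q : ℝ)),
        RAM.outputVec n s ∈ controllingVectors (A.map fun q => (q : ℝ)) ∧ (2 ≤ n →
          (vecNonzeros (RAM.outputVec n s) : ℝ) ≤
            (1 + (Real.log 2)⁻¹) * Real.log n * vecNonzeros b) := by
      intro b hb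
      obtain ⟨b', hout, hK, hham⟩ := h b (mem_controllingVectors_iff.1 hb)
      have hvec : RAM.outputVec n s = fun i => (b' i : ℝ) := by
        funext i
        -- All columns of the output array agree in the vector case; the result is read from column
        -- `0`.
        have h0 := hout i ⟨0, i.pos⟩
        simp only [inject, Matrix.of_apply, true_or, if_true] at h0
        rw [RAM.outputVec, ← h0]; rfl
      rw [hvec]
      refine ⟨mem_controllingVectors_iff.2 hK, fun hn => ?_⟩
      rw [vecNonzeros, vecNonzeros, hammingNorm_intCast]
      exact hham hn
    exact fun ⟨b, hb⟩ => ⟨(key b hb).1, fun hn b hb => (key b hb).2 hn⟩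
  · obtain ⟨p, hp⟩ := RAM.controlProgram_spec false
    refine ⟨_, hc, (RAM.controlProgram false).compile, p, fun n A => ?_⟩
    obtain ⟨t, s, hex, ht, h⟩ := hp n A
    refine ⟨t, s, hex, ht, ?_⟩
    have key : ∀ B ∈ controllingDiagonals (A.map fun q => (q : ℝ)),
        RAM.outputMat n s ∈ controllingDiagonals (A.map fun q => (q : ℝ)) ∧ (2 ≤ n →
          (matNonzeros (RAM.outputMat n s) : ℝ) ≤
            (1 + (Real.log 2)⁻¹) * Real.log n * matNonzeros B) := by
      intro B hB
      obtain ⟨d, rfl⟩ : ∃ d, B = inject false d := ⟨_, eq_inject_diag hB.1⟩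
      obtain ⟨b', hout, hK, hham⟩ := h d (mem_controllingDiagonals_iff.1 hB)
      have hmat : RAM.outputMat n s = inject false fun i => (b' i : ℝ) := by
        ext i j
        rw [RAM.outputMat, Matrix.of_apply, hout i j]
        simp only [inject, Matrix.of_apply]
        split_ifs <;> simp
      rw [hmat]
      refine ⟨mem_controllingDiagonals_iff.2 hK, fun hn => ?_⟩
      rw [matNonzeros_inject, matNonzeros_inject, hammingNorm_intCast]
      exact hham hn
    exact fun ⟨B, hB⟩ => ⟨(key B hB).1, fun hn B hB => (key B hB).2 hn⟩
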